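/- Consider a static spacetime in adapted coordinates $(t,x)\in\mathbb R\times\Omega$, $\Omega\subseteq\mathbb R^3$ open, with smooth metric $g=-V(x)^2\,dt^2+h_x$ ($V>0$, $h_x$ positive definite; units $c=1$). An \emph{open machine} is a smooth timelike future-pointing worldline parametrized by the readings $\zeta\in\mathbb R$ of its clock, with ticks at the integers. Signals are future-pointing null geodesics inside a given region. Two machines $A,B$ have a \emph{two-way null-phase channel with echo count $2N$} if, in each direction, the set of pairs (reading at transmission, reading at reception), for transmissions at all ticks, is exactly $\{(k,k+N): k\in\mathbb Z\}$; thus a signal sent at any tick $k$ and echoed at once returns at reading $k+2N$. For $x_0\in\Omega$ let $B_r=\{x: h_{x_0}(x-x_0,x-x_0)<r^2\}$. The spacetime is \emph{gently curved about $x_0$ on the scale $L$ with tolerance $\varepsilon$} if $B_{2L}\subseteq\Omega$ and, on $B_{2L}$ and for all vectors $a,b,u$ of $h_{x_0}$-norm at most $1$, $$L|\partial_aV|\le\varepsilon V(x_0),\quad L^2|\partial_a\partial_bV|\le\varepsilon V(x_0),\quad L|\partial_a h(u,u)|\le\varepsilon,\quad L^2|\partial_a\partial_b h(u,u)|\le\varepsilon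 .$$ There is a universal constant $\varepsilon>0$ with the following property. Let $N\ge 1$ be an integer and $p_\tau>0$, and suppose that a static spacetime is gently curved about $x_0$ on the scale $L=Np_\tau$ with tolerance $\varepsilon$. Let signals be those in the region $\mathbb R\times B_{2L}$. Call four open machines $V_1,\dots,V_4$ at fixed space coordinates $x_1=x_0,x_2,x_3,x_4$, with $V_1$ stepped with proper period $p_\tau$ and all six pairs linked by two-way null-phase channels with echo count $2N$, a \emph{tetrahedral arrangement}. (1) Tetrahedral arrangements exist. (2) For every tetrahedral arrangement and every choice of three of its machines, with $V_l$ the remaining one, there is a fifth open machine $V_5$ at fixed space coordinates $x_5$ that has a two-way null-phase channel with echo count $2N$ to each of the three chosen machines. The point $x_5$ lies strictly on the opposite side from $x_l$ of the coordinate plane through the positions of the three chosen machines. The five machines are pairwise radar linkable in $\mathbb R\times B_{2L}$ (each event of one machine is joined to the worldline of another by exactly one future-pointing and exactly one past-pointing null geodesic in the region), and exactly nine of the ten pairs of machines have two-way null-phase channels with echo count $2N$. -/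

import Mathlib

open Set
open scoped ContDiff

noncomputable section

/-- The coordinate space of the three space coordinates. -/
abbrev Space3 : Type := EuclideanSpace ℝ (Fin 3)

/-- Spacetime coordinates `(t, x)`. -/
abbrev Event : Type := ℝ × Space3

/-- A static spacetime in adapted coordinates: the manifold `ℝ × dom`, with `dom` open in the
coordinate space, and the Lorentzian metric `- lapse(x)² dt² + h_x`, whose components do not
depend on `t` and which has no mixed time-space components. Units with `c = 1`. -/
structure StaticSpacetime where
  dom : Set Space3
  isOpen_dom : IsOpen dom
  lapse : Space3 → ℝ
  h : Space3 → Space3 →L[ℝ] Space3 →L[ℝ] ℝ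
  lapse_smooth : ContDiffOn ℝ ∞ lapse dom
  h_smooth : ContDiffOn ℝ ∞ h dom
  lapse_pos : ∀ x ∈ dom, 0 < lapse x
  h_symm : ∀ x ∈ dom, ∀ v w, h x v w = h x w v
  h_pos : ∀ x ∈ dom, ∀ v, v ≠ 0 → 0 < h x v v

namespace StaticSpacetime

/-- The Lorentzian metric tensor field `- lapse² dt² + h`. -/
def metric (S : StaticSpacetime) (e : Event) : Event →L[ℝ] Event →L[ℝ] ℝ :=
  (-(S.lapse e.2) ^ 2) •
      (ContinuousLinearMap.mul ℝ ℝ).bilinearComp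
        (ContinuousLinearMap.fst ℝ ℝ Space3) (ContinuousLinearMap.fst ℝ ℝ Space3) +
    (S.h e.2).bilinearComp
      (ContinuousLinearMap.snd ℝ ℝ Space3) (ContinuousLinearMap.snd ℝ ℝ Space3)

theorem metric_apply (S : StaticSpacetime) (e v w : Event) :
    S.metric e v w = -(S.lapse e.2) ^ 2 * (v.1 * w.1) + S.h e.2 v.2 w.2 := by
  simp [metric]

end StaticSpacetime

/-- `γ`, restricted to `[0, 1]`, is a geodesic of the metric tensor field `g`, affinely
parametrized, that stays in `V`. The geodesic equation is written with its free index lowered,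
`g_{lk} γ''^k + ½ (∂_i g_{jl} + ∂_j g_{il} - ∂_l g_{ij}) γ'^i γ'^j = 0`, contracted with an
arbitrary vector `w`. Solutions of class `C²` are automatically smooth. -/
structure IsGeodesicIn (g : Event → Event →L[ℝ] Event →L[ℝ] ℝ) (V : Set Event)
    (γ : ℝ → Event) : Prop where
  smooth : ContDiffOn ℝ 2 γ (Icc 0 1)
  mem : ∀ s ∈ Icc (0 : ℝ) 1, γ s ∈ V
  equation : ∀ s ∈ Icc (0 : ℝ) 1, ∀ w : Event,
    g (γ s) (derivWithin (derivWithin γ (Icc 0 1)) (Icc 0 1) s) w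
      + fderiv ℝ (fun e => g e (derivWithin γ (Icc 0 1) s) w) (γ s) (derivWithin γ (Icc 0 1) s)
      - (1 / 2) *
        fderiv ℝ (fun e => g e (derivWithin γ (Icc 0 1) s) (derivWithin γ (Icc 0 1) s)) (γ s) w
      = 0

/-- A signal in `V` from the event `a` to the event `b`: a future-pointing null geodesic. -/
structure IsSignal (S : StaticSpacetime) (V : Set Event) (a b : Event) (γ : ℝ → Event) :
    Prop where
  geodesic : IsGeodesicIn S.metric V γ
  null : ∀ s ∈ Icc (0 : ℝ) 1,
    S.metric (γ s) (derivWithin γ (Icc 0 1) s) (derivWithin γ (Icc 0 1) s) = 0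
  future : ∀ s ∈ Icc (0 : ℝ) 1, 0 < (derivWithin γ (Icc 0 1) s).1
  source : γ 0 = a
  target : γ 1 = b

/-- An open machine, represented as a smooth timelike future-pointing worldline parametrized by
the readings of its clock; the reading `m.φ` is the real number `m + φ`. -/
structure OpenMachine (S : StaticSpacetime) where
  event : ℝ → Event
  smooth : ContDiff ℝ ∞ event
  mem : ∀ ζ, (event ζ).2 ∈ S.dom
  timelike : ∀ ζ, S.metric (event ζ) (deriv event ζ) (deriv event ζ) < 0
  future : ∀ ζ, 0 < (deriv event ζ).1

namespace OpenMachine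

variable {S : StaticSpacetime}

/-- The machine is located at the fixed space coordinates `x`. -/
def LocatedAt (A : OpenMachine S) (x : Space3) : Prop := ∀ ζ, (A.event ζ).2 = x

/-- Proper time along the worldline between two clock readings. -/
def properTime (A : OpenMachine S) (ζ ζ' : ℝ) : ℝ :=
  ∫ z in ζ..ζ', Real.sqrt (-(S.metric (A.event z) (deriv A.event z) (deriv A.event z)))

/-- The clock ticks with proper period `p`. -/
def HasProperPeriod (A : OpenMachine S) (p : ℝ) : Prop :=
  ∀ k : ℤ, A.properTime k (k + 1) = p

/-- A signal in `V` transmitted at the `A`-reading `ζ` is received at the `B`-reading `ξ`. -/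
def Reaches (V : Set Event) (A B : OpenMachine S) (ζ ξ : ℝ) : Prop :=
  ∃ γ, IsSignal S V (A.event ζ) (B.event ξ) γ

/-- The channel from `A` to `B` for transmission at all ticks of `A` (readings `k.0`): the set of
pairs (`A`-reading at transmission, `B`-reading at reception). -/
def channel (V : Set Event) (A B : OpenMachine S) : Set (ℝ × ℝ) :=
  {q | (∃ k : ℤ, q.1 = k) ∧ Reaches V A B q.1 q.2}

/-- The echo count `Δ_{ABA}` is `n`: a signal transmitted at any tick `k` of `A` and echoed by `B`
without delay returns to `A` at the reading `k + n`, and at no other. -/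
def HasEchoCount (V : Set Event) (A B : OpenMachine S) (n : ℕ) : Prop :=
  ∀ k : ℤ, {ζ : ℝ | ∃ ξ, Reaches V A B k ξ ∧ Reaches V B A ξ ζ} = {(k : ℝ) + n}

/-- The two-way null-phase channel with echo counts `2 N`: in both directions the channel is
`{(k.0, (k + N).0) | k ∈ ℤ}`. -/
structure TwoWayChannel (V : Set Event) (N : ℕ) (A B : OpenMachine S) : Prop where
  forth : channel V A B = {q | ∃ k : ℤ, q = ((k : ℝ), (k : ℝ) + N)}
  back : channel V B A = {q | ∃ k : ℤ, q = ((k : ℝ), (k : ℝ) + N)}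
  echo_forth : HasEchoCount V A B (2 * N)
  echo_back : HasEchoCount V B A (2 * N)

/-- `A` and `B` are radar linkable in `U`, relative to the larger region `V`: each event of `A` in
`U` is reached by exactly one future-pointing and exactly one past-pointing null geodesic in `V`
from the worldline of `B`. -/
def RadarLinkable (U V : Set Event) (A B : OpenMachine S) : Prop :=
  ∀ ζ, A.event ζ ∈ U →
    (∃ ξ γ, IsSignal S V (B.event ξ) (A.event ζ) γ ∧
      ∀ ξ' γ', IsSignal S V (B.event ξ') (A.event ζ) γ' → ξ' = ξ ∧ EqOn γ' γ (Icc 0 1)) ∧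
    (∃ ξ γ, IsSignal S V (A.event ζ) (B.event ξ) γ ∧
      ∀ ξ' γ', IsSignal S V (A.event ζ) (B.event ξ') γ' → ξ' = ξ ∧ EqOn γ' γ (Icc 0 1))

end OpenMachine

namespace StaticSpacetime

/-- The space coordinates at distance less than `r` from `x₀` in the norm of `h_{x₀}`. -/
def spaceBall (S : StaticSpacetime) (x₀ : Space3) (r : ℝ) : Set Space3 :=
  {x | S.h x₀ (x - x₀) (x - x₀) < r ^ 2}

/-- The spacetime region over `spaceBall`, for all times. -/
def tube (S : StaticSpacetime) (x₀ : Space3) (r : ℝ) : Set Event :=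
  {e | e.2 ∈ S.spaceBall x₀ r}

/-- The spacetime is gently curved about `x₀` on the length scale `L`, with tolerance `ε`: on the
ball of radius `2 L` the first and second coordinate derivatives of the metric components, measured
in units of `L` and in the norm of `h_{x₀}` (and relative to the lapse at `x₀`), are at most `ε`.
The condition does not change under affine changes of the coordinates or a change of scale. -/
structure GentlyCurved (S : StaticSpacetime) (x₀ : Space3) (L ε : ℝ) : Prop where
  center_mem : x₀ ∈ S.dom
  ball_subset : S.spaceBall x₀ (2 * L) ⊆ S.dom
  lapse_fst : ∀ x ∈ S.spaceBall x₀ (2 * L), ∀ a, S.h x₀ a a ≤ 1 →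
    L * |fderiv ℝ S.lapse x a| ≤ ε * S.lapse x₀
  lapse_snd : ∀ x ∈ S.spaceBall x₀ (2 * L), ∀ a b, S.h x₀ a a ≤ 1 → S.h x₀ b b ≤ 1 →
    L ^ 2 * |fderiv ℝ (fun z => fderiv ℝ S.lapse z a) x b| ≤ ε * S.lapse x₀
  h_fst : ∀ x ∈ S.spaceBall x₀ (2 * L), ∀ a u, S.h x₀ a a ≤ 1 → S.h x₀ u u ≤ 1 →
    L * |fderiv ℝ (fun z => S.h z u u) x a| ≤ ε
  h_snd : ∀ x ∈ S.spaceBall x₀ (2 * L), ∀ a b u,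
    S.h x₀ a a ≤ 1 → S.h x₀ b b ≤ 1 → S.h x₀ u u ≤ 1 →
    L ^ 2 * |fderiv ℝ (fun z => fderiv ℝ (fun z' => S.h z' u u) z a) x b| ≤ ε

end StaticSpacetime

/-- A tetrahedral arrangement: four machines at fixed space coordinates `x i`, the first one stepped
with proper period `p`, with all six two-way null-phase channels of echo count `2 N`, carried by
signals in `V`. -/
structure IsTetrahedralArrangement {S : StaticSpacetime} (V : Set Event) (N : ℕ) (p : ℝ)
    (A : Fin 4 → OpenMachine S) (x : Fin 4 → Space3) : Prop where
  located : ∀ i, (A i).LocatedAt (x i)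
  period : (A 0).HasProperPeriod p
  linked : ∀ i j, i ≠ j → OpenMachine.TwoWayChannel V N (A i) (A j)

end

/-! Take an `h x₀`-orthonormal frame at `x₀` and `L = N p` as the unit of length. The spatial metric
and the lapse relative to `x₀` then differ from the Euclidean metric and from 1 by at most `δ = 2ε`
on the ball of radius 2, together with their first derivatives and the Lipschitz constants of these
(`GentlyCurved.nearlyFlat`). A static metric conserves energy, so the time coordinate can be
eliminated. What remains of a null geodesic is a curve in space with `x'' = Φ(x, x', x'')` and `Φ`
of order `δ` (`IsNullPath`; `signal_isNullPath` and `isNullPath_signal` translate in both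
directions).

Two points well inside the ball are joined by such a curve, by a contraction on accelerations
(`exists_isMotion_boundary`). No two such curves have the same end points, however they run inside
the ball, because energy is bounded a priori (`energy_le`). Hence a travel time `T(p, q)` is
defined; it is symmetric, and `T² - ‖q - p‖²` is small and has a small Lipschitz constant in `q`
(`abs_time_sq_sub_le`, `abs_time_sq_sub_sub_le`).

Consequently the equations "travel time 1 from three given points" perturb the Euclidean equations
for three spheres. They can be solved near any approximate solution if the three directions are
nearly those of a regular tetrahedron (`exists_trilateration`, `exists_hasTime_one`). Correcting the
vertices of a Euclidean tetrahedron one at a time gives (1). For (2), start from the mirror image of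
the vertex `l` in the opposite face. The solution stays on the far side of that face, and its travel
time to the vertex `l` is close to `√(8/3)`, hence not 1. Exactly one of the ten pairs therefore
fails.

For machines at rest with synchronous, evenly spaced ticks, a channel of echo count `2N` means
travel time 1 in these units (`twoWayChannel_iff`). In any tetrahedral arrangement synchrony is
forced: echoes against the first machine place each tick of another machine halfway between two of
its ticks (`tetrahedralArrangement_times`). -/

/-! ### Curves on the unit interval with bounded acceleration -/

/-- A `C²` curve `x` on `[0, 1]` with velocity `v` and acceleration `a`. -/
structure IsMotion {E : Type*} [NormedAddCommGroup E] [NormedSpace ℝ E] (x v a : ℝ → E) :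
    Prop where
  pos : ∀ s ∈ Icc (0 : ℝ) 1, HasDerivWithinAt x (v s) (Icc 0 1) s
  vel : ∀ s ∈ Icc (0 : ℝ) 1, HasDerivWithinAt v (a s) (Icc 0 1) s
  acc : ContinuousOn a (Icc 0 1)

namespace IsMotion

variable {E : Type*} [NormedAddCommGroup E] [NormedSpace ℝ E] {x v a x' v' a' : ℝ → E}

theorem sub (h : IsMotion x v a) (h' : IsMotion x' v' a') :
    IsMotion (x - x') (v - v') (a - a') where
  pos s hs := (h.pos s hs).sub (h'.pos s hs)
  vel s hs := (h.vel s hs).sub (h'.vel s hs)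
  acc := h.acc.sub h'.acc

/-- The velocity varies by at most `M`, and the chord `x 1 - x 0` is its mean. -/
theorem norm_vel_sub_le (h : IsMotion x v a) {M : ℝ} (hM : ∀ s ∈ Icc (0 : ℝ) 1, ‖a s‖ ≤ M)
    {s : ℝ} (hs : s ∈ Icc (0 : ℝ) 1) : ‖v s - (x 1 - x 0)‖ ≤ M := by
  have h0 : (0 : ℝ) ∈ Icc (0 : ℝ) 1 := by simp
  have h1 : (1 : ℝ) ∈ Icc (0 : ℝ) 1 := by simp
  have hM0 : 0 ≤ M := (norm_nonneg _).trans (hM s hs)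
  have key : ∀ r ∈ Icc (0 : ℝ) 1, ‖v r - v s‖ ≤ M := fun r hr => by
    have := (convex_Icc (0 : ℝ) 1).norm_image_sub_le_of_norm_hasDerivWithin_le h.vel hM hs hr
    refine this.trans ?_
    have : ‖r - s‖ ≤ 1 := by
      rw [Real.norm_eq_abs, abs_le]; constructor <;> linarith [hr.1, hr.2, hs.1, hs.2]
    nlinarith
  have hd : ∀ r ∈ Icc (0 : ℝ) 1,
      HasDerivWithinAt (fun r => x r - r • v s) (v r - v s) (Icc 0 1) r := fun r hr => by
    simpa using (h.pos r hr).fun_sub ((hasDerivWithinAt_id r _).smul_const (v s))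
  have := (convex_Icc (0 : ℝ) 1).norm_image_sub_le_of_norm_hasDerivWithin_le hd key h0 h1
  rw [norm_sub_rev]
  simpa [sub_right_comm] using this

theorem norm_pos_sub_le (h : IsMotion x v a) {M : ℝ} (hM : ∀ s ∈ Icc (0 : ℝ) 1, ‖a s‖ ≤ M)
    {s : ℝ} (hs : s ∈ Icc (0 : ℝ) 1) : ‖x s - ((1 - s) • x 0 + s • x 1)‖ ≤ M := by
  have h0 : (0 : ℝ) ∈ Icc (0 : ℝ) 1 := by simp
  have hM0 : 0 ≤ M := (norm_nonneg _).trans (hM s hs)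
  have hd : ∀ r ∈ Icc (0 : ℝ) 1,
      HasDerivWithinAt (fun r => x r - r • (x 1 - x 0)) (v r - (x 1 - x 0)) (Icc 0 1) r :=
    fun r hr => by
      simpa using (h.pos r hr).fun_sub ((hasDerivWithinAt_id r _).smul_const (x 1 - x 0))
  have := (convex_Icc (0 : ℝ) 1).norm_image_sub_le_of_norm_hasDerivWithin_le hd
    (fun r hr => h.norm_vel_sub_le hM hr) h0 hs
  have e : x s - ((1 - s) • x 0 + s • x 1) =
      (x s - s • (x 1 - x 0)) - (x 0 - (0 : ℝ) • (x 1 - x 0)) := by module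
  rw [e]
  refine this.trans ?_
  have : ‖s - 0‖ ≤ 1 := by
    rw [Real.norm_eq_abs, abs_le]; constructor <;> linarith [hs.1, hs.2]
  nlinarith

theorem norm_vel_le (h : IsMotion x v a) {M : ℝ} (hM : ∀ s ∈ Icc (0 : ℝ) 1, ‖a s‖ ≤ M)
    {s : ℝ} (hs : s ∈ Icc (0 : ℝ) 1) : ‖v s‖ ≤ ‖x 1 - x 0‖ + M := by
  have := norm_le_norm_add_norm_sub' (v s) (x 1 - x 0)
  linarith [h.norm_vel_sub_le hM hs]

theorem norm_pos_le (h : IsMotion x v a) {M R : ℝ} (hM : ∀ s ∈ Icc (0 : ℝ) 1, ‖a s‖ ≤ M)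
    (h0 : ‖x 0‖ ≤ R) (h1 : ‖x 1‖ ≤ R) {s : ℝ} (hs : s ∈ Icc (0 : ℝ) 1) : ‖x s‖ ≤ R + M := by
  have h2 := norm_le_norm_add_norm_sub' (x s) ((1 - s) • x 0 + s • x 1)
  have h3 : ‖(1 - s) • x 0 + s • x 1‖ ≤ R := by
    have := (convex_closedBall (0 : E) R) (x := x 0) (by simpa using h0) (y := x 1)
      (by simpa using h1) (a := 1 - s) (b := s) (by linarith [hs.2]) hs.1 (by ring)
    simpa using this
  linarith [h.norm_pos_sub_le hM hs]

theorem continuousOn_pos (h : IsMotion x v a) : ContinuousOn x (Icc 0 1) :=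
  fun s hs => (h.pos s hs).continuousWithinAt

theorem continuousOn_vel (h : IsMotion x v a) : ContinuousOn v (Icc 0 1) :=
  fun s hs => (h.vel s hs).continuousWithinAt

/-- Two motions with the same initial point whose accelerations are the same function of position,
velocity and acceleration, with small Lipschitz constant, differ by at most a multiple of the
distance of the final points. -/
theorem norm_acc_sub_le (h : IsMotion x v a) (h' : IsMotion x' v' a') {κ : ℝ}
    (hκ0 : 0 ≤ κ) (hκ : κ ≤ 1 / 100) (h0 : x 0 = x' 0)
    (hl : ∀ s ∈ Icc (0 : ℝ) 1,
      ‖a s - a' s‖ ≤ κ * (‖x s - x' s‖ + ‖v s - v' s‖ + ‖a s - a' s‖))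
    {s : ℝ} (hs : s ∈ Icc (0 : ℝ) 1) : ‖a s - a' s‖ ≤ 4 * κ * ‖x 1 - x' 1‖ := by
  have hd := h.sub h'
  obtain ⟨m, hm, hmax⟩ := isCompact_Icc.exists_isMaxOn (⟨0, by simp⟩ : (Icc (0 : ℝ) 1).Nonempty)
    hd.acc.norm
  set M := ‖(a - a') m‖
  have hM : ∀ s ∈ Icc (0 : ℝ) 1, ‖(a - a') s‖ ≤ M := fun s hs => hmax hs
  have e0 : (x - x') 0 = 0 := by simp [h0]
  have hv := hd.norm_vel_le hM hm
  have hx := hd.norm_pos_le (R := ‖x 1 - x' 1‖) hM (by simp [h0]) (by simp) hm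
  rw [e0, sub_zero] at hv
  have := hl m hm
  simp only [Pi.sub_apply] at hv hx
  have hMM : M = ‖a m - a' m‖ := rfl
  have hd0 := norm_nonneg (x 1 - x' 1)
  have hM0 : 0 ≤ M := norm_nonneg _
  -- At a point where the difference of accelerations is maximal, the differences of positions and
  -- of velocities are each at most `‖x 1 - x' 1‖ + M`. As `3 κ` is small, `M` can be absorbed on
  -- the left.
  have h2 : M ≤ κ * (2 * ‖x 1 - x' 1‖ + 3 * M) := by
    refine (hMM.le.trans this).trans (mul_le_mul_of_nonneg_left ?_ hκ0)
    rw [← hMM]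
    linarith
  refine (hM s hs).trans ?_
  nlinarith [mul_nonneg hκ0 hd0, mul_le_mul_of_nonneg_right hκ hM0]

end IsMotion

/-! ### The boundary value problem with small right-hand side -/

section Existence

variable {E : Type*} [NormedAddCommGroup E] [NormedSpace ℝ E] [CompleteSpace E]

/-- Integrate `α` twice and add the affine function that corrects the boundary values. -/
theorem exists_isMotion_of_continuous (p q : E) {α : ℝ → E} (hα : Continuous α) :
    ∃ x v : ℝ → E, IsMotion x v α ∧ x 0 = p ∧ x 1 = q := by
  set w : ℝ → E := fun s => ∫ r in (0 : ℝ)..s, α r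
  have hw : ∀ s, HasDerivAt w (α s) s := fun s => (hα.integral_hasStrictDerivAt 0 s).hasDerivAt
  have hwc : Continuous w := continuous_iff_continuousAt.2 fun s => (hw s).continuousAt
  set y : ℝ → E := fun s => ∫ r in (0 : ℝ)..s, w r
  have hy : ∀ s, HasDerivAt y (w s) s := fun s => (hwc.integral_hasStrictDerivAt 0 s).hasDerivAt
  refine ⟨fun s => p + s • (q - p - y 1) + y s, fun s => (q - p - y 1) + w s,
    ⟨fun s _ => ?_, fun s _ => ?_, hα.continuousOn⟩, ?_, ?_⟩
  · have := (((hasDerivAt_id s).smul_const (q - p - y 1)).const_add p).fun_add (hy s)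
    simpa using this.hasDerivWithinAt
  · simpa using ((hw s).const_add (q - p - y 1)).hasDerivWithinAt
  · simp [y]
  · simp only [one_smul]; abel

/-- The boundary value problem `x'' = Φ(x, x', x'')` for small `Φ` with small Lipschitz constant. -/
theorem exists_isMotion_boundary {Φ : E → E → E → E} {κ : ℝ} (hκ0 : 0 ≤ κ) (hκ : κ ≤ 1 / 100)
    (hb : ∀ z v a, ‖z‖ < 2 → ‖v‖ ≤ 5 → ‖a‖ ≤ 1 → ‖Φ z v a‖ ≤ κ)
    (hl : ∀ z v a z' v' a', ‖z‖ < 2 → ‖v‖ ≤ 5 → ‖a‖ ≤ 1 → ‖z'‖ < 2 → ‖v'‖ ≤ 5 → ‖a'‖ ≤ 1 →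
      ‖Φ z v a - Φ z' v' a'‖ ≤ κ * (‖z - z'‖ + ‖v - v'‖ + ‖a - a'‖))
    {p q : E} (hp : ‖p‖ ≤ 9 / 5) (hq : ‖q‖ ≤ 9 / 5) :
    ∃ x v a : ℝ → E, IsMotion x v a ∧ x 0 = p ∧ x 1 = q ∧ ∀ s ∈ Icc (0 : ℝ) 1,
      ‖x s‖ < 2 ∧ ‖v s‖ ≤ 5 ∧ ‖a s‖ ≤ 1 ∧ a s = Φ (x s) (v s) (a s) := by
  let I := Icc (0 : ℝ) 1
  let ext : C(I, E) → ℝ → E := fun c s => c (projIcc 0 1 zero_le_one s)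
  have hext : ∀ c, Continuous (ext c) := fun c => c.continuous.comp continuous_projIcc
  have hextI : ∀ c (s : I), ext c s = c s := fun c s => by simp [ext]
  choose x v hm h0 h1 using fun c => exists_isMotion_of_continuous p q (hext c)
  -- The unknown is the acceleration, a continuous function of norm at most `κ`; the boundary values
  -- then determine position and velocity. The margins `9/5 + κ < 2` and `18/5 + κ ≤ 5` keep the
  -- motion where `Φ` is controlled.
  let B := Metric.closedBall (0 : C(I, E)) κ
  have hBn : ∀ c ∈ B, ∀ s, ‖ext c s‖ ≤ κ := fun c hc s =>
    (c.norm_coe_le_norm _).trans (by simpa [B] using hc)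
  have hpq : ‖q - p‖ ≤ 18 / 5 := (norm_sub_le _ _).trans (by linarith)
  have hdom : ∀ c ∈ B, ∀ s ∈ I, ‖x c s‖ < 2 ∧ ‖v c s‖ ≤ 5 ∧ ‖ext c s‖ ≤ 1 := fun c hc s hs => by
    have hM : ∀ r ∈ I, ‖ext c r‖ ≤ κ := fun r _ => hBn c hc r
    refine ⟨?_, ?_, (hBn c hc s).trans (by linarith)⟩
    · have := (hm c).norm_pos_le (R := 9 / 5) hM (by rwa [h0]) (by rwa [h1]) hs
      linarith
    · have := (hm c).norm_vel_le hM hs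
      rw [h0, h1] at this
      linarith
  let f : B → B := fun c =>
    ⟨⟨fun s => Φ (x c s) (v c s) (ext c s), by
      have key : ContinuousOn (fun u : E × E × E => Φ u.1 u.2.1 u.2.2)
          {u | ‖u.1‖ < 2 ∧ ‖u.2.1‖ ≤ 5 ∧ ‖u.2.2‖ ≤ 1} := by
        refine LipschitzOnWith.continuousOn (K := Real.toNNReal (κ * 3)) ?_
        refine LipschitzOnWith.of_dist_le_mul fun u hu u' hu' => ?_
        rw [Real.coe_toNNReal _ (by positivity), dist_eq_norm, dist_eq_norm]
        refine (hl _ _ _ _ _ _ hu.1 hu.2.1 hu.2.2 hu'.1 hu'.2.1 hu'.2.2).trans ?_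
        rw [mul_assoc]
        refine mul_le_mul_of_nonneg_left ?_ hκ0
        have i1 := norm_fst_le (u - u')
        have i2 := (norm_fst_le (u - u').2).trans (norm_snd_le (u - u'))
        have i3 := (norm_snd_le (u - u').2).trans (norm_snd_le (u - u'))
        simp only [Prod.fst_sub, Prod.snd_sub] at i1 i2 i3
        linarith
      refine key.comp_continuous (f := fun s : I => (x c s, v c s, ext c s)) ?_
        fun s => hdom c c.2 s s.2
      refine Continuous.prodMk ?_ (Continuous.prodMk ?_ ?_)
      · exact continuousOn_iff_continuous_domRestrict.1 (hm c).continuousOn_pos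
      · exact continuousOn_iff_continuous_domRestrict.1 (hm c).continuousOn_vel
      · exact (hext c).comp continuous_subtype_val⟩, by
      rw [mem_closedBall_zero_iff, ContinuousMap.norm_le _ hκ0]
      intro s
      obtain ⟨i, j, k⟩ := hdom c c.2 s s.2
      exact hb _ _ _ i j k⟩
  -- The difference of two candidate motions vanishes at both ends, so position, velocity and
  -- acceleration each differ by at most `‖c - c'‖`. The Lipschitz constant is thus `3 κ`, well
  -- below `1/2`.
  have hf : ContractingWith (1 / 2) f := by
    refine ⟨by norm_num [← NNReal.coe_lt_coe], LipschitzWith.of_dist_le_mul fun c c' => ?_⟩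
    rw [Subtype.dist_eq, ContinuousMap.dist_le (by positivity)]
    intro s
    rw [dist_eq_norm, Subtype.dist_eq, dist_eq_norm]
    obtain ⟨i, j, k⟩ := hdom c c.2 s s.2
    obtain ⟨i', j', k'⟩ := hdom c' c'.2 s s.2
    have hd := (hm c).sub (hm c')
    have hM : ∀ r ∈ I, ‖(ext c - ext c') r‖ ≤ ‖(c : C(I, E)) - c'‖ := fun r _ => by
      have := ((c : C(I, E)) - c').norm_coe_le_norm (projIcc 0 1 zero_le_one r)
      simpa [ext] using this
    have e0 : (x c - x c') 0 = 0 := by simp [h0]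
    have e1 : (x c - x c') 1 = 0 := by simp [h1]
    have l1 := hd.norm_pos_le (R := 0) hM (by simp [e0]) (by simp [e1]) s.2
    have l2 := hd.norm_vel_le hM s.2
    rw [e0, e1, sub_zero, norm_zero, zero_add] at l2
    have l3 := hM s s.2
    simp only [Pi.sub_apply] at l1 l2 l3
    refine (hl _ _ _ _ _ _ i j k i' j' k').trans ?_
    have := norm_nonneg ((c : C(I, E)) - c')
    have e : (((1 / 2 : NNReal)) : ℝ) = 1 / 2 := by norm_num
    rw [e]
    calc _ ≤ κ * (3 * ‖(c : C(I, E)) - c'‖) := mul_le_mul_of_nonneg_left (by linarith) hκ0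
      _ ≤ _ := by nlinarith
  have : CompleteSpace B := Metric.isClosed_closedBall.completeSpace_coe
  obtain ⟨c, hc, -⟩ := hf.exists_fixedPoint (⟨0, by simp [B, hκ0]⟩ : B) (edist_ne_top _ _)
  refine ⟨x c, v c, ext c, hm c, h0 c, h1 c, fun s hs => ?_⟩
  obtain ⟨i, j, k⟩ := hdom c c.2 s hs
  refine ⟨i, j, k, ?_⟩
  have : (f c : C(I, E)) ⟨s, hs⟩ = (c : C(I, E)) ⟨s, hs⟩ := by rw [hc]
  exact (hextI c ⟨s, hs⟩).trans this.symm

end Existence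

/-! ### Nearly flat data and the acceleration of a light ray -/

/-- A Riemannian metric `k` and a lapse `W` on the ball of radius `2`, close to the Euclidean metric
and to `1` together with their derivatives `dk`, `dW` and the Lipschitz constants of these. -/
structure NearlyFlat (E : Type*) [NormedAddCommGroup E] [InnerProductSpace ℝ E] (δ : ℝ) where
  k : E → E →L[ℝ] E →L[ℝ] ℝ
  dk : E → E →L[ℝ] E →L[ℝ] E →L[ℝ] ℝ
  W : E → ℝ
  dW : E → E →L[ℝ] ℝ
  nonneg : 0 ≤ δ
  small : δ ≤ 1 / 10 ^ 9
  deriv_k : ∀ z, ‖z‖ < 2 → HasFDerivAt k (dk z) z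
  deriv_W : ∀ z, ‖z‖ < 2 → HasFDerivAt W (dW z) z
  symm : ∀ z, ‖z‖ < 2 → ∀ u v, k z u v = k z v u
  k_near : ∀ z, ‖z‖ < 2 → ∀ u v, |k z u v - inner ℝ u v| ≤ δ * (‖u‖ * ‖v‖)
  dk_le : ∀ z, ‖z‖ < 2 → ∀ a u v, |dk z a u v| ≤ δ * (‖a‖ * ‖u‖ * ‖v‖)
  dk_lip : ∀ z z', ‖z‖ < 2 → ‖z'‖ < 2 → ∀ a u v,
    |dk z a u v - dk z' a u v| ≤ δ * ‖z - z'‖ * (‖a‖ * ‖u‖ * ‖v‖)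
  W_near : ∀ z, ‖z‖ < 2 → |W z - 1| ≤ δ
  dW_le : ∀ z, ‖z‖ < 2 → ∀ a, |dW z a| ≤ δ * ‖a‖
  dW_lip : ∀ z z', ‖z‖ < 2 → ‖z'‖ < 2 → ∀ a, |dW z a - dW z' a| ≤ δ * ‖z - z'‖ * ‖a‖

namespace NearlyFlat

variable {E : Type*} [NormedAddCommGroup E] [InnerProductSpace ℝ E] {δ : ℝ} (G : NearlyFlat E δ)

include G

theorem W_bounds {z : E} (hz : ‖z‖ < 2) : 99 / 100 ≤ G.W z ∧ G.W z ≤ 101 / 100 := by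
  have := abs_le.1 (G.W_near z hz)
  have := G.small
  constructor <;> norm_num at * <;> linarith

theorem W_lip {z z' : E} (hz : ‖z‖ < 2) (hz' : ‖z'‖ < 2) : |G.W z - G.W z'| ≤ δ * ‖z - z'‖ := by
  have := (convex_ball (0 : E) 2).norm_image_sub_le_of_norm_hasFDerivWithin_le (f := G.W)
    (f' := G.dW) (C := δ) (x := z') (y := z)
    (fun x hx => (G.deriv_W x (by simpa using hx)).hasFDerivWithinAt)
    (fun x hx => (G.dW x).opNorm_le_bound G.nonneg
      fun a => G.dW_le x (by simpa using hx) a) (by simpa using hz') (by simpa using hz)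
  simpa using this

theorem hasFDerivAt_k_apply {z : E} (hz : ‖z‖ < 2) (u v : E) :
    HasFDerivAt (fun z => G.k z u v) (((G.dk z).flip u).flip v) z := by
  have := ((G.deriv_k z hz).clm_apply (hasFDerivAt_const u z)).clm_apply (hasFDerivAt_const v z)
  refine this.congr_fderiv ?_
  ext a
  simp

theorem k_lip {z z' : E} (hz : ‖z‖ < 2) (hz' : ‖z'‖ < 2) (u v : E) :
    |G.k z u v - G.k z' u v| ≤ δ * ‖z - z'‖ * (‖u‖ * ‖v‖) := by
  have := (convex_ball (0 : E) 2).norm_image_sub_le_of_norm_hasFDerivWithin_le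
    (f := fun z => G.k z u v) (f' := fun z => ((G.dk z).flip u).flip v)
    (C := δ * (‖u‖ * ‖v‖)) (x := z') (y := z)
    (fun x hx => (G.hasFDerivAt_k_apply (by simpa using hx) u v).hasFDerivWithinAt)
    (fun x hx => ContinuousLinearMap.opNorm_le_bound _
      (mul_nonneg G.nonneg (by positivity)) fun a => by
        have := G.dk_le x (by simpa using hx) a u v
        simp only [ContinuousLinearMap.flip_apply, Real.norm_eq_abs]
        linarith) (by simpa using hz') (by simpa using hz)
  rw [Real.norm_eq_abs] at this
  linarith

theorem k_le {z : E} (hz : ‖z‖ < 2) (u v : E) : |G.k z u v| ≤ 101 / 100 * (‖u‖ * ‖v‖) := by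
  have h1 := abs_le.1 (G.k_near z hz u v)
  have h2 := abs_le.1 (abs_real_inner_le_norm u v)
  have h3 : δ * (‖u‖ * ‖v‖) ≤ 1 / 100 * (‖u‖ * ‖v‖) :=
    mul_le_mul_of_nonneg_right (by have := G.small; norm_num at *; linarith) (by positivity)
  rw [abs_le]
  constructor <;> linarith

theorem k_self_bounds {z : E} (hz : ‖z‖ < 2) (v : E) :
    99 / 100 * ‖v‖ ^ 2 ≤ G.k z v v ∧ G.k z v v ≤ 101 / 100 * ‖v‖ ^ 2 := by
  have h1 := abs_le.1 (G.k_near z hz v v)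
  rw [real_inner_self_eq_norm_sq] at h1
  have h3 : δ * (‖v‖ * ‖v‖) ≤ 1 / 100 * (‖v‖ * ‖v‖) :=
    mul_le_mul_of_nonneg_right (by have := G.small; norm_num at *; linarith) (by positivity)
  constructor <;> nlinarith

/-- The part of the geodesic equation, as a linear form, that is not there in flat space. -/
noncomputable def residual (z v a : E) : E →L[ℝ] ℝ :=
  (G.k z a - innerSL ℝ a) + G.dk z v v - (1 / 2 : ℝ) • ((G.dk z).flip v).flip v +
    (G.k z v v / G.W z) • G.dW z

theorem residual_apply (z v a w : E) :
    G.residual z v a w = (G.k z a w - inner ℝ a w) + G.dk z v v w - 1 / 2 * G.dk z w v v +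
      G.dW z w / G.W z * G.k z v v := by
  simp [residual]
  ring

theorem norm_residual_le {z : E} (hz : ‖z‖ < 2) (v a : E) :
    ‖G.residual z v a‖ ≤ δ * (‖a‖ + 3 * ‖v‖ ^ 2) := by
  have h0 := G.nonneg
  refine ContinuousLinearMap.opNorm_le_bound _ (by positivity) fun w => ?_
  rw [G.residual_apply, Real.norm_eq_abs]
  have h1 := abs_le.1 (G.k_near z hz a w)
  have h2 := abs_le.1 (G.dk_le z hz v v w)
  have h3 := abs_le.1 (G.dk_le z hz w v v)
  obtain ⟨hW, -⟩ := G.W_bounds hz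
  have h4 : |G.dW z w / G.W z * G.k z v v| ≤ δ * ‖w‖ / (99 / 100) * (101 / 100 * (‖v‖ * ‖v‖)) := by
    rw [abs_mul, abs_div, abs_of_pos (by linarith : 0 < G.W z)]
    gcongr
    · exact G.dW_le z hz w
    · exact G.k_le hz v v
  have h4 := abs_le.1 h4
  have : 0 ≤ δ * ‖w‖ * ‖v‖ ^ 2 := by positivity
  rw [abs_le]
  constructor <;> nlinarith

theorem abs_k_self_sub_le {z v z' v' : E} (hz : ‖z‖ < 2) (hz' : ‖z'‖ < 2)
    (hv : ‖v‖ ≤ 5) (hv' : ‖v'‖ ≤ 5) :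
    |G.k z v v - G.k z' v' v'| ≤ 11 * ‖v - v'‖ + ‖z - z'‖ := by
  have hsm := G.small
  have hvv' : ‖v'‖ * ‖v'‖ ≤ 25 := by nlinarith [norm_nonneg v']
  have e : G.k z v v - G.k z' v' v' = G.k z (v - v') v + G.k z v' (v - v') +
      (G.k z v' v' - G.k z' v' v') := by
    simp
  rw [e]
  refine (abs_add_three _ _ _).trans ?_
  have i1 : |G.k z (v - v') v| ≤ 101 / 100 * (‖v - v'‖ * 5) := (G.k_le hz _ _).trans (by gcongr)
  have i2 : |G.k z v' (v - v')| ≤ 101 / 100 * (5 * ‖v - v'‖) := (G.k_le hz _ _).trans (by gcongr)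
  have i3 : |G.k z v' v' - G.k z' v' v'| ≤ 1 / 10 ^ 9 * ‖z - z'‖ * 25 :=
    (G.k_lip hz hz' _ _).trans (by gcongr)
  norm_num at i3
  linarith [norm_nonneg (v - v'), norm_nonneg (z - z')]

theorem abs_dk_fst_sub_le {z v z' v' : E} (hz : ‖z‖ < 2) (hz' : ‖z'‖ < 2)
    (hv : ‖v‖ ≤ 5) (hv' : ‖v'‖ ≤ 5) (w : E) :
    |G.dk z v v w - G.dk z' v' v' w| ≤ δ * ‖w‖ * (10 * ‖v - v'‖ + 25 * ‖z - z'‖) := by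
  have h0 := G.nonneg
  have hvv' : ‖v'‖ * ‖v'‖ ≤ 25 := by nlinarith [norm_nonneg v']
  have e : G.dk z v v w - G.dk z' v' v' w = G.dk z (v - v') v w + G.dk z v' (v - v') w +
      (G.dk z v' v' w - G.dk z' v' v' w) := by
    simp
  rw [e]
  refine (abs_add_three _ _ _).trans ?_
  have i1 : |G.dk z (v - v') v w| ≤ δ * (‖v - v'‖ * 5 * ‖w‖) :=
    (G.dk_le z hz _ _ _).trans (by gcongr)
  have i2 : |G.dk z v' (v - v') w| ≤ δ * (5 * ‖v - v'‖ * ‖w‖) :=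
    (G.dk_le z hz _ _ _).trans (by gcongr)
  have i3 : |G.dk z v' v' w - G.dk z' v' v' w| ≤ δ * ‖z - z'‖ * (25 * ‖w‖) :=
    (G.dk_lip z z' hz hz' _ _ _).trans (by gcongr)
  linarith

theorem abs_dk_snd_sub_le {z v z' v' : E} (hz : ‖z‖ < 2) (hz' : ‖z'‖ < 2)
    (hv : ‖v‖ ≤ 5) (hv' : ‖v'‖ ≤ 5) (w : E) :
    |G.dk z w v v - G.dk z' w v' v'| ≤ δ * ‖w‖ * (10 * ‖v - v'‖ + 25 * ‖z - z'‖) := by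
  have h0 := G.nonneg
  have hvv' : ‖v'‖ * ‖v'‖ ≤ 25 := by nlinarith [norm_nonneg v']
  have e : G.dk z w v v - G.dk z' w v' v' = G.dk z w (v - v') v + G.dk z w v' (v - v') +
      (G.dk z w v' v' - G.dk z' w v' v') := by
    simp
  rw [e]
  refine (abs_add_three _ _ _).trans ?_
  have i1 : |G.dk z w (v - v') v| ≤ δ * (‖w‖ * ‖v - v'‖ * 5) :=
    (G.dk_le z hz _ _ _).trans (by gcongr)
  have i2 : |G.dk z w v' (v - v')| ≤ δ * (‖w‖ * 5 * ‖v - v'‖) :=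
    (G.dk_le z hz _ _ _).trans (by gcongr)
  have i3 : |G.dk z w v' v' - G.dk z' w v' v'| ≤ δ * ‖z - z'‖ * (‖w‖ * 25) :=
    (G.dk_lip z z' hz hz' _ _ _).trans (by
      have := G.nonneg
      rw [mul_assoc ‖w‖]; gcongr)
  linarith

theorem abs_logDeriv_W_sub_le {z z' : E} (hz : ‖z‖ < 2) (hz' : ‖z'‖ < 2) (w : E) :
    |G.dW z w / G.W z - G.dW z' w / G.W z'| ≤ 2 * (δ * ‖w‖ * ‖z - z'‖) := by
  have h0 := G.nonneg
  have hsm := G.small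
  obtain ⟨hW1, hW2⟩ := G.W_bounds hz
  obtain ⟨hW1', hW2'⟩ := G.W_bounds hz'
  have hWp : 0 < G.W z := by linarith
  have hWp' : 0 < G.W z' := by linarith
  have e : G.dW z w / G.W z - G.dW z' w / G.W z' =
      ((G.dW z w - G.dW z' w) * G.W z' + G.dW z' w * (G.W z' - G.W z)) /
        (G.W z * G.W z') := by
    field_simp; ring
  rw [e, abs_div, abs_of_pos (mul_pos hWp hWp'), div_le_iff₀ (mul_pos hWp hWp')]
  refine (abs_add_le _ _).trans ?_
  rw [abs_mul, abs_mul, abs_of_pos hWp', abs_sub_comm (G.W z')]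
  have i1 : |G.dW z w - G.dW z' w| * G.W z' ≤ (δ * ‖z - z'‖ * ‖w‖) * (101 / 100) := by
    gcongr
    exact G.dW_lip z z' hz hz' w
  have i2 : |G.dW z' w| * |G.W z - G.W z'| ≤ (δ * ‖w‖) * (1 / 10 ^ 9 * ‖z - z'‖) := by
    gcongr
    · exact G.dW_le z' hz' w
    · exact (G.W_lip hz hz').trans (by gcongr)
  norm_num at i2
  have i3 : 0 ≤ δ * ‖w‖ * ‖z - z'‖ := by positivity
  have i4 : 99 / 100 * (99 / 100) ≤ G.W z * G.W z' := by gcongr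
  nlinarith

theorem abs_logDeriv_W_mul_k_sub_le {z v z' v' : E} (hz : ‖z‖ < 2) (hz' : ‖z'‖ < 2)
    (hv : ‖v‖ ≤ 5) (hv' : ‖v'‖ ≤ 5) (w : E) :
    |G.dW z w / G.W z * G.k z v v - G.dW z' w / G.W z' * G.k z' v' v'| ≤
      δ * ‖w‖ * (22 * ‖v - v'‖ + 54 * ‖z - z'‖) := by
  have h0 := G.nonneg
  have hvv' : ‖v'‖ * ‖v'‖ ≤ 25 := by nlinarith [norm_nonneg v']
  obtain ⟨hW1, hW2⟩ := G.W_bounds hz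
  have hWp : 0 < G.W z := by linarith
  have e5 : |G.dW z w / G.W z| ≤ 2 * (δ * ‖w‖) := by
    rw [abs_div, abs_of_pos hWp, div_le_iff₀ hWp]
    have := G.dW_le z hz w
    have : 0 ≤ δ * ‖w‖ := by positivity
    nlinarith
  have e : G.dW z w / G.W z * G.k z v v - G.dW z' w / G.W z' * G.k z' v' v' =
      G.dW z w / G.W z * (G.k z v v - G.k z' v' v') +
      (G.dW z w / G.W z - G.dW z' w / G.W z') * G.k z' v' v' := by ring
  rw [e]
  refine (abs_add_le _ _).trans ?_
  rw [abs_mul, abs_mul]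
  have i1 : |G.dW z w / G.W z| * |G.k z v v - G.k z' v' v'| ≤
      (2 * (δ * ‖w‖)) * (11 * ‖v - v'‖ + ‖z - z'‖) := by
    gcongr
    exact G.abs_k_self_sub_le hz hz' hv hv'
  have i2 : |G.dW z w / G.W z - G.dW z' w / G.W z'| * |G.k z' v' v'| ≤
      (2 * (δ * ‖w‖ * ‖z - z'‖)) * (101 / 100 * 25) := by
    gcongr
    · exact G.abs_logDeriv_W_sub_le hz hz' w
    · exact (G.k_le hz' _ _).trans (by gcongr)
  have i3 : 0 ≤ δ * ‖w‖ * ‖z - z'‖ := by positivity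
  linarith

theorem abs_k_sub_inner_sub_le {z a z' a' : E} (hz : ‖z‖ < 2) (hz' : ‖z'‖ < 2)
    (ha' : ‖a'‖ ≤ 1) (w : E) :
    |(G.k z a w - inner ℝ a w) - (G.k z' a' w - inner ℝ a' w)| ≤
      δ * ‖w‖ * (‖a - a'‖ + ‖z - z'‖) := by
  have h0 := G.nonneg
  have e : (G.k z a w - inner ℝ a w) - (G.k z' a' w - inner ℝ a' w) =
      (G.k z (a - a') w - inner ℝ (a - a') w) + (G.k z a' w - G.k z' a' w) := by
    simp [inner_sub_left]; ring
  rw [e]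
  refine (abs_add_le _ _).trans ?_
  have i1 := G.k_near z hz (a - a') w
  have i2 := G.k_lip hz hz' a' w
  have i3 : δ * ‖z - z'‖ * (‖a'‖ * ‖w‖) ≤ δ * ‖z - z'‖ * (1 * ‖w‖) := by gcongr
  linarith

/-- Each of the four terms of the residual is Lipschitz with a constant of order `δ` on the region
allowed by the bounds 5 and 1; the constant 100 dominates the sum of their coefficients. -/
theorem norm_residual_sub_le {z v a z' v' a' : E} (hz : ‖z‖ < 2) (hz' : ‖z'‖ < 2)
    (hv : ‖v‖ ≤ 5) (hv' : ‖v'‖ ≤ 5) (ha' : ‖a'‖ ≤ 1) :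
    ‖G.residual z v a - G.residual z' v' a'‖ ≤
      100 * δ * (‖z - z'‖ + ‖v - v'‖ + ‖a - a'‖) := by
  have h0 := G.nonneg
  refine ContinuousLinearMap.opNorm_le_bound _ (by positivity) fun w => ?_
  rw [sub_apply, G.residual_apply, G.residual_apply, Real.norm_eq_abs]
  have i1 := abs_le.1 (G.abs_k_sub_inner_sub_le (a := a) hz hz' ha' w)
  have i2 := abs_le.1 (G.abs_dk_fst_sub_le hz hz' hv hv' w)
  have i3 := abs_le.1 (G.abs_dk_snd_sub_le hz hz' hv hv' w)
  have i7 := abs_le.1 (G.abs_logDeriv_W_mul_k_sub_le hz hz' hv hv' w)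
  have p1 : 0 ≤ δ * ‖w‖ * ‖z - z'‖ := by positivity
  have p2 : 0 ≤ δ * ‖w‖ * ‖v - v'‖ := by positivity
  have p3 : 0 ≤ δ * ‖w‖ * ‖a - a'‖ := by positivity
  rw [abs_le]
  constructor <;> linarith

/-- The acceleration, as a function of position, velocity and acceleration. -/
noncomputable def accel [CompleteSpace E] (z v a : E) : E :=
  -(InnerProductSpace.toDual ℝ E).symm (G.residual z v a)

theorem norm_accel_le [CompleteSpace E] {z : E} (hz : ‖z‖ < 2) (v a : E) :
    ‖G.accel z v a‖ ≤ δ * (‖a‖ + 3 * ‖v‖ ^ 2) := by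
  rw [accel, norm_neg, LinearIsometryEquiv.norm_map]
  exact G.norm_residual_le hz v a

theorem norm_accel_sub_le [CompleteSpace E] {z v a z' v' a' : E} (hz : ‖z‖ < 2) (hz' : ‖z'‖ < 2)
    (hv : ‖v‖ ≤ 5) (hv' : ‖v'‖ ≤ 5) (ha' : ‖a'‖ ≤ 1) :
    ‖G.accel z v a - G.accel z' v' a'‖ ≤
      100 * δ * (‖z - z'‖ + ‖v - v'‖ + ‖a - a'‖) := by
  rw [accel, accel, ← neg_sub_neg, neg_neg, neg_neg, ← map_sub, LinearIsometryEquiv.norm_map,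
    norm_sub_rev]
  exact G.norm_residual_sub_le hz hz' hv hv' ha'

/-- The equation stays implicit in `a`: the term `k z a w - inner a w` is moved to the small
right-hand side, and only the Euclidean inner product has to be inverted. No Christoffel symbols are
needed. -/
theorem eq_accel_iff [CompleteSpace E] (z v a : E) :
    a = G.accel z v a ↔ ∀ w, G.k z a w + G.dk z v v w - 1 / 2 * G.dk z w v v +
      G.dW z w / G.W z * G.k z v v = 0 := by
  rw [accel, eq_neg_iff_add_eq_zero, ← (InnerProductSpace.toDual ℝ E).map_eq_zero_iff, map_add,
    LinearIsometryEquiv.apply_symm_apply, ContinuousLinearMap.ext_iff]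
  refine forall_congr' fun w => ?_
  rw [add_apply, InnerProductSpace.toDual_apply_apply, G.residual_apply,
    zero_apply]
  constructor <;> intro h <;> linarith

end NearlyFlat

/-! ### A priori bounds and comparison of null paths -/

namespace NearlyFlat

variable {E : Type*} [NormedAddCommGroup E] [InnerProductSpace ℝ E] {δ : ℝ}

/-- The projection `z` to space of a null geodesic from `p` to `q` that takes the time `T`; the
conserved energy is `e`, and `e * θ` is the time coordinate along it. -/
structure IsNullPath (G : NearlyFlat E δ) (p q : E) (T : ℝ) (z v a : ℝ → E) (θ : ℝ → ℝ) (e : ℝ) :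
    Prop extends IsMotion z v a where
  start : z 0 = p
  finish : z 1 = q
  inBall : ∀ s ∈ Icc (0 : ℝ) 1, ‖z s‖ < 2
  equation : ∀ s ∈ Icc (0 : ℝ) 1, ∀ w, G.k (z s) (a s) w + G.dk (z s) (v s) (v s) w -
    1 / 2 * G.dk (z s) w (v s) (v s) + G.dW (z s) w / G.W (z s) * G.k (z s) (v s) (v s) = 0
  energy_nonneg : 0 ≤ e
  energy : ∀ s ∈ Icc (0 : ℝ) 1, G.W (z s) ^ 2 * G.k (z s) (v s) (v s) = e ^ 2
  time_zero : θ 0 = 0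
  time_one : e * θ 1 = T
  time : ∀ s ∈ Icc (0 : ℝ) 1, HasDerivWithinAt θ (1 / G.W (z s) ^ 2) (Icc 0 1) s

variable {G : NearlyFlat E δ} {p q q' : E} {T T' e e' : ℝ} {z v a z' v' a' : ℝ → E} {θ θ' : ℝ → ℝ}

namespace IsNullPath

/-- The bound of `accel` contains `δ * ‖a‖`, which is absorbed on the left. No bound on the velocity
may be assumed here, since the result serves to derive one. -/
theorem norm_acc_le_norm_vel [CompleteSpace E] (h : IsNullPath G p q T z v a θ e) {s : ℝ}
    (hs : s ∈ Icc (0 : ℝ) 1) : ‖a s‖ ≤ 4 * δ * ‖v s‖ ^ 2 := by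
  have h1 := G.norm_accel_le (h.inBall s hs) (v s) (a s)
  rw [← (G.eq_accel_iff _ _ _).2 (h.equation s hs)] at h1
  have h2 : δ * ‖a s‖ ≤ 1 / 10 * ‖a s‖ :=
    mul_le_mul_of_nonneg_right (by have := G.small; norm_num at *; linarith) (norm_nonneg _)
  have h3 : 0 ≤ δ * ‖v s‖ ^ 2 := mul_nonneg G.nonneg (by positivity)
  nlinarith

theorem norm_vel_bounds (h : IsNullPath G p q T z v a θ e) {s : ℝ}
    (hs : s ∈ Icc (0 : ℝ) 1) : 98 / 100 * e ≤ ‖v s‖ ∧ ‖v s‖ ≤ 102 / 100 * e := by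
  obtain ⟨i1, i2⟩ := G.k_self_bounds (h.inBall s hs) (v s)
  obtain ⟨i3, i4⟩ := G.W_bounds (h.inBall s hs)
  have i5 := h.energy s hs
  have i6 : (99 / 100) ^ 2 ≤ G.W (z s) ^ 2 := by gcongr
  have i7 : G.W (z s) ^ 2 ≤ (101 / 100) ^ 2 := by gcongr
  have i8 : 0 ≤ ‖v s‖ ^ 2 := by positivity
  have i11 : 0 ≤ G.k (z s) (v s) (v s) := by linarith
  have i9 : (99 / 100) ^ 2 * (99 / 100 * ‖v s‖ ^ 2) ≤ e ^ 2 := by rw [← i5]; gcongr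
  have i10 : e ^ 2 ≤ (101 / 100) ^ 2 * (101 / 100 * ‖v s‖ ^ 2) := by rw [← i5]; gcongr
  have he := h.energy_nonneg
  constructor
  · refine le_of_sq_le_sq ?_ (norm_nonneg _)
    nlinarith
  · refine le_of_sq_le_sq ?_ (by positivity)
    nlinarith

/-- A ray of energy `e > 9/2` would be nearly straight up to the parameter `σ = 9/(2e)` and would
have covered at least about `4.41` by then, more than the diameter 4 of the ball. This bound makes
uniqueness hold among all signals in the region, and not only among those of small velocity. -/
theorem energy_le [CompleteSpace E] (h : IsNullPath G p q T z v a θ e) : e ≤ 9 / 2 := by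
  by_contra! hlt
  have hδ := G.nonneg
  have hsm := G.small
  have he : 0 < e := by linarith
  set σ := 9 / 2 / e with hσ
  have hσ0 : 0 < σ := by positivity
  have hσe : σ * e = 9 / 2 := by rw [hσ]; field_simp
  have hσ1 : σ ≤ 1 := by rw [hσ, div_le_one he]; exact hlt.le
  have hsub : Icc (0 : ℝ) σ ⊆ Icc 0 1 := Icc_subset_Icc_right hσ1
  have h0 : (0 : ℝ) ∈ Icc (0 : ℝ) σ := ⟨le_rfl, hσ0.le⟩
  have h1 : σ ∈ Icc (0 : ℝ) σ := ⟨hσ0.le, le_rfl⟩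
  have hacc : ∀ s ∈ Icc (0 : ℝ) σ, ‖a s‖ ≤ 5 * δ * e ^ 2 := fun s hs => by
    refine (h.norm_acc_le_norm_vel (hsub hs)).trans ?_
    have : ‖v s‖ ^ 2 ≤ (102 / 100 * e) ^ 2 := by
      have := (h.norm_vel_bounds (hsub hs)).2
      gcongr
    nlinarith [mul_le_mul_of_nonneg_left this hδ, mul_nonneg hδ (sq_nonneg e)]
  have hvel : ∀ s ∈ Icc (0 : ℝ) σ, ‖v s - v 0‖ ≤ 5 * δ * e ^ 2 * σ := fun s hs => by
    have := (convex_Icc (0 : ℝ) σ).norm_image_sub_le_of_norm_hasDerivWithin_le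
      (fun x hx => (h.vel x (hsub hx)).mono hsub) hacc h0 hs
    refine this.trans ?_
    rw [sub_zero, Real.norm_eq_abs, abs_of_nonneg hs.1]
    gcongr
    exact hs.2
  have hpos := (convex_Icc (0 : ℝ) σ).norm_image_sub_le_of_norm_hasDerivWithin_le
    (f := fun s => z s - s • v 0) (f' := fun s => v s - v 0)
    (fun x hx => by
      simpa using ((h.pos x (hsub hx)).mono hsub).fun_sub
        ((hasDerivWithinAt_id x _).smul_const (v 0))) hvel h0 h1
  rw [sub_zero, Real.norm_eq_abs, abs_of_pos hσ0] at hpos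
  -- The deviation from a straight line up to `σ` depends only on `σ * e = 9/2`, so it is small
  -- uniformly in `e`.
  have e1 : 5 * δ * e ^ 2 * σ * σ = 5 * δ * (9 / 2) ^ 2 := by rw [← hσe]; ring
  rw [e1] at hpos
  have e2 : σ • v 0 = z σ - z 0 - ((z σ - σ • v 0) - (z 0 - (0 : ℝ) • v 0)) := by module
  have i1 : ‖σ • v 0‖ ≤ ‖z σ‖ + ‖z 0‖ + 5 * δ * (9 / 2) ^ 2 := by
    rw [e2]
    exact (norm_sub_le _ _).trans (add_le_add (norm_sub_le _ _) hpos)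
  have i2 : ‖σ • v 0‖ = σ * ‖v 0‖ := by rw [norm_smul, Real.norm_eq_abs, abs_of_pos hσ0]
  have i3 : σ * (98 / 100 * e) ≤ σ * ‖v 0‖ := by
    gcongr
    exact (h.norm_vel_bounds (hsub h0)).1
  have i4 := h.inBall _ (hsub h0)
  have i5 := h.inBall _ (hsub h1)
  norm_num at hsm
  linarith

theorem norm_vel_le_five [CompleteSpace E] (h : IsNullPath G p q T z v a θ e) {s : ℝ}
    (hs : s ∈ Icc (0 : ℝ) 1) : ‖v s‖ ≤ 5 := by
  linarith [(h.norm_vel_bounds hs).2, h.energy_le]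

theorem norm_acc_le [CompleteSpace E] (h : IsNullPath G p q T z v a θ e) {s : ℝ}
    (hs : s ∈ Icc (0 : ℝ) 1) : ‖a s‖ ≤ 100 * δ := by
  refine (h.norm_acc_le_norm_vel hs).trans ?_
  have : ‖v s‖ ^ 2 ≤ 5 ^ 2 := by
    have := h.norm_vel_le_five hs
    gcongr
  nlinarith [mul_le_mul_of_nonneg_left this G.nonneg]

theorem norm_acc_le_one [CompleteSpace E] (h : IsNullPath G p q T z v a θ e) {s : ℝ}
    (hs : s ∈ Icc (0 : ℝ) 1) : ‖a s‖ ≤ 1 := by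
  have := h.norm_acc_le hs
  have := G.small
  norm_num at this
  linarith

/-- Both accelerations are the same function of position, velocity and acceleration, with Lipschitz
constant `100 δ`. This controls two rays with a common source by the distance of their targets. -/
theorem norm_acc_sub_le [CompleteSpace E] (h : IsNullPath G p q T z v a θ e)
    (h' : IsNullPath G p q' T' z' v' a' θ' e') {s : ℝ} (hs : s ∈ Icc (0 : ℝ) 1) :
    ‖a s - a' s‖ ≤ 400 * δ * ‖q - q'‖ := by
  have hδ := G.nonneg
  have hsm := G.small
  have := h.toIsMotion.norm_acc_sub_le h'.toIsMotion (κ := 100 * δ) (by positivity)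
    (by norm_num at hsm; linarith) (h.start.trans h'.start.symm) (fun s hs => by
      have := G.norm_accel_sub_le (a := a s) (h.inBall s hs) (h'.inBall s hs)
        (h.norm_vel_le_five hs) (h'.norm_vel_le_five hs) (h'.norm_acc_le_one hs)
      rwa [← (G.eq_accel_iff _ _ _).2 (h.equation s hs),
        ← (G.eq_accel_iff _ _ _).2 (h'.equation s hs)] at this) hs
  rw [h.finish, h'.finish] at this
  linarith

theorem norm_pos_sub_le [CompleteSpace E] (h : IsNullPath G p q T z v a θ e)
    (h' : IsNullPath G p q' T' z' v' a' θ' e') {s : ℝ} (hs : s ∈ Icc (0 : ℝ) 1) :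
    ‖z s - z' s‖ ≤ 2 * ‖q - q'‖ := by
  have := (h.toIsMotion.sub h'.toIsMotion).norm_pos_le (R := ‖q - q'‖)
    (fun s hs => h.norm_acc_sub_le h' hs) (by simp [h.start, h'.start])
    (by simp [h.finish, h'.finish]) hs
  have h1 : 400 * δ * ‖q - q'‖ ≤ 1 * ‖q - q'‖ :=
    mul_le_mul_of_nonneg_right (by have := G.small; norm_num at *; linarith) (norm_nonneg _)
  simp only [Pi.sub_apply] at this
  linarith

theorem norm_vel_sub_vel_le [CompleteSpace E] (h : IsNullPath G p q T z v a θ e)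
    (h' : IsNullPath G p q' T' z' v' a' θ' e') {s : ℝ} (hs : s ∈ Icc (0 : ℝ) 1) :
    ‖(v s - v' s) - (q - q')‖ ≤ 400 * δ * ‖q - q'‖ := by
  have := (h.toIsMotion.sub h'.toIsMotion).norm_vel_sub_le
    (fun s hs => h.norm_acc_sub_le h' hs) hs
  simp only [Pi.sub_apply, h.start, h'.start, h.finish, h'.finish, sub_self, sub_zero] at this
  exact this

theorem time_one_bounds (h : IsNullPath G p q T z v a θ e) : |θ 1 - 1| ≤ 4 * δ := by
  have hδ := G.nonneg
  have hsm := G.small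
  norm_num at hsm
  have := (convex_Icc (0 : ℝ) 1).norm_image_sub_le_of_norm_hasDerivWithin_le
    (f := fun s => θ s - s) (f' := fun s => 1 / G.W (z s) ^ 2 - 1) (C := 4 * δ) (x := 0) (y := 1)
    (fun x hx => (h.time x hx).fun_sub (hasDerivWithinAt_id x _)) (fun x hx => by
      have h1 := abs_le.1 (G.W_near _ (h.inBall x hx))
      obtain ⟨h2, h3⟩ := G.W_bounds (h.inBall x hx)
      have h4 : 0 < G.W (z x) := by linarith
      have h5 : G.W (z x) ^ 2 ≤ 1 + 3 * δ := by nlinarith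
      have h6 : 1 - 3 * δ ≤ G.W (z x) ^ 2 := by nlinarith
      rw [Real.norm_eq_abs, abs_le]
      constructor
      · rw [le_sub_iff_add_le, le_div_iff₀ (by positivity)]
        nlinarith
      · rw [sub_le_iff_le_add, div_le_iff₀ (by positivity)]
        nlinarith) (by simp) (by simp)
  simpa [h.time_zero] using this

theorem abs_time_one_sub_le [CompleteSpace E] (h : IsNullPath G p q T z v a θ e)
    (h' : IsNullPath G p q' T' z' v' a' θ' e') : |θ 1 - θ' 1| ≤ 8 * δ * ‖q - q'‖ := by
  have hδ := G.nonneg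
  have := (convex_Icc (0 : ℝ) 1).norm_image_sub_le_of_norm_hasDerivWithin_le
    (f := fun s => θ s - θ' s) (f' := fun s => 1 / G.W (z s) ^ 2 - 1 / G.W (z' s) ^ 2)
    (C := 8 * δ * ‖q - q'‖) (x := 0) (y := 1)
    (fun x hx => (h.time x hx).fun_sub (h'.time x hx)) (fun x hx => by
      obtain ⟨h2, h3⟩ := G.W_bounds (h.inBall x hx)
      obtain ⟨h2', h3'⟩ := G.W_bounds (h'.inBall x hx)
      have h4 : 0 < G.W (z x) := by linarith
      have h4' : 0 < G.W (z' x) := by linarith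
      have e : 1 / G.W (z x) ^ 2 - 1 / G.W (z' x) ^ 2 =
          (G.W (z' x) - G.W (z x)) * (G.W (z' x) + G.W (z x)) /
            (G.W (z x) ^ 2 * G.W (z' x) ^ 2) := by
        field_simp; ring
      have h5 : |G.W (z' x) - G.W (z x)| ≤ δ * (2 * ‖q - q'‖) := by
        rw [abs_sub_comm]
        refine (G.W_lip (h.inBall x hx) (h'.inBall x hx)).trans ?_
        gcongr
        exact h.norm_pos_sub_le h' hx
      have h6 : (99 / 100) ^ 2 * (99 / 100) ^ 2 ≤ G.W (z x) ^ 2 * G.W (z' x) ^ 2 := by gcongr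
      rw [e, Real.norm_eq_abs, abs_div, abs_mul, abs_of_pos (by positivity :
        0 < G.W (z x) ^ 2 * G.W (z' x) ^ 2), abs_of_pos (by positivity :
        0 < G.W (z' x) + G.W (z x)), div_le_iff₀ (by positivity)]
      have h7 : 0 ≤ δ * ‖q - q'‖ := by positivity
      calc _ ≤ δ * (2 * ‖q - q'‖) * (101 / 100 + 101 / 100) := by gcongr
        _ ≤ 8 * δ * ‖q - q'‖ * ((99 / 100) ^ 2 * (99 / 100) ^ 2) := by nlinarith
        _ ≤ _ := by gcongr) (by simp) (by simp)
  simpa [h.time_zero, h'.time_zero] using this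

end IsNullPath

end NearlyFlat

/-! ### Travel time compared with Euclidean distance -/

namespace NearlyFlat

variable {E : Type*} [NormedAddCommGroup E] [InnerProductSpace ℝ E] {δ : ℝ}

variable {G : NearlyFlat E δ} {p q q' : E} {T T' e e' : ℝ} {z v a z' v' a' : ℝ → E} {θ θ' : ℝ → ℝ}

namespace IsNullPath

theorem zero_mem : (0 : ℝ) ∈ Icc (0 : ℝ) 1 := by simp

theorem norm_start_lt (h : IsNullPath G p q T z v a θ e) : ‖p‖ < 2 := by
  have := h.inBall 0 (by simp)
  rwa [h.start] at this

theorem norm_finish_lt (h : IsNullPath G p q T z v a θ e) : ‖q‖ < 2 := by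
  have := h.inBall 1 (by simp)
  rwa [h.finish] at this

theorem norm_vel_zero_sub_le [CompleteSpace E] (h : IsNullPath G p q T z v a θ e) :
    ‖v 0 - (q - p)‖ ≤ 100 * δ := by
  have := h.toIsMotion.norm_vel_sub_le (fun s hs => h.norm_acc_le hs) (s := 0) (by simp)
  rwa [h.start, h.finish] at this

/-- Conservation of energy, evaluated at the source, expresses the travel time by the initial
velocity and the integral `θ 1` of the inverse squared lapse. -/
theorem time_sq (h : IsNullPath G p q T z v a θ e) :
    T ^ 2 = (G.W p * θ 1) ^ 2 * G.k p (v 0) (v 0) := by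
  have := h.energy 0 (by simp)
  rw [h.start] at this
  rw [← h.time_one, mul_pow, ← this]
  ring

/-- The excess over the squared distance is split according to its three causes: the lapse, the
metric at the source, and the deviation `v 0 - (q - p)` of the initial velocity from the chord. Each
part is of order `δ` and also has a Lipschitz constant of order `δ` in the target. -/
theorem time_sq_sub (h : IsNullPath G p q T z v a θ e) :
    T ^ 2 - ‖q - p‖ ^ 2 = ((G.W p * θ 1) ^ 2 - 1) * G.k p (v 0) (v 0) +
      (G.k p (v 0) (v 0) - inner ℝ (v 0) (v 0)) +
      (2 * inner ℝ (q - p) (v 0 - (q - p)) +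
        inner ℝ (v 0 - (q - p)) (v 0 - (q - p))) := by
  rw [h.time_sq, ← real_inner_self_eq_norm_sq]
  have : v 0 = (q - p) + (v 0 - (q - p)) := by abel
  have e : inner ℝ (v 0) (v 0) = inner ℝ (q - p) (q - p) + 2 * inner ℝ (q - p) (v 0 - (q - p)) +
      inner ℝ (v 0 - (q - p)) (v 0 - (q - p)) := by
    conv_lhs => rw [this]
    rw [real_inner_add_add_self]
  rw [e]
  ring

theorem abs_factor_sub_one_le (h : IsNullPath G p q T z v a θ e) :
    |(G.W p * θ 1) ^ 2 - 1| ≤ 20 * δ := by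
  have hδ := G.nonneg
  have hsm := G.small
  norm_num at hsm
  have h1 := abs_le.1 h.time_one_bounds
  have h2 := abs_le.1 (G.W_near p h.norm_start_lt)
  have h3 : G.W p * θ 1 ≤ 1 + 6 * δ := by nlinarith
  have h4 : 1 - 6 * δ ≤ G.W p * θ 1 := by nlinarith
  rw [abs_le]
  constructor <;> nlinarith

theorem abs_factor_sub_le [CompleteSpace E] (h : IsNullPath G p q T z v a θ e)
    (h' : IsNullPath G p q' T' z' v' a' θ' e') :
    |(G.W p * θ 1) ^ 2 - (G.W p * θ' 1) ^ 2| ≤ 20 * δ * ‖q - q'‖ := by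
  have hδ := G.nonneg
  have hsm := G.small
  norm_num at hsm
  have h1 := abs_le.1 h.time_one_bounds
  have h1' := abs_le.1 h'.time_one_bounds
  obtain ⟨h2, h3⟩ := G.W_bounds h.norm_start_lt
  have e : (G.W p * θ 1) ^ 2 - (G.W p * θ' 1) ^ 2 =
      G.W p ^ 2 * (θ 1 - θ' 1) * (θ 1 + θ' 1) := by ring
  rw [e, abs_mul, abs_mul, abs_of_nonneg (sq_nonneg (G.W p)),
    abs_of_pos (by linarith : 0 < θ 1 + θ' 1)]
  have h5 : 0 ≤ δ * ‖q - q'‖ := by positivity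
  calc _ ≤ (101 / 100) ^ 2 * (8 * δ * ‖q - q'‖) * (21 / 10) := by
        gcongr
        · linarith
        · exact h.abs_time_one_sub_le h'
        · linarith
    _ ≤ _ := by nlinarith

theorem abs_time_sq_sub_le [CompleteSpace E] (h : IsNullPath G p q T z v a θ e) :
    |T ^ 2 - ‖q - p‖ ^ 2| ≤ 10 ^ 4 * δ := by
  have hδ := G.nonneg
  have hsm := G.small
  norm_num at hsm
  rw [h.time_sq_sub]
  have hv := h.norm_vel_le_five (s := 0) (by simp)
  have hr := h.norm_vel_zero_sub_le
  have hd : ‖q - p‖ ≤ 4 :=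
    (norm_sub_le _ _).trans (by linarith [h.norm_start_lt, h.norm_finish_lt])
  have i1 : |((G.W p * θ 1) ^ 2 - 1) * G.k p (v 0) (v 0)| ≤
      20 * δ * (101 / 100 * (5 * 5)) := by
    rw [abs_mul]
    gcongr
    · exact h.abs_factor_sub_one_le
    · exact (G.k_le h.norm_start_lt _ _).trans (by gcongr)
  have i2 : |G.k p (v 0) (v 0) - inner ℝ (v 0) (v 0)| ≤ δ * (5 * 5) :=
    (G.k_near p h.norm_start_lt _ _).trans (by gcongr)
  have i3 : |inner ℝ (q - p) (v 0 - (q - p))| ≤ 4 * (100 * δ) :=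
    (abs_real_inner_le_norm _ _).trans (by gcongr)
  have i4 : |inner ℝ (v 0 - (q - p)) (v 0 - (q - p))| ≤ 1 * (100 * δ) :=
    (abs_real_inner_le_norm _ _).trans (by gcongr; linarith)
  have i1 := abs_le.1 i1
  have i2 := abs_le.1 i2
  have i3 := abs_le.1 i3
  have i4 := abs_le.1 i4
  rw [abs_le]
  constructor <;> linarith

/-- Smallness of the excess alone would not give a contraction; this Lipschitz bound in the target
is what trilateration needs. The difference is expanded so that every term contains a factor of
order `δ` and a factor of order `‖q - q'‖`. -/
theorem abs_time_sq_sub_sub_le [CompleteSpace E] (h : IsNullPath G p q T z v a θ e)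
    (h' : IsNullPath G p q' T' z' v' a' θ' e') :
    |(T ^ 2 - ‖q - p‖ ^ 2) - (T' ^ 2 - ‖q' - p‖ ^ 2)| ≤ 10 ^ 4 * δ * ‖q - q'‖ := by
  have hδ := G.nonneg
  have hsm := G.small
  norm_num at hsm
  have m0 : (0 : ℝ) ∈ Icc (0 : ℝ) 1 := by simp
  have hv := h.norm_vel_le_five m0
  have hv' := h'.norm_vel_le_five m0
  have hr := h.norm_vel_zero_sub_le
  have hr' := h'.norm_vel_zero_sub_le
  have hp := h.norm_start_lt
  have hd : ‖q' - p‖ ≤ 4 :=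
    (norm_sub_le _ _).trans (by linarith [h.norm_start_lt, h'.norm_finish_lt])
  have hQ := norm_nonneg (q - q')
  have hdr := h.norm_vel_sub_vel_le h' m0
  have hdv : ‖v 0 - v' 0‖ ≤ 2 * ‖q - q'‖ := by
    have := norm_le_norm_add_norm_sub' (v 0 - v' 0) (q - q')
    nlinarith
  rw [h.time_sq_sub, h'.time_sq_sub]
  set A := (G.W p * θ 1) ^ 2
  set A' := (G.W p * θ' 1) ^ 2
  set r := v 0 - (q - p)
  set r' := v' 0 - (q' - p)
  have er : r - r' = (v 0 - v' 0) - (q - q') := by simp only [r, r']; abel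
  rw [← er] at hdr
  have i1 : |(A - 1) * (G.k p (v 0) (v 0) - G.k p (v' 0) (v' 0))| ≤
      20 * δ * (11 * (2 * ‖q - q'‖)) := by
    rw [abs_mul]
    gcongr
    · exact h.abs_factor_sub_one_le
    · refine (G.abs_k_self_sub_le hp hp hv hv').trans ?_
      rw [sub_self, norm_zero, add_zero]
      gcongr
  have i2 : |(A - A') * G.k p (v' 0) (v' 0)| ≤ 20 * δ * ‖q - q'‖ * (101 / 100 * (5 * 5)) := by
    rw [abs_mul]
    gcongr
    · exact h.abs_factor_sub_le h'
    · exact (G.k_le hp _ _).trans (by gcongr)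
  have i3 : |G.k p (v 0 - v' 0) (v 0) - inner ℝ (v 0 - v' 0) (v 0)| ≤
      δ * ((2 * ‖q - q'‖) * 5) := (G.k_near p hp _ _).trans (by gcongr)
  have i4 : |G.k p (v' 0) (v 0 - v' 0) - inner ℝ (v' 0) (v 0 - v' 0)| ≤
      δ * (5 * (2 * ‖q - q'‖)) := (G.k_near p hp _ _).trans (by gcongr)
  have i5 : |inner ℝ (q - q') r| ≤ ‖q - q'‖ * (100 * δ) :=
    (abs_real_inner_le_norm _ _).trans (by gcongr)
  have i6 : |inner ℝ (q' - p) (r - r')| ≤ 4 * (400 * δ * ‖q - q'‖) :=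
    (abs_real_inner_le_norm _ _).trans (by gcongr)
  have i7 : |inner ℝ (r - r') (r + r')| ≤ (400 * δ * ‖q - q'‖) * 1 :=
    (abs_real_inner_le_norm _ _).trans (by
      gcongr
      exact (norm_add_le _ _).trans (by linarith))
  have e : ((A - 1) * G.k p (v 0) (v 0) + (G.k p (v 0) (v 0) - inner ℝ (v 0) (v 0)) +
      (2 * inner ℝ (q - p) r + inner ℝ r r)) -
      ((A' - 1) * G.k p (v' 0) (v' 0) + (G.k p (v' 0) (v' 0) - inner ℝ (v' 0) (v' 0)) +
      (2 * inner ℝ (q' - p) r' + inner ℝ r' r')) =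
      (A - 1) * (G.k p (v 0) (v 0) - G.k p (v' 0) (v' 0)) + (A - A') * G.k p (v' 0) (v' 0) +
      (G.k p (v 0 - v' 0) (v 0) - inner ℝ (v 0 - v' 0) (v 0)) +
      (G.k p (v' 0) (v 0 - v' 0) - inner ℝ (v' 0) (v 0 - v' 0)) +
      2 * inner ℝ (q - q') r + 2 * inner ℝ (q' - p) (r - r') + inner ℝ (r - r') (r + r') := by
    have : q - q' = (q - p) - (q' - p) := by abel
    rw [this]
    simp only [map_sub, sub_apply, inner_sub_left, inner_sub_right, inner_add_right,
      real_inner_comm (v 0) (v' 0), real_inner_comm r r']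
    ring
  rw [e]
  have i1 := abs_le.1 i1
  have i2 := abs_le.1 i2
  have i3 := abs_le.1 i3
  have i4 := abs_le.1 i4
  have i5 := abs_le.1 i5
  have i6 := abs_le.1 i6
  have i7 := abs_le.1 i7
  have hδQ : 0 ≤ δ * ‖q - q'‖ := by positivity
  rw [abs_le]
  constructor <;> linarith

/-- A null path is determined by its end points. -/
theorem unique [CompleteSpace E] (h : IsNullPath G p q T z v a θ e)
    (h' : IsNullPath G p q T' z' v' a' θ' e') :
    T = T' ∧ e = e' ∧ EqOn z z' (Icc 0 1) ∧ EqOn θ θ' (Icc 0 1) := by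
  have hz : EqOn z z' (Icc 0 1) := fun s hs => by
    have := h.norm_pos_sub_le h' hs
    rw [sub_self, norm_zero, mul_zero] at this
    exact sub_eq_zero.1 (norm_le_zero_iff.1 this)
  have hv : v 0 = v' 0 := by
    have := h.norm_vel_sub_vel_le h' zero_mem
    rw [sub_self, norm_zero, mul_zero, sub_zero] at this
    exact sub_eq_zero.1 (norm_le_zero_iff.1 this)
  have he : e = e' := by
    have h1 := h.energy 0 zero_mem
    rw [hz zero_mem, hv, h'.energy 0 zero_mem] at h1
    exact ((pow_left_inj₀ h'.energy_nonneg h.energy_nonneg two_ne_zero).1 h1).symm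
  have hθ : EqOn θ θ' (Icc 0 1) := fun s hs => by
    have := (convex_Icc (0 : ℝ) 1).norm_image_sub_le_of_norm_hasDerivWithin_le
      (f := fun s => θ s - θ' s) (f' := fun _ => 0) (C := 0) (x := 0) (y := s)
      (fun x hx => by
        have := (h.time x hx).fun_sub (h'.time x hx)
        rwa [hz hx, sub_self] at this) (by simp) (by simp) hs
    simpa [h.time_zero, h'.time_zero, sub_eq_zero] using this
  refine ⟨?_, he, hz, hθ⟩
  rw [← h.time_one, ← h'.time_one, he, hθ (by simp)]

/-- The path equation and the energy are even in the velocity, so reversal preserves both; the time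
function is reflected. -/
theorem reverse (h : IsNullPath G p q T z v a θ e) :
    IsNullPath G q p T (fun s => z (1 - s)) (fun s => -v (1 - s)) (fun s => a (1 - s))
      (fun s => θ 1 - θ (1 - s)) e := by
  have hm : MapsTo (fun s : ℝ => 1 - s) (Icc 0 1) (Icc 0 1) := fun s hs =>
    ⟨by linarith [hs.2], by linarith [hs.1]⟩
  have hd : ∀ s, HasDerivWithinAt (fun s : ℝ => 1 - s) (-1) (Icc 0 1) s := fun s =>
    (hasDerivWithinAt_id s _).const_sub 1
  refine ⟨⟨fun s hs => ?_, fun s hs => ?_, ?_⟩, by simp [h.finish], by simp [h.start],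
    fun s hs => h.inBall _ (hm hs), fun s hs w => ?_, h.energy_nonneg, fun s hs => ?_, by simp,
    by simp [h.time_zero, h.time_one], fun s hs => ?_⟩
  · simpa [Function.comp_def] using (h.pos _ (hm hs)).scomp s (hd s) hm
  · simpa using ((h.vel _ (hm hs)).scomp s (hd s) hm).fun_neg
  · exact h.acc.comp (by fun_prop) hm
  · simpa using h.equation _ (hm hs) w
  · simpa using h.energy _ (hm hs)
  · simpa using ((h.time _ (hm hs)).scomp s (hd s) hm).const_sub (θ 1)

end IsNullPath

theorem hasDerivWithinAt_k_comp (G : NearlyFlat E δ) {z v : ℝ → E} {s : ℝ} (h : ‖z s‖ < 2)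
    (h' : HasDerivWithinAt z (v s) (Icc 0 1) s) :
    HasDerivWithinAt (fun s => G.k (z s)) (G.dk (z s) (v s)) (Icc 0 1) s := by
  have h1 := G.deriv_k (z s) h
  have h2 := HasFDerivAt.comp_hasDerivWithinAt (l := G.k) (l' := G.dk (z s)) s h1 h'
  exact h2

theorem exists_isNullPath [CompleteSpace E] (G : NearlyFlat E δ) {p q : E} (hp : ‖p‖ ≤ 9 / 5)
    (hq : ‖q‖ ≤ 9 / 5) : ∃ T z v a θ e, IsNullPath G p q T z v a θ e := by
  have hδ := G.nonneg
  have hsm := G.small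
  norm_num at hsm
  obtain ⟨z, v, a, hm, h0, h1, hr⟩ := exists_isMotion_boundary (Φ := G.accel) (κ := 100 * δ)
    (by positivity) (by linarith)
    (fun z v a hz hv ha => (G.norm_accel_le hz v a).trans (by
      have : ‖v‖ ^ 2 ≤ 5 ^ 2 := by gcongr
      nlinarith))
    (fun z v a z' v' a' hz hv ha hz' hv' ha' => G.norm_accel_sub_le hz hz' hv hv' ha') hp hq
  have heq := fun s hs => (G.eq_accel_iff _ _ _).1 (hr s hs).2.2.2
  have hW : ∀ s ∈ Icc (0 : ℝ) 1, 0 < G.W (z s) := fun s hs => by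
    linarith [(G.W_bounds (hr s hs).1).1]
  have hdW : ∀ s ∈ Icc (0 : ℝ) 1,
      HasDerivWithinAt (fun s => G.W (z s)) (G.dW (z s) (v s)) (Icc 0 1) s := fun s hs =>
    (G.deriv_W _ (hr s hs).1).comp_hasDerivWithinAt s (hm.pos s hs)
  have hdk : ∀ s ∈ Icc (0 : ℝ) 1,
      HasDerivWithinAt (fun s => G.k (z s)) (G.dk (z s) (v s)) (Icc 0 1) s := fun s hs =>
    G.hasDerivWithinAt_k_comp (hr s hs).1 (hm.pos s hs)
  -- Conservation of energy: the derivative is `2 W²` times the left-hand side of the path equation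
  -- tested with the velocity itself.
  have hF : ∀ s ∈ Icc (0 : ℝ) 1, HasDerivWithinAt
      (fun s => G.W (z s) ^ 2 * G.k (z s) (v s) (v s)) 0 (Icc 0 1) s := fun s hs => by
    have h2 := (((hdW s hs).fun_pow 2).fun_mul
      (((hdk s hs).clm_apply (hm.vel s hs)).clm_apply (hm.vel s hs)))
    refine h2.congr_deriv ?_
    have h3 := heq s hs (v s)
    have h4 := hW s hs
    have h5 := G.symm _ (hr s hs).1 (v s) (a s)
    simp only [add_apply] at *
    rw [h5]
    field_simp at h3
    push_cast
    linear_combination G.W (z s) * h3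
  have hE : ∀ s ∈ Icc (0 : ℝ) 1, G.W (z s) ^ 2 * G.k (z s) (v s) (v s) =
      G.W (z 0) ^ 2 * G.k (z 0) (v 0) (v 0) := fun s hs => by
    have := (convex_Icc (0 : ℝ) 1).norm_image_sub_le_of_norm_hasDerivWithin_le
      (C := 0) (x := 0) (y := s) hF (by simp) (by simp) hs
    rw [zero_mul] at this
    exact sub_eq_zero.1 (norm_le_zero_iff.1 this)
  have hk0 : 0 ≤ G.k (z 0) (v 0) (v 0) :=
    le_trans (by positivity) (G.k_self_bounds (hr 0 (by simp)).1 (v 0)).1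
  -- The integrand is extended to the line by constants beyond the end points, so that it is
  -- continuous everywhere.
  let f : ℝ → ℝ := fun s => 1 / G.W (z (projIcc 0 1 zero_le_one s)) ^ 2
  have hf : Continuous f := by
    have h2 : ContinuousOn (fun s => 1 / G.W (z s) ^ 2) (Icc 0 1) := by
      refine ContinuousOn.div continuousOn_const
        (ContinuousOn.pow (fun s hs => (hdW s hs).continuousWithinAt) 2) fun s hs => ?_
      have := hW s hs
      positivity
    exact (continuousOn_iff_continuous_domRestrict.1 h2).comp continuous_projIcc
  refine ⟨_, z, v, a, fun s => ∫ r in (0 : ℝ)..s, f r,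
    Real.sqrt (G.W (z 0) ^ 2 * G.k (z 0) (v 0) (v 0)),
    { hm with
      start := h0
      finish := h1
      inBall := fun s hs => (hr s hs).1
      equation := heq
      energy_nonneg := Real.sqrt_nonneg _
      energy := fun s hs => ?_
      time_zero := by simp
      time_one := rfl
      time := fun s hs => ?_ }⟩
  · rw [Real.sq_sqrt (by positivity), hE s hs]
  · have h2 := (hf.integral_hasStrictDerivAt 0 s).hasDerivAt.hasDerivWithinAt (s := Icc 0 1)
    have e : f s = 1 / G.W (z s) ^ 2 := by simp [f, projIcc_of_mem zero_le_one hs]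
    rwa [e] at h2

end NearlyFlat

/-! ### Perturbed intersection of three unit spheres -/

section Trilateration

variable {E : Type*} [NormedAddCommGroup E] [InnerProductSpace ℝ E]

theorem abs_inner_sub_half_le {u v : E} {η : ℝ} (hu : |‖u‖ ^ 2 - 1| ≤ η) (hv : |‖v‖ ^ 2 - 1| ≤ η)
    (huv : |‖u - v‖ ^ 2 - 1| ≤ η) : |inner ℝ u v - 1 / 2| ≤ 3 / 2 * η := by
  have h := norm_sub_sq_real u v
  have h1 := abs_le.1 hu
  have h2 := abs_le.1 hv
  have h3 := abs_le.1 huv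
  rw [abs_le]
  constructor <;> linarith

/-- Coefficients with respect to three unit vectors at mutual angles of 60 degrees of half the vector
whose inner products with them are given. -/
noncomputable def dualCoeff (b : Fin 3 → ℝ) (i : Fin 3) : ℝ := b i - (b 0 + b 1 + b 2) / 4

theorem dualCoeff_sub (b b' : Fin 3 → ℝ) (i : Fin 3) :
    dualCoeff (b - b') i = dualCoeff b i - dualCoeff b' i := by
  simp only [dualCoeff, Pi.sub_apply]; ring

theorem abs_dualCoeff_le (b : Fin 3 → ℝ) (i : Fin 3) : |dualCoeff b i| ≤ 7 / 4 * ‖b‖ := by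
  have h := fun j => abs_le.1 ((Real.norm_eq_abs _).symm.le.trans (norm_le_pi_norm b j))
  have h0 := h 0
  have h1 := h 1
  have h2 := h 2
  have hi := h i
  rw [dualCoeff, abs_le]
  constructor <;> linarith

/-- The point, relative to the apex of three vectors `u`, with coefficients `dualCoeff b`. -/
noncomputable def dualComb (u : Fin 3 → E) (b : Fin 3 → ℝ) : E := ∑ i, dualCoeff b i • u i

theorem dualComb_sub (u : Fin 3 → E) (b b' : Fin 3 → ℝ) :
    dualComb u (b - b') = dualComb u b - dualComb u b' := by
  simp only [dualComb, dualCoeff_sub, sub_smul, Finset.sum_sub_distrib]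

theorem norm_dualComb_le {u : Fin 3 → E} (hu : ∀ i, |‖u i‖ ^ 2 - 1| ≤ 1 / 1000) (b : Fin 3 → ℝ) :
    ‖dualComb u b‖ ≤ 6 * ‖b‖ := by
  have h : ∀ i, ‖dualCoeff b i • u i‖ ≤ 7 / 4 * ‖b‖ * (101 / 100) := fun i => by
    have h1 : ‖u i‖ ≤ 101 / 100 := by
      refine le_of_sq_le_sq ?_ (by norm_num)
      have := abs_le.1 (hu i)
      linarith
    rw [norm_smul]
    gcongr
    exact abs_dualCoeff_le b i
  refine (norm_sum_le_of_le _ fun i _ => h i).trans ?_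
  have := norm_nonneg b
  simp
  linarith

/-- For unit vectors at mutual angles of 60 degrees, twice the Gram matrix is `I + J` with `J` the
all-ones matrix, and its inverse is `I - J/4`, as in `dualCoeff`. Here the Gram matrix is only
nearly this one, which leaves the error on the right. -/
theorem abs_inner_dualComb_sub_le {u : Fin 3 → E} (hu : ∀ i, |‖u i‖ ^ 2 - 1| ≤ 1 / 1000)
    (huu : ∀ i j, i ≠ j → |‖u i - u j‖ ^ 2 - 1| ≤ 1 / 1000) (b : Fin 3 → ℝ) (i : Fin 3) :
    |2 * inner ℝ (u i) (dualComb u b) - b i| ≤ 1 / 50 * ‖b‖ := by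
  have e : 2 * inner ℝ (u i) (dualComb u b) - b i =
      ∑ j, 2 * dualCoeff b j * (inner ℝ (u i) (u j) - if i = j then 1 else 1 / 2) := by
    rw [dualComb, inner_sum]
    simp only [real_inner_smul_right, Fin.sum_univ_three]
    fin_cases i <;> simp [dualCoeff] <;> ring
  rw [e]
  have h : ∀ j, |2 * dualCoeff b j * (inner ℝ (u i) (u j) - if i = j then 1 else 1 / 2)| ≤
      2 * (7 / 4 * ‖b‖) * (3 / 2 * (1 / 1000)) := fun j => by
    rw [abs_mul, abs_mul, abs_two]
    gcongr
    · exact abs_dualCoeff_le b j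
    · split_ifs with hij
      · rw [hij, real_inner_self_eq_norm_sq]
        linarith [hu j]
      · exact abs_inner_sub_half_le (hu i) (hu j) (huu i j hij)
  refine (Finset.abs_sum_le_sum_abs _ _).trans ((Finset.sum_le_sum fun j _ => h j).trans ?_)
  have := norm_nonneg b
  simp
  linarith

/-- Newton's method with the derivative frozen at that of the exact regular configuration. The
unknown is the vector `b` of intended values of `2⟨u i, x⟩`, and the correction is sought in the
span of the `u i`. The bounds on the coefficients `c` later decide on which side of a plane the
solution lies. -/
theorem exists_trilateration {u : Fin 3 → E} (hu : ∀ i, |‖u i‖ ^ 2 - 1| ≤ 1 / 1000)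
    (huu : ∀ i j, i ≠ j → |‖u i - u j‖ ^ 2 - 1| ≤ 1 / 1000) {err : Fin 3 → E → ℝ}
    (herr : ∀ i x, ‖x‖ ≤ 1 / 20 → |err i x| ≤ 1 / 1000)
    (hlip : ∀ i x y, ‖x‖ ≤ 1 / 20 → ‖y‖ ≤ 1 / 20 →
      |err i x - err i y| ≤ 1 / 1000 * ‖x - y‖) :
    ∃ c : Fin 3 → ℝ, (∀ i, |c i| ≤ 1 / 20) ∧ ‖∑ i, c i • u i‖ ≤ 1 / 20 ∧
      ∀ i, ‖u i + ∑ j, c j • u j‖ ^ 2 + err i (∑ j, c j • u j) = 1 := by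
  -- On this ball `‖x‖ ≤ 6/125 < 1/20`. The errors `1/1000` (twice), `‖b‖/50` and `‖x‖²` add up to
  -- less than `1/125`.
  let B := Metric.closedBall (0 : Fin 3 → ℝ) (1 / 125)
  let F : (Fin 3 → ℝ) → Fin 3 → ℝ := fun b i =>
    b i - (‖u i + dualComb u b‖ ^ 2 + err i (dualComb u b) - 1)
  have eF : ∀ b i, F b i = -((‖u i‖ ^ 2 - 1) + (2 * inner ℝ (u i) (dualComb u b) - b i) +
      ‖dualComb u b‖ ^ 2 + err i (dualComb u b)) := fun b i => by
    simp only [F, norm_add_sq_real]; ring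
  have hB : ∀ b ∈ B, ‖b‖ ≤ 1 / 125 ∧ ‖dualComb u b‖ ≤ 6 / 125 := fun b hb => by
    have h1 : ‖b‖ ≤ 1 / 125 := by simpa [B] using hb
    exact ⟨h1, (norm_dualComb_le hu b).trans (by linarith)⟩
  have hF : ∀ b ∈ B, F b ∈ B := fun b hb => by
    obtain ⟨h1, h2⟩ := hB b hb
    rw [mem_closedBall_zero_iff, pi_norm_le_iff_of_nonneg (by norm_num)]
    intro i
    have i1 := abs_le.1 (hu i)
    have i2 := abs_le.1 (abs_inner_dualComb_sub_le hu huu b i)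
    have i3 := abs_le.1 (herr i (dualComb u b) (by linarith))
    have i4 : ‖dualComb u b‖ ^ 2 ≤ (6 / 125) ^ 2 := by gcongr
    have i5 := sq_nonneg ‖dualComb u b‖
    rw [eF, Real.norm_eq_abs, abs_le]
    norm_num at i4
    constructor <;> linarith
  let f : B → B := fun b => ⟨F b, hF b b.2⟩
  -- The Lipschitz constant is at most `1/50 + 6 * 12/125 + 6/1000`; the quadratic term contributes
  -- most of it.
  have hf : ContractingWith (7 / 10) f := by
    refine ⟨by
      rw [← NNReal.coe_lt_coe]; push_cast; norm_num, LipschitzWith.of_dist_le_mul fun b b' => ?_⟩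
    obtain ⟨h1, h2⟩ := hB b b.2
    obtain ⟨h1', h2'⟩ := hB b' b'.2
    rw [Subtype.dist_eq, Subtype.dist_eq, dist_pi_le_iff (by positivity)]
    intro i
    rw [Real.dist_eq, dist_eq_norm]
    change |F b i - F b' i| ≤ _
    set d := ‖(b : Fin 3 → ℝ) - b'‖
    have hd : 0 ≤ d := norm_nonneg _
    have j1 := abs_inner_dualComb_sub_le hu huu ((b : Fin 3 → ℝ) - b') i
    have j2 := norm_dualComb_le hu ((b : Fin 3 → ℝ) - b')
    rw [dualComb_sub] at j1 j2
    rw [inner_sub_right, Pi.sub_apply] at j1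
    have j3 := hlip i (dualComb u b) (dualComb u b') (by linarith) (by linarith)
    have j4 := abs_norm_sub_norm_le (dualComb u b) (dualComb u b')
    have j5 : |‖dualComb u b‖ ^ 2 - ‖dualComb u b'‖ ^ 2| ≤ 6 * d * (12 / 125) := by
      rw [sq_sub_sq, mul_comm, abs_mul, abs_of_nonneg (by positivity :
        0 ≤ ‖dualComb u (b : Fin 3 → ℝ)‖ + ‖dualComb u (b' : Fin 3 → ℝ)‖)]
      gcongr
      · exact j4.trans j2
      · linarith
    have j1 := abs_le.1 j1
    have j3 := abs_le.1 j3
    have j5 := abs_le.1 j5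
    rw [eF, eF, abs_le]
    push_cast
    constructor <;> linarith
  have : CompleteSpace B := Metric.isClosed_closedBall.completeSpace_coe
  obtain ⟨b, hb, -⟩ := hf.exists_fixedPoint (⟨0, by simp [B]⟩ : B) (edist_ne_top _ _)
  obtain ⟨h1, h2⟩ := hB b b.2
  refine ⟨dualCoeff b, fun i => (abs_dualCoeff_le _ i).trans (by linarith),
    h2.trans (by norm_num), fun i => ?_⟩
  have h3 : F b i = (b : Fin 3 → ℝ) i := congrFun (congrArg Subtype.val hb) i
  simp only [F, dualComb] at h3
  linarith

end Trilateration

/-! ### Points at unit travel time -/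

namespace NearlyFlat

variable {E : Type*} [NormedAddCommGroup E] [InnerProductSpace ℝ E] {δ : ℝ}

/-- A null path leads from `p` to `q` in the time `T`. -/
def HasTime (G : NearlyFlat E δ) (p q : E) (T : ℝ) : Prop :=
  ∃ z v a θ e, IsNullPath G p q T z v a θ e

variable {G : NearlyFlat E δ} {p q q' : E} {T T' : ℝ}

theorem HasTime.symm (h : G.HasTime p q T) : G.HasTime q p T := by
  obtain ⟨z, v, a, θ, e, h⟩ := h
  exact ⟨_, _, _, _, _, h.reverse⟩

theorem HasTime.unique [CompleteSpace E] (h : G.HasTime p q T) (h' : G.HasTime p q T') :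
    T = T' := by
  obtain ⟨z, v, a, θ, e, h⟩ := h
  obtain ⟨z', v', a', θ', e', h'⟩ := h'
  exact (h.unique h').1

theorem HasTime.abs_sq_sub_le [CompleteSpace E] (h : G.HasTime p q T) :
    |‖q - p‖ ^ 2 - T ^ 2| ≤ 1 / 10 ^ 5 := by
  obtain ⟨z, v, a, θ, e, h⟩ := h
  rw [abs_sub_comm]
  refine h.abs_time_sq_sub_le.trans ?_
  have := G.small
  norm_num at *
  linarith

theorem HasTime.abs_sq_sub_one_le [CompleteSpace E] (h : G.HasTime p q 1) :
    |‖q - p‖ ^ 2 - 1| ≤ 1 / 10 ^ 5 := by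
  simpa using h.abs_sq_sub_le

theorem HasTime.nonneg (h : G.HasTime p q T) : 0 ≤ T := by
  obtain ⟨z, v, a, θ, e, h⟩ := h
  rw [← h.time_one]
  have h1 := abs_le.1 h.time_one_bounds
  have h2 := G.small
  norm_num at h2
  exact mul_nonneg h.energy_nonneg (by linarith)

theorem exists_hasTime [CompleteSpace E] (G : NearlyFlat E δ) {p q : E} (hp : ‖p‖ ≤ 9 / 5)
    (hq : ‖q‖ ≤ 9 / 5) : ∃ T, G.HasTime p q T := by
  obtain ⟨T, h⟩ := G.exists_isNullPath hp hq
  exact ⟨T, h⟩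

/-- There is a point at travel time `1` from three given points near any point that has
approximately this property, if the three points have approximately the distances `1`. -/
theorem exists_hasTime_one [CompleteSpace E] (G : NearlyFlat E δ) {p : Fin 3 → E} {q : E}
    (hp : ∀ i, ‖p i‖ ≤ 9 / 5) (hq : ‖q‖ ≤ 7 / 4)
    (hpp : ∀ i j, i ≠ j → |‖p i - p j‖ ^ 2 - 1| ≤ 1 / 1000)
    (hqp : ∀ i, |‖q - p i‖ ^ 2 - 1| ≤ 1 / 1000) :
    ∃ c : Fin 3 → ℝ, (∀ i, |c i| ≤ 1 / 20) ∧ ‖∑ i, c i • (q - p i)‖ ≤ 1 / 20 ∧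
      ∀ i, G.HasTime (p i) (q + ∑ j, c j • (q - p j)) 1 := by
  -- The travel time must be a total function of the displacement; outside the small ball its value
  -- is arbitrary.
  have hex : ∀ i x, ∃ T, ‖x‖ ≤ 1 / 20 → G.HasTime (p i) (q + x) T := fun i x => by
    by_cases hx : ‖x‖ ≤ 1 / 20
    · obtain ⟨T, hT⟩ := G.exists_hasTime (hp i) (q := q + x)
        ((norm_add_le _ _).trans (by linarith))
      exact ⟨T, fun _ => hT⟩
    · exact ⟨0, fun h => absurd h hx⟩
  choose T hT using hex
  obtain ⟨c, hc, hx, h⟩ := exists_trilateration (u := fun i => q - p i) hqp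
    (fun i j hij => by
      rw [sub_sub_sub_cancel_left, norm_sub_rev]
      exact hpp i j hij)
    (err := fun i x => T i x ^ 2 - ‖q + x - p i‖ ^ 2)
    (fun i x hx => by
      rw [abs_sub_comm]
      exact (hT i x hx).abs_sq_sub_le.trans (by norm_num))
    (fun i x y hx hy => by
      obtain ⟨z, v, a, θ, e, h⟩ := hT i x hx
      obtain ⟨z', v', a', θ', e', h'⟩ := hT i y hy
      refine (h.abs_time_sq_sub_sub_le h').trans ?_
      rw [add_sub_add_left_eq_sub]
      gcongr
      have := G.small
      norm_num at *
      linarith)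
  refine ⟨c, hc, hx, fun i => ?_⟩
  have h1 := hT i _ hx
  have h2 := h i
  rw [show q - p i + ∑ j, c j • (q - p j) = q + ∑ j, c j • (q - p j) - p i by abel] at h2
  have h3 : T i (∑ j, c j • (q - p j)) = 1 := by
    rw [← pow_left_inj₀ h1.nonneg zero_le_one two_ne_zero]
    linarith
  rwa [h3] at h1

end NearlyFlat

/-! ### The tetrahedron and the point opposite to a vertex -/

namespace NearlyFlat

/-- The vertices other than 0 are corrected one after the other, each by trilateration from the
other three. A vertex placed at unit travel times has nearly unit distances, so the configuration
remains nearly regular for the next correction. The last one uses only corrected vertices. -/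
theorem exists_isTetrahedron {δ : ℝ} (G : NearlyFlat Space3 δ) :
    ∃ z : Fin 4 → Space3, z 0 = 0 ∧ ∀ i j, i ≠ j → G.HasTime (z i) (z j) 1 := by
  have hs : Real.sqrt 2 ^ 2 = 2 := Real.sq_sqrt (by norm_num)
  set r : ℝ := Real.sqrt 2 / 2
  have hr : r ^ 2 = 1 / 2 := by simp only [r, div_pow, hs]; norm_num
  -- With the origin these are alternate vertices of a cube of side `1/√2`, hence a regular
  -- tetrahedron of edge 1.
  let P : Space3 := !₂[r, r, 0]
  let Q : Space3 := !₂[r, 0, r]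
  let R : Space3 := !₂[0, r, r]
  have nP : ‖P‖ ^ 2 = 1 := by
    simp [P, EuclideanSpace.norm_sq_eq, Fin.sum_univ_three, hr]; norm_num
  have nQ : ‖Q‖ ^ 2 = 1 := by
    simp [Q, EuclideanSpace.norm_sq_eq, Fin.sum_univ_three, hr]; norm_num
  have nR : ‖R‖ ^ 2 = 1 := by
    simp [R, EuclideanSpace.norm_sq_eq, Fin.sum_univ_three, hr]; norm_num
  have nPQ : ‖P - Q‖ ^ 2 = 1 := by
    simp [P, Q, EuclideanSpace.norm_sq_eq, Fin.sum_univ_three, hr]; norm_num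
  have nPR : ‖P - R‖ ^ 2 = 1 := by
    simp [P, R, EuclideanSpace.norm_sq_eq, Fin.sum_univ_three, hr]; norm_num
  have nQR : ‖Q - R‖ ^ 2 = 1 := by
    simp [Q, R, EuclideanSpace.norm_sq_eq, Fin.sum_univ_three, hr]; norm_num
  have le_of_sq : ∀ {x : Space3}, |‖x‖ ^ 2 - 1| ≤ 1 / 1000 → ‖x‖ ≤ 7 / 4 := fun {x} h => by
    refine le_of_sq_le_sq ?_ (by norm_num)
    linarith [(abs_le.1 h).2]
  have of_eq : ∀ {t : ℝ}, t = 1 → |t - 1| ≤ 1 / 1000 := fun h => by rw [h]; norm_num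
  have step : ∀ {a b q : Space3}, |‖a‖ ^ 2 - 1| ≤ 1 / 1000 → |‖b‖ ^ 2 - 1| ≤ 1 / 1000 →
      |‖q‖ ^ 2 - 1| ≤ 1 / 1000 → |‖a - b‖ ^ 2 - 1| ≤ 1 / 1000 →
      |‖q - a‖ ^ 2 - 1| ≤ 1 / 1000 → |‖q - b‖ ^ 2 - 1| ≤ 1 / 1000 →
      ∃ y, G.HasTime 0 y 1 ∧ G.HasTime a y 1 ∧ G.HasTime b y 1 := by
    intro a b q ha hb hq hab hqa hqb
    obtain ⟨c, -, -, h⟩ := G.exists_hasTime_one (p := ![0, a, b]) (q := q)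
      (fun i => by
        fin_cases i
        · simp; norm_num
        · exact (le_of_sq ha).trans (by norm_num)
        · exact (le_of_sq hb).trans (by norm_num))
      (le_of_sq hq)
      (fun i j hij => by
        fin_cases i <;> fin_cases j <;> first | exact absurd rfl hij | skip
        all_goals simp only [Fin.zero_eta, Fin.mk_one, Fin.reduceFinMk, Matrix.cons_val,
          zero_sub, sub_zero, norm_neg]
        · exact ha
        · exact hb
        · exact ha
        · exact hab
        · exact hb
        · rw [norm_sub_rev]; exact hab)
      (fun i => by
        fin_cases i
        · simpa using hq
        · exact hqa
        · exact hqb)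
    exact ⟨_, h 0, h 1, h 2⟩
  have near : ∀ {a b : Space3}, G.HasTime a b 1 → |‖b - a‖ ^ 2 - 1| ≤ 1 / 1000 := fun h =>
    h.abs_sq_sub_one_le.trans (by norm_num)
  have near0 : ∀ {b : Space3}, G.HasTime 0 b 1 → |‖b‖ ^ 2 - 1| ≤ 1 / 1000 := fun h => by
    simpa using near h
  -- `P` is replaced by `x`, then `Q` by `y`, then `R` by `w`. The unit times `xQ`, `xR` and `yR` to
  -- provisional vertices are used only for nearness.
  obtain ⟨x, x0, xQ, xR⟩ := step (of_eq nQ) (of_eq nR) (of_eq nP) (of_eq nQR) (of_eq nPQ)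
    (of_eq nPR)
  obtain ⟨y, y0, yx, yR⟩ := step (near0 x0) (of_eq nR) (of_eq nQ) (near xR)
    (near xQ.symm) (of_eq nQR)
  obtain ⟨w, w0, wx, wy⟩ := step (near0 x0) (near0 y0) (of_eq nR) (near yx.symm)
    (near xR.symm) (near yR.symm)
  refine ⟨![0, x, y, w], rfl, fun i j hij => ?_⟩
  fin_cases i <;> fin_cases j <;> first | exact absurd rfl hij | skip
  exacts [x0, y0, w0, x0.symm, yx, wx, y0.symm, yx.symm, wy, w0.symm, wx.symm, wy.symm]

section Reflection

variable {E : Type*} [NormedAddCommGroup E] [InnerProductSpace ℝ E]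

/-- If `o` had barycentric coordinates `w`, the vectors `p i - o` would satisfy a linear relation
with coefficients `w`. Its inner product with `p j - o` is nearly `(w j + 1)/2`, so every `w j`
would be close to `-1`, whereas their sum is 1. -/
theorem notMem_affineSpan_of_near_regular {p : Fin 3 → E} {o : E}
    (ho : ∀ i, |‖p i - o‖ ^ 2 - 1| ≤ 1 / 10 ^ 5)
    (hp : ∀ i j, i ≠ j → |‖p i - p j‖ ^ 2 - 1| ≤ 1 / 10 ^ 5) :
    o ∉ affineSpan ℝ (range p) := by
  intro hmem
  obtain ⟨w, hw, hwo⟩ := eq_affineCombination_of_mem_affineSpan_of_fintype hmem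
  rw [Finset.affineCombination_eq_linear_combination _ _ _ hw] at hwo
  have hz : ∑ i, w i • (p i - o) = 0 := by
    simp only [smul_sub, Finset.sum_sub_distrib, ← Finset.sum_smul, hw, one_smul, ← hwo, sub_self]
  have hg : ∀ i j, |inner ℝ (p i - o) (p j - o) - if i = j then 1 else 1 / 2| ≤
      3 / 2 * (1 / 10 ^ 5) := fun i j => by
    split_ifs with hij
    · rw [hij, real_inner_self_eq_norm_sq]
      exact (ho j).trans (by norm_num)
    · exact abs_inner_sub_half_le (ho i) (ho j) (by
        rw [sub_sub_sub_cancel_right]; exact hp i j hij)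
  have hj : ∀ j, |w j / 2 + 1 / 2| ≤ 3 / 2 * (1 / 10 ^ 5) * (|w 0| + |w 1| + |w 2|) := fun j => by
    have h1 : ∑ i, w i * inner ℝ (p j - o) (p i - o) = 0 := by
      have := congrArg (fun x => inner ℝ (p j - o) x) hz
      simpa [inner_sum, real_inner_smul_right] using this
    have h2 : w j / 2 + 1 / 2 =
        -∑ i, w i * (inner ℝ (p j - o) (p i - o) - if j = i then 1 else 1 / 2) := by
      simp only [mul_sub, Finset.sum_sub_distrib, h1]
      rw [Fin.sum_univ_three] at hw
      rw [Fin.sum_univ_three]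
      fin_cases j <;> simp <;> linarith
    rw [h2, abs_neg]
    refine (Finset.abs_sum_le_sum_abs _ _).trans ?_
    have h3 : ∀ i, |w i * (inner ℝ (p j - o) (p i - o) - if j = i then 1 else 1 / 2)| ≤
        |w i| * (3 / 2 * (1 / 10 ^ 5)) := fun i => by
      rw [abs_mul]
      gcongr
      exact hg j i
    refine (Finset.sum_le_sum fun i _ => h3 i).trans (le_of_eq ?_)
    rw [Fin.sum_univ_three]
    ring
  rw [Fin.sum_univ_three] at hw
  set S := |w 0| + |w 1| + |w 2| with hS
  have hb : ∀ j, |w j| ≤ 1 + 3 * (1 / 10 ^ 5) * S := fun j => by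
    have := abs_le.1 (hj j)
    rw [abs_le]
    constructor <;> linarith
  have a0 := (abs_le.1 (hj 0)).2
  have a1 := (abs_le.1 (hj 1)).2
  have a2 := (abs_le.1 (hj 2)).2
  have b0 := hb 0
  have b1 := hb 1
  have b2 := hb 2
  norm_num at *
  linarith

theorem norm_sq_smul_sum_sub (c d : ℝ) (w : Fin 3 → E) (j : Fin 3) :
    ‖c • (w 0 + w 1 + w 2) - d • w j‖ ^ 2 = c ^ 2 * (‖w 0‖ ^ 2 + ‖w 1‖ ^ 2 + ‖w 2‖ ^ 2 +
      2 * (inner ℝ (w 0) (w 1) + inner ℝ (w 0) (w 2) + inner ℝ (w 1) (w 2))) -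
      2 * c * d * (inner ℝ (w 0) (w j) + inner ℝ (w 1) (w j) + inner ℝ (w 2) (w j)) +
      d ^ 2 * ‖w j‖ ^ 2 := by
  simp only [← real_inner_self_eq_norm_sq, inner_sub_left, inner_sub_right, inner_add_left,
    inner_add_right, real_inner_smul_left, real_inner_smul_right]
  rw [real_inner_comm (w 0) (w j), real_inner_comm (w 1) (w j), real_inner_comm (w 2) (w j),
    real_inner_comm (w 0) (w 1), real_inner_comm (w 0) (w 2), real_inner_comm (w 1) (w 2)]
  ring

/-- The point opposite to one vertex of a tetrahedron with unit travel times. -/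
theorem exists_opposite [CompleteSpace E] {δ : ℝ} (G : NearlyFlat E δ) {p : Fin 3 → E} {o : E}
    (hp : ∀ i j, i ≠ j → G.HasTime (p i) (p j) 1) (ho : ∀ i, G.HasTime o (p i) 1)
    (h0 : o = 0 ∨ ∃ i, p i = 0) :
    ∃ y, ‖y‖ ≤ 9 / 5 ∧ (∀ i, G.HasTime (p i) y 1) ∧ (affineSpan ℝ (range p)).SOppSide o y ∧
      2 ≤ ‖y - o‖ ^ 2 := by
  have no : ∀ i, |‖p i - o‖ ^ 2 - 1| ≤ 1 / 10 ^ 5 := fun i => (ho i).abs_sq_sub_one_le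
  have np : ∀ i j, i ≠ j → |‖p i - p j‖ ^ 2 - 1| ≤ 1 / 10 ^ 5 := fun i j hij =>
    (hp j i hij.symm).abs_sq_sub_one_le
  set w : Fin 3 → E := fun i => p i - o with hw
  have hg : ∀ i j, i ≠ j → |inner ℝ (w i) (w j) - 1 / 2| ≤ 3 / 2 * (1 / 10 ^ 5) := fun i j hij =>
    abs_inner_sub_half_le (no i) (no j) (by
      rw [hw]; simp only [sub_sub_sub_cancel_right]; exact np i j hij)
  have g01 := abs_le.1 (hg 0 1 (by decide))
  have g02 := abs_le.1 (hg 0 2 (by decide))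
  have g12 := abs_le.1 (hg 1 2 (by decide))
  have n0 := abs_le.1 (no 0)
  have n1 := abs_le.1 (no 1)
  have n2 := abs_le.1 (no 2)
  change -(1 / 10 ^ 5) ≤ ‖w 0‖ ^ 2 - 1 ∧ ‖w 0‖ ^ 2 - 1 ≤ 1 / 10 ^ 5 at n0
  change -(1 / 10 ^ 5) ≤ ‖w 1‖ ^ 2 - 1 ∧ ‖w 1‖ ^ 2 - 1 ≤ 1 / 10 ^ 5 at n1
  change -(1 / 10 ^ 5) ≤ ‖w 2‖ ^ 2 - 1 ∧ ‖w 2‖ ^ 2 - 1 ≤ 1 / 10 ^ 5 at n2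
  -- The mirror image of `o` in the face if the tetrahedron is regular: the centroid of the face is
  -- `o + (w 0 + w 1 + w 2)/3`. Its squared distance from `o` is then `8/3`, the square of twice the
  -- height `√(2/3)`.
  set q : E := (2 / 3 : ℝ) • (w 0 + w 1 + w 2) + o with hq
  have hqp : ∀ j, |‖q - p j‖ ^ 2 - 1| ≤ 1 / 1000 := fun j => by
    have e : q - p j = (2 / 3 : ℝ) • (w 0 + w 1 + w 2) - (1 : ℝ) • w j := by
      simp only [hq, hw]; module
    rw [e, norm_sq_smul_sum_sub, abs_le]
    fin_cases j
    all_goals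
      simp only [Fin.zero_eta, Fin.mk_one, Fin.reduceFinMk, real_inner_self_eq_norm_sq,
        real_inner_comm (w 0) (w 1), real_inner_comm (w 0) (w 2), real_inner_comm (w 1) (w 2)]
      norm_num at *
      constructor <;> linarith
  have hqo : |‖q - o‖ ^ 2 - 8 / 3| ≤ 1 / 1000 := by
    have e : q - o = (2 / 3 : ℝ) • (w 0 + w 1 + w 2) - (0 : ℝ) • w 0 := by
      simp only [hq]; module
    rw [e, norm_sq_smul_sum_sub, abs_le]
    norm_num at *
    constructor <;> linarith
  -- One of the four vertices is the origin, so these norms are controlled by distances already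
  -- estimated: `√(8/3) < 7/4` covers the worst case for `q`.
  have hp1 : ∀ i, ‖p i‖ ≤ 11 / 10 ∧ ‖q‖ ≤ 7 / 4 := fun i => by
    have sq : ∀ {x : E} {c : ℝ}, 0 ≤ c → ‖x‖ ^ 2 ≤ c ^ 2 → ‖x‖ ≤ c := fun hc h =>
      le_of_sq_le_sq h hc
    rcases h0 with h0 | ⟨j, hj⟩
    · have h1 := (abs_le.1 (no i)).2
      have h2 := (abs_le.1 hqo).2
      rw [h0, sub_zero] at h1 h2
      norm_num at h1 h2
      exact ⟨sq (by norm_num) (by norm_num; linarith), sq (by norm_num) (by norm_num; linarith)⟩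
    · have h2 := (abs_le.1 (hqp j)).2
      rw [hj, sub_zero] at h2
      refine ⟨?_, sq (by norm_num) (by norm_num at *; linarith)⟩
      by_cases hij : i = j
      · rw [hij, hj, norm_zero]; norm_num
      · have h1 := (abs_le.1 (np i j hij)).2
        rw [hj, sub_zero] at h1
        exact sq (by norm_num) (by norm_num at *; linarith)
  obtain ⟨c, hc, hx, h⟩ := G.exists_hasTime_one (p := p) (q := q)
    (fun i => (hp1 i).1.trans (by norm_num)) (hp1 0).2
    (fun i j hij => (np i j hij).trans (by norm_num)) hqp
  have hqo2 : 16 / 10 ≤ ‖q - o‖ := by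
    refine le_of_sq_le_sq ?_ (norm_nonneg _)
    have := (abs_le.1 hqo).1
    norm_num at *
    linarith
  refine ⟨q + ∑ j, c j • (q - p j), (norm_add_le _ _).trans (by linarith [(hp1 0).2]), h, ?_, ?_⟩
  · have hc0 := abs_le.1 (hc 0)
    have hc1 := abs_le.1 (hc 1)
    have hc2 := abs_le.1 (hc 2)
    have ho' := notMem_affineSpan_of_near_regular no np
    set C := c 0 + c 1 + c 2 with hC
    have hC2 : 2 + C ≠ 0 := by linarith
    have hmem : ∀ i, p i ∈ affineSpan ℝ (range p) := fun i =>
      subset_affineSpan _ _ (mem_range_self i)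
    -- The point where the line from `o` to the solution `y` meets the plane. In terms of the
    -- vectors `w j`, the coefficients of `y - o` are `2/3 (1 + C) - c j`, with sum `2 + C`.
    -- Dividing by this sum gives barycentric coordinates of a point `m`, and `y = m - (1 + C)(o -
    -- m)` with `1 + C > 0`.
    have hm : ((2 / 3 * (1 + C) - c 1) / (2 + C)) • (p 1 -ᵥ p 0) +ᵥ
        (((2 / 3 * (1 + C) - c 2) / (2 + C)) • (p 2 -ᵥ p 0) +ᵥ p 0) ∈ affineSpan ℝ (range p) :=
      AffineSubspace.smul_vsub_vadd_mem _ _ (hmem 1) (hmem 0)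
        (AffineSubspace.smul_vsub_vadd_mem _ _ (hmem 2) (hmem 0) (hmem 0))
    have := (AffineSubspace.sOppSide_lineMap_left hm ho' (t := -(1 + C)) (by linarith)).symm
    rw [AffineMap.lineMap_apply] at this
    refine Eq.subst (motive := fun y => (affineSpan ℝ (range p)).SOppSide o y) ?_ this
    rw [Fin.sum_univ_three]
    simp only [vsub_eq_sub, vadd_eq_add, hq, hw]
    match_scalars <;> field_simp <;> rw [hC] <;> ring
  · have h1 : ‖q - o‖ ≤ ‖q + ∑ j, c j • (q - p j) - o‖ + 1 / 20 := by
      have e : q - o = (q + ∑ j, c j • (q - p j) - o) - ∑ j, c j • (q - p j) := by abel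
      conv_lhs => rw [e]
      exact (norm_sub_le _ _).trans (by linarith)
    nlinarith

end Reflection

end NearlyFlat

/-! ### From a gently curved spacetime to nearly flat data -/

theorem exists_orthonormal_frame (B : Space3 →L[ℝ] Space3 →L[ℝ] ℝ) (hs : ∀ v w, B v w = B w v)
    (hp : ∀ v, v ≠ 0 → 0 < B v v) :
    ∃ A : Space3 ≃L[ℝ] Space3, ∀ u v, B (A u) (A v) = inner ℝ u v := by
  let β : LinearMap.BilinForm ℝ Space3 :=
    LinearMap.mk₂ ℝ (fun v w => B v w) (by simp) (by simp) (by simp) (by simp)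
  have hβ : ∀ v w, β v w = B v w := fun v w => rfl
  obtain ⟨b', hb'⟩ := LinearMap.BilinForm.exists_orthogonal_basis (B := β) ⟨fun v w => hs v w⟩
  let b := b'.reindex (finCongr (by simp : Module.finrank ℝ Space3 = 3))
  have hb : ∀ i j, i ≠ j → B (b i) (b j) = 0 := fun i j hij => by
    have := hb' (i := (finCongr (by simp : Module.finrank ℝ Space3 = 3)).symm i)
      (j := (finCongr (by simp : Module.finrank ℝ Space3 = 3)).symm j) (by simpa using hij)
    simpa [b, hβ] using this
  have hpos : ∀ i, 0 < B (b i) (b i) := fun i => hp _ (b.ne_zero i)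
  have hsq : ∀ i, 0 < Real.sqrt (B (b i) (b i)) := fun i => Real.sqrt_pos.2 (hpos i)
  let c := b.isUnitSMul (w := fun i => (Real.sqrt (B (b i) (b i)))⁻¹)
    fun i => (inv_ne_zero (hsq i).ne').isUnit
  have hc : ∀ i j, B (c i) (c j) = if i = j then 1 else 0 := fun i j => by
    simp only [c, Module.Basis.isUnitSMul_apply, map_smul, smul_apply, smul_eq_mul]
    split_ifs with hij
    · rw [← hij]
      have h1 := Real.mul_self_sqrt (hpos i).le
      have h2 := (hsq i).ne'
      field_simp
      linarith
    · rw [hb i j hij]; simp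
  let A := (WithLp.linearEquiv 2 ℝ (Fin 3 → ℝ)).trans c.equivFun.symm
  have hA : ∀ u, A u = ∑ i, u i • c i := fun u => by
    simp [A, Module.Basis.equivFun_symm_apply]
  refine ⟨A.toContinuousLinearEquiv, fun u v => ?_⟩
  simp only [LinearEquiv.coe_toContinuousLinearEquiv', hA, map_sum, sum_apply,
    map_smul, smul_apply, hc, smul_eq_mul, PiLp.inner_apply]
  simp [mul_comm]

section Bounds

variable {E : Type*} [NormedAddCommGroup E] [InnerProductSpace ℝ E]

theorem ContinuousLinearMap.abs_apply_le_of_unit (φ : E →L[ℝ] ℝ) {C : ℝ}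
    (h : ∀ a, ‖a‖ ≤ 1 → |φ a| ≤ C) (a : E) : |φ a| ≤ C * ‖a‖ := by
  rcases eq_or_ne a 0 with rfl | ha
  · simp
  · have h1 : 0 < ‖a‖ := norm_pos_iff.2 ha
    have h2 := h (‖a‖⁻¹ • a) (by rw [norm_smul, norm_inv, norm_norm, inv_mul_cancel₀ h1.ne'])
    rw [map_smul, smul_eq_mul, abs_mul, abs_inv, abs_norm, inv_mul_le_iff₀ h1] at h2
    linarith

/-- Gentle curvature bounds only the diagonal values `h(u, u)`. Polarization with the parallelogram
law recovers all values without loss of constant: `4|β(u, v)| ≤ C(‖u + v‖² + ‖u - v‖²) ≤ 4C` for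
`u`, `v` in the unit ball. -/
theorem ContinuousLinearMap.abs_apply_le_of_diag (β : E →L[ℝ] E →L[ℝ] ℝ)
    (hs : ∀ u v, β u v = β v u) {C : ℝ} (h : ∀ u, ‖u‖ ≤ 1 → |β u u| ≤ C) (u v : E) :
    |β u v| ≤ C * (‖u‖ * ‖v‖) := by
  have hq : ∀ u, |β u u| ≤ C * ‖u‖ ^ 2 := fun u => by
    rcases eq_or_ne u 0 with rfl | hu
    · simp
    · have h1 : 0 < ‖u‖ := norm_pos_iff.2 hu
      have h2 := h (‖u‖⁻¹ • u) (by rw [norm_smul, norm_inv, norm_norm, inv_mul_cancel₀ h1.ne'])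
      rw [map_smul, map_smul, smul_apply, smul_eq_mul, smul_eq_mul, abs_mul, abs_mul, abs_inv,
        abs_norm, inv_mul_le_iff₀ h1, inv_mul_le_iff₀ h1] at h2
      linarith
  have hu : ∀ u v, ‖u‖ ≤ 1 → ‖v‖ ≤ 1 → |β u v| ≤ C := fun u v hu hv => by
    have i1 := abs_le.1 (hq (u + v))
    have i2 := abs_le.1 (hq (u - v))
    have i3 := parallelogram_law_with_norm ℝ u v
    have e1 : β (u + v) (u + v) - β (u - v) (u - v) = 4 * β u v := by
      simp only [map_add, map_sub, add_apply, sub_apply, hs v u]; ring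
    have hC : 0 ≤ C := (abs_nonneg _).trans (h 0 (by simp))
    have i4 : C * (‖u + v‖ ^ 2 + ‖u - v‖ ^ 2) ≤ C * 4 := by
      gcongr
      nlinarith [norm_nonneg u, norm_nonneg v]
    rw [abs_le]
    constructor <;> linarith
  have h1 : ∀ u, ‖u‖ ≤ 1 → |β u v| ≤ C * ‖v‖ := fun u hu' =>
    (β u).abs_apply_le_of_unit (fun v hv => hu u v hu' hv) v
  have := (β.flip v).abs_apply_le_of_unit (C := C * ‖v‖) (fun u hu => h1 u hu) u
  rw [ContinuousLinearMap.flip_apply] at this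
  linarith

theorem ContinuousLinearMap.abs_sub_inner_le_of_diag (β : E →L[ℝ] E →L[ℝ] ℝ)
    (hs : ∀ u v, β u v = β v u) {C : ℝ} (h : ∀ u, ‖u‖ ≤ 1 → |β u u - inner ℝ u u| ≤ C) (u v : E) :
    |β u v - inner ℝ u v| ≤ C * (‖u‖ * ‖v‖) := by
  let I : E →L[ℝ] E →L[ℝ] ℝ := (isBoundedBilinearMap_inner (𝕜 := ℝ) (E := E)).toContinuousLinearMap
  have hI : ∀ u v, I u v = inner ℝ u v := fun u v => rfl
  have := (β - I).abs_apply_le_of_diag (C := C) (fun u v => by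
    rw [sub_apply, sub_apply, sub_apply, sub_apply, hI, hI, hs, real_inner_comm])
    (fun u hu => by simpa [hI] using h u hu) u v
  simpa [hI] using this

theorem ContinuousLinearMap.abs_apply₃_le_of_diag (D : E →L[ℝ] E →L[ℝ] E →L[ℝ] ℝ)
    (hs : ∀ a u v, D a u v = D a v u) {C : ℝ}
    (h : ∀ a u, ‖u‖ ≤ 1 → |D a u u| ≤ C * ‖a‖) (a u v : E) :
    |D a u v| ≤ C * (‖a‖ * ‖u‖ * ‖v‖) := by
  have := (D a).abs_apply_le_of_diag (hs a) (h a) u v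
  linarith

theorem ContinuousLinearMap.abs_apply₃_sub_le_of_diag (D D' : E →L[ℝ] E →L[ℝ] E →L[ℝ] ℝ)
    (hs : ∀ a u v, D a u v = D a v u) (hs' : ∀ a u v, D' a u v = D' a v u) {C : ℝ}
    (h : ∀ a u, ‖u‖ ≤ 1 → |D a u u - D' a u u| ≤ C * ‖a‖) (a u v : E) :
    |D a u v - D' a u v| ≤ C * (‖a‖ * ‖u‖ * ‖v‖) := by
  have := (D a - D' a).abs_apply_le_of_diag (C := C * ‖a‖) (fun u v => by
    rw [sub_apply, sub_apply, sub_apply, sub_apply, hs, hs']) (fun u hu => by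
      simpa using h a u hu) u v
  simp only [sub_apply] at this
  linarith

end Bounds

/-- The affine coordinates in which the center is `0`, the unit of length is `L`, and the unit
vectors are given by the frame `A`. -/
def frameChart (x₀ : Space3) (L : ℝ) (A : Space3 ≃L[ℝ] Space3) (z : Space3) : Space3 :=
  x₀ + L • A z

section FrameChart

variable {x₀ : Space3} {L : ℝ} {A : Space3 ≃L[ℝ] Space3}

theorem hasFDerivAt_frameChart (z : Space3) :
    HasFDerivAt (frameChart x₀ L A) (L • (A : Space3 →L[ℝ] Space3)) z :=
  ((A : Space3 →L[ℝ] Space3).hasFDerivAt.const_smul L).const_add x₀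

theorem frameChart_injective (hL : 0 < L) : Function.Injective (frameChart x₀ L A) :=
  fun _ _ h => A.injective (smul_right_injective _ hL.ne' (add_left_cancel h))

theorem frameChart_surjective (hL : 0 < L) : Function.Surjective (frameChart x₀ L A) :=
  fun x => ⟨A.symm (L⁻¹ • (x - x₀)), by
    rw [frameChart, A.apply_symm_apply, smul_inv_smul₀ hL.ne', add_sub_cancel]⟩

/-- Bounds of a scalar field in the frame coordinates from bounds of its derivatives. -/
theorem frameChart_bounds {dom : Set Space3} (hdom : IsOpen dom) {f : Space3 → ℝ}
    (hf : ContDiffOn ℝ ∞ f dom) (hL : 0 < L) {C : ℝ}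
    (hm : ∀ z, ‖z‖ < 2 → frameChart x₀ L A z ∈ dom)
    (h1 : ∀ z, ‖z‖ < 2 → ∀ a, ‖a‖ ≤ 1 → L * |fderiv ℝ f (frameChart x₀ L A z) (A a)| ≤ C)
    (h2 : ∀ z, ‖z‖ < 2 → ∀ a b, ‖a‖ ≤ 1 → ‖b‖ ≤ 1 →
      L ^ 2 * |fderiv ℝ (fun y => fderiv ℝ f y (A a)) (frameChart x₀ L A z) (A b)| ≤ C) :
    (∀ z, ‖z‖ < 2 → ∀ a, |L * fderiv ℝ f (frameChart x₀ L A z) (A a)| ≤ C * ‖a‖) ∧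
    (∀ z z', ‖z‖ < 2 → ‖z'‖ < 2 → ∀ a, |L * fderiv ℝ f (frameChart x₀ L A z) (A a) -
      L * fderiv ℝ f (frameChart x₀ L A z') (A a)| ≤ C * ‖z - z'‖ * ‖a‖) ∧
    (∀ z, ‖z‖ < 2 → |f (frameChart x₀ L A z) - f x₀| ≤ 2 * C) := by
  have hC : 0 ≤ C := by simpa using h1 0 (by simp) 0 (by simp)
  have b1 : ∀ z, ‖z‖ < 2 → ∀ a, |L * fderiv ℝ f (frameChart x₀ L A z) (A a)| ≤ C * ‖a‖ :=
    fun z hz a => by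
      have := (L • ((fderiv ℝ f (frameChart x₀ L A z)).comp
        (A : Space3 →L[ℝ] Space3))).abs_apply_le_of_unit (C := C) (fun a ha => by
          simpa [abs_mul, abs_of_pos hL] using h1 z hz a ha) a
      simpa using this
  refine ⟨b1, fun z z' hz hz' a => ?_, fun z hz => ?_⟩
  · have key : ∀ a, ‖a‖ ≤ 1 → |L * fderiv ℝ f (frameChart x₀ L A z) (A a) -
        L * fderiv ℝ f (frameChart x₀ L A z') (A a)| ≤ C * ‖z - z'‖ := fun a ha => by
      have hd : ∀ y, ‖y‖ < 2 → HasFDerivAt (fun y => L * fderiv ℝ f (frameChart x₀ L A y) (A a))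
          (L • ((fderiv ℝ (fun y => fderiv ℝ f y (A a)) (frameChart x₀ L A y)).comp
            (L • (A : Space3 →L[ℝ] Space3)))) y := fun y hy => by
        have hc : ContDiffAt ℝ ∞ f (frameChart x₀ L A y) :=
          hf.contDiffAt (hdom.mem_nhds (hm y hy))
        have hc' : ContDiffAt ℝ 1 (fderiv ℝ f) (frameChart x₀ L A y) :=
          hc.fderiv_right (by norm_cast)
        have hc2 := (hc'.differentiableAt one_ne_zero).clm_apply
          (differentiableAt_const (A a))
        exact (hc2.hasFDerivAt.comp y (hasFDerivAt_frameChart y)).const_mul L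
      have := (convex_ball (0 : Space3) 2).norm_image_sub_le_of_norm_hasFDerivWithin_le
        (C := C) (x := z') (y := z)
        (fun y hy => (hd y (by simpa using hy)).hasFDerivWithinAt) (fun y hy => by
          refine ContinuousLinearMap.opNorm_le_bound _ hC fun b => ?_
          refine ContinuousLinearMap.abs_apply_le_of_unit _ (fun b hb => ?_) b
          have := h2 y (by simpa using hy) a b ha hb
          simp only [smul_apply, ContinuousLinearMap.comp_apply, map_smul, smul_eq_mul,
            ContinuousLinearEquiv.coe_coe, abs_mul, abs_of_pos hL]
          linarith) (by simpa using hz') (by simpa using hz)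
      simpa using this
    have := (L • ((fderiv ℝ f (frameChart x₀ L A z)).comp (A : Space3 →L[ℝ] Space3)) -
      L • ((fderiv ℝ f (frameChart x₀ L A z')).comp
        (A : Space3 →L[ℝ] Space3))).abs_apply_le_of_unit (C := C * ‖z - z'‖) (fun a ha => by
          simpa using key a ha) a
    simpa using this
  · have hd : ∀ y, ‖y‖ < 2 → HasFDerivAt (fun y => f (frameChart x₀ L A y))
        ((fderiv ℝ f (frameChart x₀ L A y)).comp (L • (A : Space3 →L[ℝ] Space3))) y :=
      fun y hy => by
        have hc : ContDiffAt ℝ ∞ f (frameChart x₀ L A y) :=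
          hf.contDiffAt (hdom.mem_nhds (hm y hy))
        exact (hc.differentiableAt (by simp)).hasFDerivAt.comp y (hasFDerivAt_frameChart y)
    have := (convex_ball (0 : Space3) 2).norm_image_sub_le_of_norm_hasFDerivWithin_le
      (C := C) (x := 0) (y := z)
      (fun y hy => (hd y (by simpa using hy)).hasFDerivWithinAt) (fun y hy => by
        refine ContinuousLinearMap.opNorm_le_bound _ hC fun b => ?_
        simpa using b1 y (by simpa using hy) b) (by simp) (by simpa using hz)
    rw [sub_zero, Real.norm_eq_abs] at this
    have e : frameChart x₀ L A 0 = x₀ := by simp [frameChart]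
    rw [e] at this
    refine this.trans ?_
    nlinarith

end FrameChart

/-- The composition of a bilinear form with a linear map in both arguments. -/
noncomputable def pullbackForm (A : Space3 →L[ℝ] Space3) :
    (Space3 →L[ℝ] Space3 →L[ℝ] ℝ) →L[ℝ] Space3 →L[ℝ] Space3 →L[ℝ] ℝ :=
  ((ContinuousLinearMap.compL ℝ Space3 Space3 (Space3 →L[ℝ] ℝ)).flip A).comp
    (ContinuousLinearMap.compL ℝ Space3 (Space3 →L[ℝ] ℝ) (Space3 →L[ℝ] ℝ)
      ((ContinuousLinearMap.compL ℝ Space3 Space3 ℝ).flip A))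

theorem pullbackForm_apply (A : Space3 →L[ℝ] Space3) (B : Space3 →L[ℝ] Space3 →L[ℝ] ℝ)
    (u v : Space3) : pullbackForm A B u v = B (A u) (A v) := by
  simp [pullbackForm]

namespace StaticSpacetime

variable {S : StaticSpacetime} {x₀ : Space3} {L : ℝ} {A : Space3 ≃L[ℝ] Space3}

theorem frameChart_mem_spaceBall (hL : 0 < L) (hA : ∀ u v, S.h x₀ (A u) (A v) = inner ℝ u v)
    (z : Space3) : frameChart x₀ L A z ∈ S.spaceBall x₀ (2 * L) ↔ ‖z‖ < 2 := by
  have e : frameChart x₀ L A z - x₀ = L • A z := by simp [frameChart]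
  rw [spaceBall, mem_ofPred_eq, e]
  simp only [map_smul, smul_apply, hA, smul_eq_mul, real_inner_self_eq_norm_sq]
  rw [show L * (L * ‖z‖ ^ 2) = (L * ‖z‖) ^ 2 by ring,
    pow_lt_pow_iff_left₀ (by positivity) (by positivity) two_ne_zero, mul_comm 2 L,
    mul_lt_mul_iff_right₀ hL]

theorem frame_norm_le_one (hA : ∀ u v, S.h x₀ (A u) (A v) = inner ℝ u v) {a : Space3}
    (ha : ‖a‖ ≤ 1) : S.h x₀ (A a) (A a) ≤ 1 := by
  rw [hA, real_inner_self_eq_norm_sq]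
  nlinarith [norm_nonneg a]

theorem hasFDerivAt_h {x : Space3} (hx : x ∈ S.dom) : HasFDerivAt S.h (fderiv ℝ S.h x) x :=
  ((S.h_smooth.contDiffAt (S.isOpen_dom.mem_nhds hx)).differentiableAt (by simp)).hasFDerivAt

theorem hasFDerivAt_lapse {x : Space3} (hx : x ∈ S.dom) :
    HasFDerivAt S.lapse (fderiv ℝ S.lapse x) x :=
  ((S.lapse_smooth.contDiffAt (S.isOpen_dom.mem_nhds hx)).differentiableAt (by simp)).hasFDerivAt

theorem hasFDerivAt_h_apply {x : Space3} (hx : x ∈ S.dom) (u v : Space3) :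
    HasFDerivAt (fun y => S.h y u v) (((fderiv ℝ S.h x).flip u).flip v) x := by
  have := ((hasFDerivAt_h hx).clm_apply (hasFDerivAt_const u x)).clm_apply (hasFDerivAt_const v x)
  refine this.congr_fderiv ?_
  ext a
  simp

theorem hasFDerivAt_pullbackForm_h {z : Space3} (hz : frameChart x₀ L A z ∈ S.dom) :
    HasFDerivAt (fun z => pullbackForm (A : Space3 →L[ℝ] Space3) (S.h (frameChart x₀ L A z)))
      ((pullbackForm (A : Space3 →L[ℝ] Space3)).comp
        ((fderiv ℝ S.h (frameChart x₀ L A z)).comp (L • (A : Space3 →L[ℝ] Space3)))) z := by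
  have h0 := hasFDerivAt_h hz
  have h1 := HasFDerivAt.comp (g := S.h) (g' := fderiv ℝ S.h (frameChart x₀ L A z)) z h0
    (hasFDerivAt_frameChart z)
  have h3 : HasFDerivAt (pullbackForm (A : Space3 →L[ℝ] Space3))
      (pullbackForm (A : Space3 →L[ℝ] Space3)) (S.h (frameChart x₀ L A z)) :=
    ContinuousLinearMap.hasFDerivAt _
  have h2 := HasFDerivAt.comp (g := pullbackForm (A : Space3 →L[ℝ] Space3))
    (g' := pullbackForm (A : Space3 →L[ℝ] Space3)) z h3 h1
  exact h2

/-- Symmetry of `h` is assumed only on `dom`, so its derivative inherits it by openness of `dom`. -/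
theorem fderiv_h_symm {x : Space3} (hx : x ∈ S.dom) (a u v : Space3) :
    fderiv ℝ S.h x a u v = fderiv ℝ S.h x a v u := by
  have h1 := hasFDerivAt_h_apply hx u v
  have h2 := (hasFDerivAt_h_apply hx v u).congr_of_eventuallyEq
    (Filter.eventually_of_mem (S.isOpen_dom.mem_nhds hx) fun y hy => S.h_symm y hy u v)
  simpa using DFunLike.congr_fun (h1.unique h2) a

end StaticSpacetime

namespace StaticSpacetime

variable {S : StaticSpacetime} {x₀ : Space3} {L ε : ℝ} {A : Space3 ≃L[ℝ] Space3}

/-- A gently curved static spacetime in frame coordinates. -/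
noncomputable def GentlyCurved.nearlyFlat (hS : S.GentlyCurved x₀ L ε) (hL : 0 < L) (hε : 0 ≤ ε)
    (hε' : 2 * ε ≤ 1 / 10 ^ 9) (hA : ∀ u v, S.h x₀ (A u) (A v) = inner ℝ u v) :
    NearlyFlat Space3 (2 * ε) :=
  have hV : 0 < S.lapse x₀ := S.lapse_pos x₀ hS.center_mem
  have hball : ∀ z, ‖z‖ < 2 → frameChart x₀ L A z ∈ S.spaceBall x₀ (2 * L) := fun z hz =>
    (frameChart_mem_spaceBall hL hA z).2 hz
  have hdom : ∀ z, ‖z‖ < 2 → frameChart x₀ L A z ∈ S.dom := fun z hz =>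
    hS.ball_subset (hball z hz)
  have bV := frameChart_bounds S.isOpen_dom S.lapse_smooth hL (C := ε * S.lapse x₀) hdom
    (fun z hz a ha => hS.lapse_fst _ (hball z hz) _ (frame_norm_le_one hA ha))
    (fun z hz a b ha hb => hS.lapse_snd _ (hball z hz) _ _ (frame_norm_le_one hA ha)
      (frame_norm_le_one hA hb))
  have hsm : ∀ u, ContDiffOn ℝ ∞ (fun y => S.h y u u) S.dom := fun u =>
    (S.h_smooth.clm_apply contDiffOn_const).clm_apply contDiffOn_const
  have bh := fun (u : Space3) (hu : ‖u‖ ≤ 1) => frameChart_bounds (L := L) (A := A) (C := ε)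
    (f := fun y => S.h y (A u) (A u)) S.isOpen_dom (hsm (A u)) hL hdom
    (fun z hz a ha => hS.h_fst _ (hball z hz) _ _ (frame_norm_le_one hA ha)
      (frame_norm_le_one hA hu))
    (fun z hz a b ha hb => hS.h_snd _ (hball z hz) _ _ _ (frame_norm_le_one hA ha)
      (frame_norm_le_one hA hb) (frame_norm_le_one hA hu))
  have edh : ∀ z, ‖z‖ < 2 → ∀ a u, fderiv ℝ (fun y => S.h y u u) (frameChart x₀ L A z) a =
      fderiv ℝ S.h (frameChart x₀ L A z) a u u := fun z hz a u => by
    rw [(hasFDerivAt_h_apply (hdom z hz) u u).fderiv]; simp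
  have dk_apply : ∀ z a u v, ((pullbackForm (A : Space3 →L[ℝ] Space3)).comp
      ((fderiv ℝ S.h (frameChart x₀ L A z)).comp (L • (A : Space3 →L[ℝ] Space3)))) a u v =
      L * fderiv ℝ S.h (frameChart x₀ L A z) (A a) (A u) (A v) := fun z a u v => by
    simp [pullbackForm_apply]
  { k := fun z => pullbackForm A (S.h (frameChart x₀ L A z))
    dk := fun z => (pullbackForm (A : Space3 →L[ℝ] Space3)).comp
      ((fderiv ℝ S.h (frameChart x₀ L A z)).comp (L • (A : Space3 →L[ℝ] Space3)))
    W := fun z => S.lapse (frameChart x₀ L A z) / S.lapse x₀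
    dW := fun z => (S.lapse x₀)⁻¹ •
      (fderiv ℝ S.lapse (frameChart x₀ L A z)).comp (L • (A : Space3 →L[ℝ] Space3))
    nonneg := by positivity
    small := hε'
    deriv_k := fun z hz => hasFDerivAt_pullbackForm_h (hdom z hz)
    deriv_W := fun z hz => by
      have h1 := (hasFDerivAt_lapse (hdom z hz)).comp z (hasFDerivAt_frameChart z)
      simp only [div_eq_inv_mul]
      exact h1.const_mul _
    symm := fun z hz u v => by
      rw [pullbackForm_apply, pullbackForm_apply]
      exact S.h_symm _ (hdom z hz) _ _
    k_near := fun z hz => ContinuousLinearMap.abs_sub_inner_le_of_diag _ (fun u v => by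
        rw [pullbackForm_apply, pullbackForm_apply]
        exact S.h_symm _ (hdom z hz) _ _) fun u hu => by
      rw [pullbackForm_apply, ← hA]
      exact (bh u hu).2.2 z hz
    dk_le := fun z hz a u v => by
      have := ContinuousLinearMap.abs_apply₃_le_of_diag _ (fun a u v => by
        rw [dk_apply, dk_apply, fderiv_h_symm (hdom z hz)]) (fun a u hu => by
        have := (bh u hu).1 z hz a
        rw [edh z hz] at this
        rwa [dk_apply]) a u v
      have h2 : 0 ≤ ε * (‖a‖ * ‖u‖ * ‖v‖) := by positivity
      linarith
    dk_lip := fun z z' hz hz' a u v => by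
      have := ContinuousLinearMap.abs_apply₃_sub_le_of_diag _ _ (fun a u v => by
        rw [dk_apply z, dk_apply z, fderiv_h_symm (hdom z hz)]) (fun a u v => by
        rw [dk_apply z', dk_apply z', fderiv_h_symm (hdom z' hz')]) (fun a u hu => by
        have := (bh u hu).2.1 z z' hz hz' a
        rw [edh z hz, edh z' hz'] at this
        rwa [dk_apply, dk_apply]) a u v
      have h2 : 0 ≤ ε * ‖z - z'‖ * (‖a‖ * ‖u‖ * ‖v‖) := by positivity
      linarith
    -- Integrating the derivative over the radius 2 costs a factor 2; this and the same bound in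
    -- `k_near` are the reason for `2 * ε`.
    W_near := fun z hz => by
      have := bV.2.2 z hz
      rw [div_sub_one hV.ne', abs_div, abs_of_pos hV, div_le_iff₀ hV]
      linarith
    dW_le := fun z hz a => by
      have := bV.1 z hz a
      have h2 : 0 ≤ ε * ‖a‖ := by positivity
      simp only [smul_apply, ContinuousLinearMap.comp_apply, map_smul, smul_eq_mul,
        ContinuousLinearEquiv.coe_coe]
      rw [abs_mul, abs_inv, abs_of_pos hV, inv_mul_le_iff₀ hV]
      nlinarith
    dW_lip := fun z z' hz hz' a => by
      have := bV.2.1 z z' hz hz' a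
      have h2 : 0 ≤ ε * ‖z - z'‖ * ‖a‖ := by positivity
      simp only [smul_apply, ContinuousLinearMap.comp_apply, map_smul, smul_eq_mul,
        ContinuousLinearEquiv.coe_coe]
      rw [← mul_sub, abs_mul, abs_inv, abs_of_pos hV, inv_mul_le_iff₀ hV]
      nlinarith }

/-! ### Signals as null paths and null paths as signals -/

theorem hasFDerivAt_metric_apply {e : Event} (he : e.2 ∈ S.dom) (v w : Event) :
    HasFDerivAt (fun e => S.metric e v w)
      ((-(2 * S.lapse e.2 * (v.1 * w.1))) • (fderiv ℝ S.lapse e.2).comp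
          (ContinuousLinearMap.snd ℝ ℝ Space3) +
        (((fderiv ℝ S.h e.2).flip v.2).flip w.2).comp (ContinuousLinearMap.snd ℝ ℝ Space3)) e := by
  have h1 := (hasFDerivAt_lapse he).comp e (hasFDerivAt_snd (𝕜 := ℝ) (p := e))
  have h2 := (hasFDerivAt_h_apply he v.2 w.2).comp e (hasFDerivAt_snd (𝕜 := ℝ) (p := e))
  have h3 := ((h1.pow 2).neg.mul_const (v.1 * w.1)).add h2
  refine (h3.congr_fderiv ?_).congr_of_eventuallyEq
    (Filter.Eventually.of_forall fun e => S.metric_apply e v w)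
  ext ξ
  · simp
  · simp
    ring

/-- The geodesic equation, split into its time and space components. -/
theorem geodesic_expression {e : Event} (he : e.2 ∈ S.dom) (u b w : Event) :
    S.metric e b w + fderiv ℝ (fun e => S.metric e u w) e u -
        1 / 2 * fderiv ℝ (fun e => S.metric e u u) e w =
      -(S.lapse e.2 ^ 2 * b.1 + 2 * S.lapse e.2 * fderiv ℝ S.lapse e.2 u.2 * u.1) * w.1 +
      (S.h e.2 b.2 w.2 + fderiv ℝ S.h e.2 u.2 u.2 w.2 - 1 / 2 * fderiv ℝ S.h e.2 w.2 u.2 u.2 +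
        S.lapse e.2 * fderiv ℝ S.lapse e.2 w.2 * u.1 ^ 2) := by
  rw [(hasFDerivAt_metric_apply he u w).fderiv, (hasFDerivAt_metric_apply he u u).fderiv,
    S.metric_apply]
  simp only [add_apply, smul_apply, ContinuousLinearMap.comp_apply, ContinuousLinearMap.coe_snd',
    ContinuousLinearMap.flip_apply, smul_eq_mul]
  ring

end StaticSpacetime

namespace IsMotion

variable {E : Type*} [NormedAddCommGroup E] [NormedSpace ℝ E] {x v a : ℝ → E}

theorem uniqueDiffOn_Icc_zero_one : UniqueDiffOn ℝ (Icc (0 : ℝ) 1) := uniqueDiffOn_Icc zero_lt_one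

theorem derivWithin_eq (h : IsMotion x v a) {s : ℝ} (hs : s ∈ Icc (0 : ℝ) 1) :
    derivWithin x (Icc 0 1) s = v s :=
  (h.pos s hs).derivWithin (uniqueDiffOn_Icc_zero_one s hs)

theorem derivWithin_derivWithin_eq (h : IsMotion x v a) {s : ℝ} (hs : s ∈ Icc (0 : ℝ) 1) :
    derivWithin (derivWithin x (Icc 0 1)) (Icc 0 1) s = a s := by
  rw [derivWithin_congr (fun r hr => h.derivWithin_eq hr) (h.derivWithin_eq hs)]
  exact (h.vel s hs).derivWithin (uniqueDiffOn_Icc_zero_one s hs)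

theorem contDiffOn (h : IsMotion x v a) : ContDiffOn ℝ 2 x (Icc 0 1) := by
  have h1 : ContDiffOn ℝ 1 v (Icc 0 1) := by
    rw [show (1 : WithTop ℕ∞) = 0 + 1 from rfl,
      contDiffOn_succ_iff_derivWithin uniqueDiffOn_Icc_zero_one]
    refine ⟨fun s hs => (h.vel s hs).differentiableWithinAt, by simp, ?_⟩
    rw [contDiffOn_zero]
    exact h.acc.congr fun s hs =>
      (h.vel s hs).derivWithin (uniqueDiffOn_Icc_zero_one s hs)
  rw [show (2 : WithTop ℕ∞) = 1 + 1 from rfl,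
    contDiffOn_succ_iff_derivWithin uniqueDiffOn_Icc_zero_one]
  exact ⟨fun s hs => (h.pos s hs).differentiableWithinAt, by simp,
    h1.congr fun s hs => h.derivWithin_eq hs⟩

theorem of_contDiffOn (h : ContDiffOn ℝ 2 x (Icc 0 1)) :
    IsMotion x (derivWithin x (Icc 0 1)) (derivWithin (derivWithin x (Icc 0 1)) (Icc 0 1)) := by
  have h1 : ContDiffOn ℝ 1 (derivWithin x (Icc 0 1)) (Icc 0 1) :=
    h.derivWithin uniqueDiffOn_Icc_zero_one (by norm_num [one_add_one_eq_two])
  exact ⟨fun s hs => (h.differentiableOn two_ne_zero s hs).hasDerivWithinAt,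
    fun s hs => (h1.differentiableOn one_ne_zero s hs).hasDerivWithinAt,
    h1.continuousOn_derivWithin uniqueDiffOn_Icc_zero_one le_rfl⟩

end IsMotion

namespace StaticSpacetime

variable {S : StaticSpacetime} {x₀ : Space3} {L ε : ℝ} {A : Space3 ≃L[ℝ] Space3}

section Apply

variable (hS : S.GentlyCurved x₀ L ε) (hL : 0 < L) (hε : 0 ≤ ε)
    (hε' : 2 * ε ≤ 1 / 10 ^ 9) (hA : ∀ u v, S.h x₀ (A u) (A v) = inner ℝ u v)

theorem GentlyCurved.nearlyFlat_k (z u v : Space3) : (hS.nearlyFlat hL hε hε' hA).k z u v =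
    S.h (frameChart x₀ L A z) (A u) (A v) := pullbackForm_apply _ _ _ _

theorem GentlyCurved.nearlyFlat_dk (z a u v : Space3) :
    (hS.nearlyFlat hL hε hε' hA).dk z a u v =
      L * fderiv ℝ S.h (frameChart x₀ L A z) (A a) (A u) (A v) := by
  simp [nearlyFlat, pullbackForm_apply]

theorem GentlyCurved.nearlyFlat_W (z : Space3) : (hS.nearlyFlat hL hε hε' hA).W z =
    S.lapse (frameChart x₀ L A z) / S.lapse x₀ := rfl

theorem GentlyCurved.nearlyFlat_dW (z a : Space3) : (hS.nearlyFlat hL hε hε' hA).dW z a =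
    L * fderiv ℝ S.lapse (frameChart x₀ L A z) (A a) / S.lapse x₀ := by
  simp [nearlyFlat]
  ring

end Apply

/-- The time component of the geodesic equation is conservation of energy, and the null condition
expresses the time velocity in the space component by the space velocity. The second conclusion
recovers the signal from its projection, which transfers uniqueness from null paths to signals. -/
theorem signal_isNullPath (hS : S.GentlyCurved x₀ L ε) (hL : 0 < L) (hε : 0 ≤ ε)
    (hε' : 2 * ε ≤ 1 / 10 ^ 9) (hA : ∀ u v, S.h x₀ (A u) (A v) = inner ℝ u v)
    {α β : Event} {γ : ℝ → Event} (hγ : IsSignal S (S.tube x₀ (2 * L)) α β γ) {p q : Space3}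
    (hp : frameChart x₀ L A p = α.2) (hq : frameChart x₀ L A q = β.2) :
    ∃ z v a θ e, (hS.nearlyFlat hL hε hε' hA).IsNullPath p q
        ((β.1 - α.1) * (S.lapse x₀ / L)) z v a θ e ∧
      ∀ s ∈ Icc (0 : ℝ) 1,
        γ s = (α.1 + L / S.lapse x₀ * (e * θ s), frameChart x₀ L A (z s)) := by
  have hV : 0 < S.lapse x₀ := S.lapse_pos x₀ hS.center_mem
  have m0 : (0 : ℝ) ∈ Icc (0 : ℝ) 1 := by simp
  have hm := IsMotion.of_contDiffOn hγ.geodesic.smooth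
  set u := derivWithin γ (Icc 0 1)
  set b := derivWithin u (Icc 0 1)
  let Λ : Event →L[ℝ] Space3 :=
    (L⁻¹ • (A.symm : Space3 →L[ℝ] Space3)).comp (ContinuousLinearMap.snd ℝ ℝ Space3)
  have hΛ : ∀ e, L • A (Λ e) = e.2 := fun e => by simp [Λ, smul_inv_smul₀ hL.ne']
  have hdom : ∀ s ∈ Icc (0 : ℝ) 1, (γ s).2 ∈ S.dom := fun s hs =>
    hS.ball_subset (hγ.geodesic.mem s hs)
  have hX : ∀ s, frameChart x₀ L A (Λ (γ s - (0, x₀))) = (γ s).2 := fun s => by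
    rw [frameChart, hΛ]; simp
  have hVs : ∀ s ∈ Icc (0 : ℝ) 1, 0 < S.lapse (γ s).2 := fun s hs => S.lapse_pos _ (hdom s hs)
  have heq : ∀ s ∈ Icc (0 : ℝ) 1, ∀ w : Event,
      -(S.lapse (γ s).2 ^ 2 * (b s).1 +
        2 * S.lapse (γ s).2 * fderiv ℝ S.lapse (γ s).2 (u s).2 * (u s).1) * w.1 +
      (S.h (γ s).2 (b s).2 w.2 + fderiv ℝ S.h (γ s).2 (u s).2 (u s).2 w.2 -
        1 / 2 * fderiv ℝ S.h (γ s).2 w.2 (u s).2 (u s).2 +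
        S.lapse (γ s).2 * fderiv ℝ S.lapse (γ s).2 w.2 * (u s).1 ^ 2) = 0 := fun s hs w => by
    rw [← geodesic_expression (hdom s hs)]
    exact hγ.geodesic.equation s hs w
  have hnull : ∀ s ∈ Icc (0 : ℝ) 1,
      S.h (γ s).2 (u s).2 (u s).2 = S.lapse (γ s).2 ^ 2 * (u s).1 ^ 2 := fun s hs => by
    have := hγ.null s hs
    rw [S.metric_apply] at this
    linear_combination this
  have hfst : ∀ s ∈ Icc (0 : ℝ) 1, HasDerivWithinAt (fun s => (γ s).1) (u s).1 (Icc 0 1) s :=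
    fun s hs => (ContinuousLinearMap.fst ℝ ℝ Space3).hasFDerivAt.comp_hasDerivWithinAt s
      (hm.pos s hs)
  have hfst' : ∀ s ∈ Icc (0 : ℝ) 1, HasDerivWithinAt (fun s => (u s).1) (b s).1 (Icc 0 1) s :=
    fun s hs => (ContinuousLinearMap.fst ℝ ℝ Space3).hasFDerivAt.comp_hasDerivWithinAt s
      (hm.vel s hs)
  have hsnd : ∀ s ∈ Icc (0 : ℝ) 1, HasDerivWithinAt (fun s => (γ s).2) (u s).2 (Icc 0 1) s :=
    fun s hs => (ContinuousLinearMap.snd ℝ ℝ Space3).hasFDerivAt.comp_hasDerivWithinAt s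
      (hm.pos s hs)
  -- The conserved energy: its derivative is minus the left-hand side of the geodesic equation
  -- tested with the time vector `(1, 0)`.
  set c := S.lapse (γ 0).2 ^ 2 * (u 0).1 with hcdef
  have hc : ∀ s ∈ Icc (0 : ℝ) 1, S.lapse (γ s).2 ^ 2 * (u s).1 = c := fun s hs => by
    have hd : ∀ r ∈ Icc (0 : ℝ) 1,
        HasDerivWithinAt (fun r => S.lapse (γ r).2 ^ 2 * (u r).1) 0 (Icc 0 1) r := fun r hr => by
      have h1 := (hasFDerivAt_lapse (hdom r hr)).comp_hasDerivWithinAt r (hsnd r hr)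
      refine ((h1.fun_pow 2).fun_mul (hfst' r hr)).congr_deriv ?_
      have := heq r hr (1, 0)
      simp only [map_zero, zero_apply, mul_zero, mul_one, add_zero, sub_zero] at this
      simp only [Function.comp_apply]
      push_cast
      linear_combination -this
    have := (convex_Icc (0 : ℝ) 1).norm_image_sub_le_of_norm_hasDerivWithin_le
      (C := 0) (x := 0) (y := s) hd (by simp) m0 hs
    rw [zero_mul] at this
    exact sub_eq_zero.1 (norm_le_zero_iff.1 this)
  have hc0 : 0 < c := mul_pos (pow_pos (hVs 0 m0) 2) (hγ.future 0 m0)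
  have he : 0 < c / (S.lapse x₀ * L) := by positivity
  set e := c / (S.lapse x₀ * L) with hedef
  let θ : ℝ → ℝ := fun s => S.lapse x₀ / L * ((γ s).1 - α.1) / e
  refine ⟨fun s => Λ (γ s - (0, x₀)), fun s => Λ (u s), fun s => Λ (b s), θ, e,
    ⟨⟨fun s hs => ?_, fun s hs => ?_, ?_⟩, ?_, ?_, fun s hs => ?_, fun s hs w => ?_, he.le,
      fun s hs => ?_, ?_, ?_, fun s hs => ?_⟩, fun s hs => ?_⟩
  · exact Λ.hasFDerivAt.comp_hasDerivWithinAt s ((hm.pos s hs).sub_const _)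
  · exact Λ.hasFDerivAt.comp_hasDerivWithinAt s (hm.vel s hs)
  · exact Λ.continuous.comp_continuousOn hm.acc
  · apply frameChart_injective (x₀ := x₀) (A := A) hL
    rw [hX, hp, hγ.source]
  · apply frameChart_injective (x₀ := x₀) (A := A) hL
    rw [hX, hq, hγ.target]
  · rw [← frameChart_mem_spaceBall hL hA, hX]
    exact hγ.geodesic.mem s hs
  · have h1 := heq s hs (0, A w)
    have h2 := hnull s hs
    have h3 := (hVs s hs).ne'
    rw [hS.nearlyFlat_k, hS.nearlyFlat_k, hS.nearlyFlat_dk, hS.nearlyFlat_dk, hS.nearlyFlat_dW,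
      hS.nearlyFlat_W, hX]
    rw [← hΛ (u s), ← hΛ (b s)] at h1
    rw [← hΛ (u s)] at h2
    simp only [map_smul, smul_apply, smul_eq_mul, mul_zero, zero_add] at h1 h2
    have h4 : L * (fderiv ℝ S.lapse (γ s).2) (A w) / S.lapse x₀ /
        (S.lapse (γ s).2 / S.lapse x₀) * S.h (γ s).2 (A (Λ (u s))) (A (Λ (u s))) =
        S.lapse (γ s).2 * fderiv ℝ S.lapse (γ s).2 (A w) * (u s).1 ^ 2 / L := by
      field_simp
      linear_combination (fderiv ℝ S.lapse (γ s).2) (A w) * h2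
    rw [h4]
    have h5 := hL.ne'
    field_simp
    linear_combination 2 * h1
  · have h1 := hc s hs
    have h2 := hnull s hs
    rw [← hΛ (u s)] at h2
    simp only [map_smul, smul_apply, smul_eq_mul] at h2
    rw [hS.nearlyFlat_k, hS.nearlyFlat_W, hX, hedef, ← h1]
    field_simp
    linear_combination S.lapse (γ s).2 ^ 2 * h2
  · simp [θ, hγ.source]
  · simp only [θ, hγ.target]
    field_simp
  · have h1 := (((hfst s hs).sub_const α.1).const_mul (S.lapse x₀ / L)).div_const e
    refine h1.congr_deriv ?_
    have h2 := (hVs s hs).ne'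
    rw [hS.nearlyFlat_W, hX, hedef, ← hc s hs]
    have h3 := (hγ.future s hs).ne'
    change (u s).1 ≠ 0 at h3
    field_simp
  · rw [hX]
    refine Prod.ext ?_ rfl
    simp only [θ]
    field_simp
    ring

/-- The time component is rebuilt from `e * θ`. Positive energy excludes constant paths and makes
the signal future-pointing. -/
theorem isNullPath_signal (hS : S.GentlyCurved x₀ L ε) (hL : 0 < L) (hε : 0 ≤ ε)
    (hε' : 2 * ε ≤ 1 / 10 ^ 9) (hA : ∀ u v, S.h x₀ (A u) (A v) = inner ℝ u v)
    {p q : Space3} {T e : ℝ} {z v a : ℝ → Space3} {θ : ℝ → ℝ}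
    (h : (hS.nearlyFlat hL hε hε' hA).IsNullPath p q T z v a θ e) (he : 0 < e) (t : ℝ) :
    IsSignal S (S.tube x₀ (2 * L)) (t, frameChart x₀ L A p)
      (t + L / S.lapse x₀ * T, frameChart x₀ L A q)
      fun s => (t + L / S.lapse x₀ * (e * θ s), frameChart x₀ L A (z s)) := by
  have hV : 0 < S.lapse x₀ := S.lapse_pos x₀ hS.center_mem
  have hball : ∀ s ∈ Icc (0 : ℝ) 1, frameChart x₀ L A (z s) ∈ S.spaceBall x₀ (2 * L) :=
    fun s hs => (frameChart_mem_spaceBall hL hA _).2 (h.inBall s hs)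
  have hdom : ∀ s ∈ Icc (0 : ℝ) 1, frameChart x₀ L A (z s) ∈ S.dom := fun s hs =>
    hS.ball_subset (hball s hs)
  have hVs : ∀ s ∈ Icc (0 : ℝ) 1, 0 < S.lapse (frameChart x₀ L A (z s)) := fun s hs =>
    S.lapse_pos _ (hdom s hs)
  have hz : ∀ s ∈ Icc (0 : ℝ) 1,
      HasDerivWithinAt (fun s => frameChart x₀ L A (z s)) (L • A (v s)) (Icc 0 1) s :=
    fun s hs => (hasFDerivAt_frameChart (z s)).comp_hasDerivWithinAt s (h.pos s hs)
  have hv : ∀ s ∈ Icc (0 : ℝ) 1,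
      HasDerivWithinAt (fun s => L • A (v s)) (L • A (a s)) (Icc 0 1) s :=
    fun s hs => (L • (A : Space3 →L[ℝ] Space3)).hasFDerivAt.comp_hasDerivWithinAt s (h.vel s hs)
  have hW : ∀ s ∈ Icc (0 : ℝ) 1, HasDerivWithinAt (fun s => S.lapse (frameChart x₀ L A (z s)))
      (fderiv ℝ S.lapse (frameChart x₀ L A (z s)) (L • A (v s))) (Icc 0 1) s :=
    fun s hs => (hasFDerivAt_lapse (hdom s hs)).comp_hasDerivWithinAt s (hz s hs)
  have hm : IsMotion (fun s => ((t + L / S.lapse x₀ * (e * θ s), frameChart x₀ L A (z s)) : Event))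
      (fun s => ((L * S.lapse x₀ * e / S.lapse (frameChart x₀ L A (z s)) ^ 2, L • A (v s)) : Event))
      (fun s => ((L * S.lapse x₀ * e * (-(2 * fderiv ℝ S.lapse (frameChart x₀ L A (z s))
        (L • A (v s)))) / S.lapse (frameChart x₀ L A (z s)) ^ 3, L • A (a s)) : Event)) := by
    refine ⟨fun s hs => HasDerivWithinAt.prodMk ?_ (hz s hs),
      fun s hs => HasDerivWithinAt.prodMk ?_ (hv s hs), ContinuousOn.prodMk ?_ ?_⟩
    · refine ((((h.time s hs).const_mul e).const_mul _).const_add t).congr_deriv ?_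
      have := (hVs s hs).ne'
      rw [hS.nearlyFlat_W]
      field_simp
    · have h1 := ((hW s hs).fun_pow 2)
      have h2 := (hVs s hs).ne'
      refine ((hasDerivWithinAt_const s (Icc (0 : ℝ) 1) (L * S.lapse x₀ * e)).fun_div h1
        (pow_ne_zero 2 h2)).congr_deriv ?_
      push_cast
      field_simp
      ring
    · have hzc : ContinuousOn (fun s => frameChart x₀ L A (z s)) (Icc 0 1) := fun s hs =>
        (hz s hs).continuousWithinAt
      have hvc : ContinuousOn (fun s => L • A (v s)) (Icc 0 1) := fun s hs =>
        (hv s hs).continuousWithinAt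
      have hWc : ContinuousOn (fun s => S.lapse (frameChart x₀ L A (z s))) (Icc 0 1) :=
        fun s hs => (hW s hs).continuousWithinAt
      have hdW : ContinuousOn (fun s => fderiv ℝ S.lapse (frameChart x₀ L A (z s))) (Icc 0 1) :=
        (S.lapse_smooth.continuousOn_fderiv_of_isOpen S.isOpen_dom (by simp)).comp hzc hdom
      exact (continuousOn_const.mul (continuousOn_const.mul (hdW.clm_apply hvc)).neg).div
        (hWc.pow 3) fun s hs => pow_ne_zero 3 (hVs s hs).ne'
    · exact (L • (A : Space3 →L[ℝ] Space3)).continuous.comp_continuousOn h.acc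
  have hk : ∀ s ∈ Icc (0 : ℝ) 1, S.lapse (frameChart x₀ L A (z s)) ^ 2 *
      S.h (frameChart x₀ L A (z s)) (A (v s)) (A (v s)) = (S.lapse x₀ * e) ^ 2 := fun s hs => by
    have h1 := h.energy s hs
    rw [hS.nearlyFlat_k, hS.nearlyFlat_W] at h1
    field_simp at h1
    linear_combination h1
  refine ⟨⟨hm.contDiffOn, hball, fun s hs w => ?_⟩, fun s hs => ?_, fun s hs => ?_, ?_, ?_⟩
  · rw [hm.derivWithin_derivWithin_eq hs, hm.derivWithin_eq hs, geodesic_expression (hdom s hs)]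
    have h1 := h.equation s hs (A.symm w.2)
    have h2 := hk s hs
    have h3 := (hVs s hs).ne'
    rw [hS.nearlyFlat_k, hS.nearlyFlat_k, hS.nearlyFlat_dk, hS.nearlyFlat_dk, hS.nearlyFlat_dW,
      hS.nearlyFlat_W, A.apply_symm_apply] at h1
    simp only [map_smul, smul_apply, smul_eq_mul]
    set V := S.lapse (frameChart x₀ L A (z s))
    set K := S.h (frameChart x₀ L A (z s)) (A (v s)) (A (v s))
    have e1 : V ^ 2 * (L * S.lapse x₀ * e * -(2 * (L * fderiv ℝ S.lapse (frameChart x₀ L A (z s))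
        (A (v s)))) / V ^ 3) + 2 * V * (L * fderiv ℝ S.lapse (frameChart x₀ L A (z s))
        (A (v s))) * (L * S.lapse x₀ * e / V ^ 2) = 0 := by
      field_simp
      ring
    have e2 : V * fderiv ℝ S.lapse (frameChart x₀ L A (z s)) w.2 *
        (L * S.lapse x₀ * e / V ^ 2) ^ 2 = L * (L * fderiv ℝ S.lapse (frameChart x₀ L A (z s)) w.2 /
          S.lapse x₀ / (V / S.lapse x₀) * K) := by
      field_simp
      linear_combination -(fderiv ℝ S.lapse (frameChart x₀ L A (z s)) w.2) * h2
    rw [e1, e2]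
    linear_combination L * h1
  · rw [hm.derivWithin_eq hs, S.metric_apply]
    have h2 := hk s hs
    have h3 := (hVs s hs).ne'
    simp only [map_smul, smul_apply, smul_eq_mul]
    field_simp
    linear_combination L ^ 2 * h2
  · rw [hm.derivWithin_eq hs]
    have := hVs s hs
    positivity
  · simp [h.time_zero, h.start]
  · simp [h.time_one, h.finish]

end StaticSpacetime

/-! ### Machines at rest, their ticks and their channels -/

namespace NearlyFlat

theorem HasTime.norm_lt {E : Type*} [NormedAddCommGroup E] [InnerProductSpace ℝ E] {δ : ℝ}
    {G : NearlyFlat E δ} {p q : E} {T : ℝ} (h : G.HasTime p q T) : ‖p‖ < 2 ∧ ‖q‖ < 2 := by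
  obtain ⟨z, v, a, θ, e, h⟩ := h
  exact ⟨h.norm_start_lt, h.norm_finish_lt⟩

end NearlyFlat

namespace OpenMachine

variable {S : StaticSpacetime} {x y x₀ : Space3} {c d p : ℝ} {A B : OpenMachine S}

/-- The coordinate times of the ticks are evenly spaced. -/
def TicksAt (A : OpenMachine S) (c d : ℝ) : Prop := ∀ k : ℤ, (A.event k).1 = c + k * d

theorem hasDerivAt_event (A : OpenMachine S) (ζ : ℝ) : HasDerivAt A.event (deriv A.event ζ) ζ :=
  (A.smooth.differentiable (by simp) ζ).hasDerivAt

theorem hasDerivAt_time (A : OpenMachine S) (ζ : ℝ) :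
    HasDerivAt (fun ζ => (A.event ζ).1) (deriv A.event ζ).1 ζ :=
  (ContinuousLinearMap.fst ℝ ℝ Space3).hasFDerivAt.comp_hasDerivAt ζ (A.hasDerivAt_event ζ)

theorem strictMono_time (A : OpenMachine S) : StrictMono fun ζ => (A.event ζ).1 :=
  strictMono_of_deriv_pos fun ζ => by
    rw [(A.hasDerivAt_time ζ).deriv]
    exact A.future ζ

/-- A clock could in general cover only a bounded interval of coordinate time; evenly spaced ticks
exclude this, by the intermediate value theorem between two ticks. Radar linkability needs it. -/
theorem TicksAt.surjective_time (h : A.TicksAt c d) (hd : 0 < d) :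
    Function.Surjective fun ζ => (A.event ζ).1 := fun t => by
  have hc : Continuous fun ζ => (A.event ζ).1 := continuous_iff_continuousAt.2 fun ζ =>
    (A.hasDerivAt_time ζ).continuousAt
  refine mem_range_of_exists_le_of_exists_ge hc ⟨(⌊(t - c) / d⌋ : ℤ), ?_⟩ ⟨(⌈(t - c) / d⌉ : ℤ), ?_⟩
  · have := Int.floor_le ((t - c) / d)
    rw [le_div_iff₀ hd] at this
    rw [h]
    linarith
  · have := Int.le_ceil ((t - c) / d)
    rw [div_le_iff₀ hd] at this
    rw [h]
    linarith

theorem LocatedAt.event_eq (h : A.LocatedAt x) (ζ : ℝ) : A.event ζ = ((A.event ζ).1, x) :=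
  Prod.ext rfl (h ζ)

/-- At a fixed position the velocity has no space component, so the integrand is the constant lapse
times the rate of coordinate time, whatever the clock does between ticks. -/
theorem LocatedAt.properTime_eq (h : A.LocatedAt x) (ζ ζ' : ℝ) :
    A.properTime ζ ζ' = S.lapse x * ((A.event ζ').1 - (A.event ζ).1) := by
  have hx : 0 < S.lapse x := S.lapse_pos x (h 0 ▸ A.mem 0)
  have h2 : ∀ z, (deriv A.event z).2 = 0 := fun z => by
    have h1 : HasDerivAt (fun ζ => (A.event ζ).2) (deriv A.event z).2 z :=
      (ContinuousLinearMap.snd ℝ ℝ Space3).hasFDerivAt.comp_hasDerivAt z (A.hasDerivAt_event z)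
    have h3 : (fun ζ => (A.event ζ).2) = fun _ => x := funext h
    rw [h3] at h1
    exact h1.unique (hasDerivAt_const z x)
  have e : ∀ z, Real.sqrt (-(S.metric (A.event z) (deriv A.event z) (deriv A.event z))) =
      S.lapse x * (deriv A.event z).1 := fun z => by
    rw [S.metric_apply, h2, h z]
    have := A.future z
    rw [← Real.sqrt_sq (by positivity : 0 ≤ S.lapse x * (deriv A.event z).1)]
    congr 1
    simp
    ring
  rw [properTime]
  simp only [e]
  rw [intervalIntegral.integral_const_mul,
    intervalIntegral.integral_eq_sub_of_hasDerivAt fun z _ => A.hasDerivAt_time z]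
  refine Continuous.intervalIntegrable ?_ _ _
  exact continuous_fst.comp (A.smooth.continuous_deriv (by simp))

theorem HasProperPeriod.ticksAt (hp : A.HasProperPeriod p) (h : A.LocatedAt x) :
    A.TicksAt (A.event 0).1 (p / S.lapse x) := by
  have hx : 0 < S.lapse x := S.lapse_pos x (h 0 ▸ A.mem 0)
  have step : ∀ k : ℤ, (A.event (k + 1)).1 = (A.event k).1 + p / S.lapse x := fun k => by
    have := hp k
    rw [h.properTime_eq] at this
    rw [← this]
    field_simp
    ring
  intro k
  induction k using Int.induction_on with
  | zero => simp
  | succ k ih =>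
    have := step k
    push_cast at *
    rw [this, ih]
    ring
  | pred k ih =>
    have := step (-k - 1)
    push_cast at *
    rw [sub_add_cancel, ih] at this
    linarith

/-- The machine at rest whose ticks are evenly spaced. -/
noncomputable def atRest (S : StaticSpacetime) (x : Space3) (hx : x ∈ S.dom) (c d : ℝ)
    (hd : 0 < d) : OpenMachine S :=
  have h : ∀ ζ, HasDerivAt (fun ζ : ℝ => ((c + ζ * d, x) : Event)) (d, 0) ζ := fun ζ =>
    HasDerivAt.prodMk (by simpa using ((hasDerivAt_id ζ).mul_const d).const_add c)
      (hasDerivAt_const ζ x)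
  { event := fun ζ => (c + ζ * d, x)
    smooth := by fun_prop
    mem := fun _ => hx
    timelike := fun ζ => by
      rw [(h ζ).deriv, S.metric_apply]
      have := S.lapse_pos x hx
      simp
      positivity
    future := fun ζ => by rw [(h ζ).deriv]; exact hd }

theorem atRest_locatedAt (hx : x ∈ S.dom) (hd : 0 < d) : (atRest S x hx c d hd).LocatedAt x :=
  fun _ => rfl

theorem atRest_ticksAt (hx : x ∈ S.dom) (hd : 0 < d) : (atRest S x hx c d hd).TicksAt c d :=
  fun _ => rfl

/-- Signals from `x` to `y` take the coordinate time `τ`, and they are unique. -/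
structure _root_.StaticSpacetime.HasSignalTime (S : StaticSpacetime) (V : Set Event)
    (x y : Space3) (τ : ℝ) : Prop where
  exists_iff : ∀ t t', (∃ γ, IsSignal S V (t, x) (t', y) γ) ↔ t' - t = τ
  unique : ∀ t t' γ γ', IsSignal S V (t, x) (t', y) γ → IsSignal S V (t, x) (t', y) γ' →
    EqOn γ' γ (Icc 0 1)

variable {V : Set Event} {τ : ℝ} {N : ℕ}

theorem reaches_iff (hτ : S.HasSignalTime V x y τ) (hA : A.LocatedAt x) (hB : B.LocatedAt y)
    (ζ ξ : ℝ) : Reaches V A B ζ ξ ↔ (B.event ξ).1 - (A.event ζ).1 = τ := by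
  rw [← hτ.exists_iff, Reaches, ← hA.event_eq, ← hB.event_eq]

/-- The reading `k + N` is a tick and has the right coordinate time; strict monotonicity of the
clock excludes every other reading. -/
theorem reaches_tick_iff (hτ : S.HasSignalTime V x y (N * d)) (hA : A.LocatedAt x)
    (hB : B.LocatedAt y) (hAt : A.TicksAt c d) (hBt : B.TicksAt c d) (k : ℤ) (ξ : ℝ) :
    Reaches V A B k ξ ↔ ξ = k + N := by
  have e : ((k + N : ℤ) : ℝ) = k + N := by push_cast; rfl
  have h := hBt (k + N)
  rw [e] at h
  have hi : (B.event ξ).1 = (B.event (k + N)).1 ↔ ξ = k + N :=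
    B.strictMono_time.injective.eq_iff
  rw [reaches_iff hτ hA hB, hAt, ← hi, h]
  constructor <;> intro h <;> linarith

theorem channel_eq (hτ : S.HasSignalTime V x y (N * d)) (hA : A.LocatedAt x)
    (hB : B.LocatedAt y) (hAt : A.TicksAt c d) (hBt : B.TicksAt c d) :
    channel V A B = {q | ∃ k : ℤ, q = ((k : ℝ), (k : ℝ) + N)} := by
  ext ⟨ζ, ξ⟩
  constructor
  · rintro ⟨⟨k, hk⟩, h⟩
    change ζ = k at hk
    subst hk
    exact ⟨k, Prod.ext rfl ((reaches_tick_iff hτ hA hB hAt hBt k ξ).1 h)⟩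
  · rintro ⟨k, hk⟩
    rw [Prod.mk.injEq] at hk
    obtain ⟨rfl, rfl⟩ := hk
    exact ⟨⟨k, rfl⟩, (reaches_tick_iff hτ hA hB hAt hBt k _).2 rfl⟩

theorem hasEchoCount (hτ : S.HasSignalTime V x y (N * d)) (hτ' : S.HasSignalTime V y x (N * d))
    (hA : A.LocatedAt x) (hB : B.LocatedAt y) (hAt : A.TicksAt c d) (hBt : B.TicksAt c d) :
    HasEchoCount V A B (2 * N) := by
  intro k
  have e : (k : ℝ) + N = ((k + N : ℤ) : ℝ) := by push_cast; rfl
  ext ζ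
  simp only [mem_ofPred_eq, mem_singleton_iff, reaches_tick_iff hτ hA hB hAt hBt,
    exists_eq_left]
  rw [e, reaches_tick_iff hτ' hB hA hBt hAt]
  push_cast
  rw [two_mul, add_assoc]

/-- Both directions are needed: one constructs channels, the other shows that the tenth pair has
none. For the latter, the transmission at tick 0 already determines `τ`. -/
theorem twoWayChannel_iff (hτ : S.HasSignalTime V x y τ) (hτ' : S.HasSignalTime V y x τ)
    (hA : A.LocatedAt x) (hB : B.LocatedAt y) (hAt : A.TicksAt c d) (hBt : B.TicksAt c d) :
    TwoWayChannel V N A B ↔ τ = N * d := by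
  constructor
  · intro h
    have h1 : (((0 : ℤ) : ℝ), ((0 : ℤ) : ℝ) + N) ∈ channel V A B := by
      rw [h.forth]
      exact ⟨0, rfl⟩
    have h2 := (reaches_iff hτ hA hB _ _).1 h1.2
    have h3 := hBt N
    have h4 := hAt 0
    push_cast at h2 h3 h4
    rw [zero_add, h3, h4] at h2
    linarith
  · rintro rfl
    exact ⟨channel_eq hτ hA hB hAt hBt, channel_eq hτ' hB hA hBt hAt,
      hasEchoCount hτ hτ' hA hB hAt hBt, hasEchoCount hτ' hτ hB hA hBt hAt⟩

theorem radarLinkable (hτ : S.HasSignalTime V x y τ) (hτ' : S.HasSignalTime V y x τ)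
    (hA : A.LocatedAt x) (hB : B.LocatedAt y) (hBt : B.TicksAt c d) (hd : 0 < d) (U : Set Event) :
    RadarLinkable U V A B := by
  intro ζ _
  constructor
  · obtain ⟨ξ, hξ⟩ := hBt.surjective_time hd ((A.event ζ).1 - τ)
    change (B.event ξ).1 = _ at hξ
    obtain ⟨γ, hγ⟩ := (reaches_iff hτ' hB hA ξ ζ).2 (by rw [hξ]; ring)
    refine ⟨ξ, γ, hγ, fun ξ' γ' hγ' => ?_⟩
    have h1 := (reaches_iff hτ' hB hA ξ' ζ).1 ⟨γ', hγ'⟩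
    obtain rfl : ξ' = ξ := B.strictMono_time.injective (by linarith)
    rw [hA.event_eq, hB.event_eq] at hγ hγ'
    exact ⟨rfl, hτ'.unique _ _ _ _ hγ hγ'⟩
  · obtain ⟨ξ, hξ⟩ := hBt.surjective_time hd ((A.event ζ).1 + τ)
    change (B.event ξ).1 = _ at hξ
    obtain ⟨γ, hγ⟩ := (reaches_iff hτ hA hB ζ ξ).2 (by rw [hξ]; ring)
    refine ⟨ξ, γ, hγ, fun ξ' γ' hγ' => ?_⟩
    have h1 := (reaches_iff hτ hA hB ζ ξ').1 ⟨γ', hγ'⟩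
    obtain rfl : ξ' = ξ := B.strictMono_time.injective (by linarith)
    rw [hA.event_eq, hB.event_eq] at hγ hγ'
    exact ⟨rfl, hτ.unique _ _ _ _ hγ hγ'⟩

end OpenMachine

/-! ### Signal times and the structure of tetrahedral arrangements -/

namespace StaticSpacetime

variable {S : StaticSpacetime} {x₀ : Space3} {L ε : ℝ} {A : Space3 ≃L[ℝ] Space3}

theorem hasTime_of_signal (hS : S.GentlyCurved x₀ L ε) (hL : 0 < L) (hε : 0 ≤ ε)
    (hε' : 2 * ε ≤ 1 / 10 ^ 9) (hA : ∀ u v, S.h x₀ (A u) (A v) = inner ℝ u v)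
    {α β : Event} {γ : ℝ → Event} (hγ : IsSignal S (S.tube x₀ (2 * L)) α β γ) {p q : Space3}
    (hp : frameChart x₀ L A p = α.2) (hq : frameChart x₀ L A q = β.2) :
    (hS.nearlyFlat hL hε hε' hA).HasTime p q ((β.1 - α.1) * (S.lapse x₀ / L)) := by
  obtain ⟨z, v, a, θ, e, h, -⟩ := signal_isNullPath hS hL hε hε' hA hγ hp hq
  exact ⟨z, v, a, θ, e, h⟩

theorem hasSignalTime (hS : S.GentlyCurved x₀ L ε) (hL : 0 < L) (hε : 0 ≤ ε)
    (hε' : 2 * ε ≤ 1 / 10 ^ 9) (hA : ∀ u v, S.h x₀ (A u) (A v) = inner ℝ u v)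
    {p q : Space3} {T : ℝ} (h : (hS.nearlyFlat hL hε hε' hA).HasTime p q T) (hT : 0 < T) :
    S.HasSignalTime (S.tube x₀ (2 * L)) (frameChart x₀ L A p) (frameChart x₀ L A q)
      (L / S.lapse x₀ * T) := by
  have hV : 0 < S.lapse x₀ := S.lapse_pos x₀ hS.center_mem
  refine ⟨fun t t' => ⟨fun ⟨γ, hγ⟩ => ?_, fun ht => ?_⟩, fun t t' γ γ' hγ hγ' => ?_⟩
  · rw [h.unique (hasTime_of_signal hS hL hε hε' hA hγ rfl rfl)]
    field_simp
  · obtain ⟨z, v, a, θ, e, h⟩ := h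
    have he : 0 < e := h.energy_nonneg.lt_of_ne' (by
      rintro rfl
      have := h.time_one
      linarith)
    have := isNullPath_signal hS hL hε hε' hA h he t
    rw [← ht, add_sub_cancel] at this
    exact ⟨_, this⟩
  · obtain ⟨z, v, a, θ, e, h1, h2⟩ := signal_isNullPath hS hL hε hε' hA hγ (p := p) (q := q) rfl rfl
    obtain ⟨z', v', a', θ', e', h1', h2'⟩ :=
      signal_isNullPath hS hL hε hε' hA hγ' (p := p) (q := q) rfl rfl
    obtain ⟨-, he, hz, hθ⟩ := h1.unique h1'
    intro s hs
    rw [h2 s hs, h2' s hs, he, hz hs, hθ hs]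

end StaticSpacetime

theorem frameChart_zero {x₀ : Space3} {L : ℝ} {A : Space3 ≃L[ℝ] Space3} :
    frameChart x₀ L A 0 = x₀ := by simp [frameChart]

theorem sOppSide_frameChart {x₀ : Space3} {L : ℝ} {A : Space3 ≃L[ℝ] Space3} (hL : 0 < L)
    {s : Set Space3} {o y : Space3} (h : (affineSpan ℝ s).SOppSide o y) :
    (affineSpan ℝ (frameChart x₀ L A '' s)).SOppSide (frameChart x₀ L A o)
      (frameChart x₀ L A y) := by
  let f : Space3 →ᵃ[ℝ] Space3 :=
    { toFun := frameChart x₀ L A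
      linear := L • (A : Space3 →L[ℝ] Space3).toLinearMap
      map_vadd' := fun p v => by
        simp [frameChart]
        abel }
  have hf : Function.Injective f := frameChart_injective hL
  have := (hf.sOppSide_map_iff (s := affineSpan ℝ s) (x := o) (y := y)).2 h
  rwa [AffineSubspace.map_span] at this

namespace StaticSpacetime

variable {S : StaticSpacetime} {x₀ : Space3} {ε p : ℝ} {N : ℕ} {F : Space3 ≃L[ℝ] Space3}

/-- In a tetrahedral arrangement all ticks are synchronous, and all travel times are equal. -/
theorem tetrahedralArrangement_times (hp : 0 < p) (hS : S.GentlyCurved x₀ (N * p) ε)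
    (hL : 0 < (N : ℝ) * p) (hε : 0 ≤ ε) (hε' : 2 * ε ≤ 1 / 10 ^ 9)
    (hF : ∀ u v, S.h x₀ (F u) (F v) = inner ℝ u v) {A : Fin 4 → OpenMachine S}
    {z : Fin 4 → Space3} (hz : z 0 = 0)
    (hA : IsTetrahedralArrangement (S.tube x₀ (2 * (N * p))) N p A
      fun i => frameChart x₀ (N * p) F (z i)) :
    (∃ c, ∀ i, (A i).TicksAt c (p / S.lapse x₀)) ∧
      ∀ i j, i ≠ j → (hS.nearlyFlat hL hε hε' hF).HasTime (z i) (z j) 1 := by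
  have hV : 0 < S.lapse x₀ := S.lapse_pos x₀ hS.center_mem
  set d := p / S.lapse x₀ with hd
  have hd0 : 0 < d := by positivity
  have hLd : S.lapse x₀ / (N * p) = 1 / (N * d) := by rw [hd]; field_simp
  have hN : 0 < (N : ℝ) := pos_of_mul_pos_left hL hp.le
  have h0 := hA.period.ticksAt (hA.located 0)
  rw [hz, frameChart_zero] at h0
  set c := ((A 0).event 0).1
  have hlink : ∀ i j, i ≠ j → ∀ k : ℤ, (hS.nearlyFlat hL hε hε' hF).HasTime (z i) (z j)
      ((((A j).event ((k + N : ℤ) : ℝ)).1 - ((A i).event k).1) * (1 / (N * d))) :=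
    fun i j hij k => by
      have h1 : ((k : ℝ), (k : ℝ) + N) ∈
          OpenMachine.channel (S.tube x₀ (2 * (N * p))) (A i) (A j) := by
        rw [(hA.linked i j hij).forth]
        exact ⟨k, rfl⟩
      obtain ⟨-, γ, hγ⟩ := h1
      have := hasTime_of_signal hS hL hε hε' hF hγ (p := z i) (q := z j)
        (hA.located i k).symm (hA.located j _).symm
      rw [hLd] at this
      push_cast
      exact this
  have ht : ∀ i, (A i).TicksAt c d := fun i k => by
    by_cases hi : i = 0
    · rw [hi]; exact h0 k
    · have h1 := (hlink 0 i (Ne.symm hi) (k - N)).unique (hlink i 0 hi k).symm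
      have h2 := mul_right_cancel₀ (by positivity) h1
      rw [h0, h0, sub_add_cancel] at h2
      push_cast at h2
      linarith
  refine ⟨⟨c, ht⟩, fun i j hij => ?_⟩
  have := hlink i j hij 0
  rw [ht, ht] at this
  push_cast at this
  convert this using 1
  field_simp
  ring

/-- Four machines at rest at unit travel times are a tetrahedral arrangement. -/
theorem exists_tetrahedralArrangement (hp : 0 < p) (hS : S.GentlyCurved x₀ (N * p) ε)
    (hL : 0 < (N : ℝ) * p) (hε : 0 ≤ ε) (hε' : 2 * ε ≤ 1 / 10 ^ 9)
    (hF : ∀ u v, S.h x₀ (F u) (F v) = inner ℝ u v) :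
    ∃ (A : Fin 4 → OpenMachine S) (x : Fin 4 → Space3), x 0 = x₀ ∧
      IsTetrahedralArrangement (S.tube x₀ (2 * (N * p))) N p A x := by
  have hV : 0 < S.lapse x₀ := S.lapse_pos x₀ hS.center_mem
  have hd : 0 < p / S.lapse x₀ := by positivity
  obtain ⟨z, hz0, hz⟩ := (hS.nearlyFlat hL hε hε' hF).exists_isTetrahedron
  have hdom : ∀ i, frameChart x₀ (N * p) F (z i) ∈ S.dom := fun i => by
    obtain ⟨j, hij⟩ := exists_ne i
    exact hS.ball_subset ((frameChart_mem_spaceBall hL hF _).2 (hz i j hij.symm).norm_lt.1)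
  have hτ : ∀ i j, i ≠ j → S.HasSignalTime (S.tube x₀ (2 * (N * p)))
      (frameChart x₀ (N * p) F (z i)) (frameChart x₀ (N * p) F (z j))
      (N * p / S.lapse x₀ * 1) := fun i j hij =>
    hasSignalTime hS hL hε hε' hF (hz i j hij) one_pos
  refine ⟨fun i => OpenMachine.atRest S _ (hdom i) 0 _ hd, fun i => frameChart x₀ (N * p) F (z i),
    (congrArg _ hz0).trans frameChart_zero, fun i => OpenMachine.atRest_locatedAt _ _, fun k => ?_,
    fun i j hij => ?_⟩
  · have e : frameChart x₀ (N * p) F (z 0) = x₀ := (congrArg _ hz0).trans frameChart_zero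
    rw [(OpenMachine.atRest_locatedAt (c := 0) (hdom 0) hd).properTime_eq]
    have h1 := OpenMachine.atRest_ticksAt (c := 0) (hdom 0) hd
    have h2 := h1 k
    have h3 := h1 (k + 1)
    push_cast at h3
    rw [h2, h3, e]
    field_simp
    ring
  · refine (OpenMachine.twoWayChannel_iff (hτ i j hij) (hτ j i hij.symm)
      (OpenMachine.atRest_locatedAt _ _) (OpenMachine.atRest_locatedAt _ _)
      (OpenMachine.atRest_ticksAt _ _) (OpenMachine.atRest_ticksAt _ _)).2 ?_
    ring

end StaticSpacetime

namespace NearlyFlat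

variable {δ : ℝ} {G : NearlyFlat Space3 δ}

/-- The travel times between the vertices of a tetrahedron and the point opposite to the vertex
`l`. -/
theorem snoc_hasTime {z : Fin 4 → Space3} {y : Space3} {l : Fin 4} (hz0 : z 0 = 0)
    (hz : ∀ i j, i ≠ j → G.HasTime (z i) (z j) 1) (hy : ‖y‖ ≤ 9 / 5)
    (hyz : ∀ i, i ≠ l → G.HasTime (z i) y 1) (hyl : 2 ≤ ‖y - z l‖ ^ 2) (i j : Fin 5)
    (hij : i ≠ j) :
    ∃ T, 0 < T ∧ G.HasTime (Fin.snoc (α := fun _ => Space3) z y i)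
      (Fin.snoc (α := fun _ => Space3) z y j) T ∧
      (T = 1 ↔ ¬ ((i = l.castSucc ∧ j = Fin.last 4) ∨ (i = Fin.last 4 ∧ j = l.castSucc))) := by
  have hzl : ‖z l‖ ≤ 9 / 5 := by
    by_cases hl : l = 0
    · rw [hl, hz0, norm_zero]; norm_num
    · have := (abs_le.1 (hz 0 l (Ne.symm hl)).abs_sq_sub_one_le).2
      rw [hz0, sub_zero] at this
      refine le_of_sq_le_sq ?_ (by norm_num)
      norm_num at *
      linarith
  obtain ⟨T, hT⟩ := G.exists_hasTime hzl hy
  have hne : ∀ i : Fin 4, i.castSucc ≠ Fin.last 4 := fun i => (Fin.castSucc_lt_last i).ne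
  have hne' : ∀ i : Fin 4, Fin.last 4 ≠ i.castSucc := fun i => (Fin.castSucc_lt_last i).ne'
  have hT0 := hT.nonneg
  -- The squared distance is at least 2 and differs little from `T ^ 2`, so this pair cannot have
  -- travel time 1.
  have hT1 : 1 < T := by
    have := (abs_le.1 hT.abs_sq_sub_le).2
    norm_num at this
    nlinarith
  induction i using Fin.lastCases with
  | last =>
    induction j using Fin.lastCases with
    | last => exact absurd rfl hij
    | cast j =>
      simp only [Fin.snoc_last, Fin.snoc_castSucc]
      by_cases hj : j = l
      · subst hj
        exact ⟨T, by linarith, hT.symm, by simp [hT1.ne']⟩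
      · exact ⟨1, one_pos, (hyz j hj).symm, by simp [hj, hne, hne', -Fin.reduceLast]⟩
  | cast i =>
    induction j using Fin.lastCases with
    | last =>
      simp only [Fin.snoc_last, Fin.snoc_castSucc]
      by_cases hi : i = l
      · subst hi
        exact ⟨T, by linarith, hT, by simp [hT1.ne']⟩
      · exact ⟨1, one_pos, hyz i hi, by simp [hi, hne, hne', -Fin.reduceLast]⟩
    | cast j =>
      simp only [Fin.snoc_castSucc]
      refine ⟨1, one_pos, hz i j fun h => hij (by rw [h]), ?_⟩
      simp [hne, -Fin.reduceLast]

end NearlyFlat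

/-! ### The main theorem -/

theorem ncard_pairs_but_one (l : Fin 4) :
    {q : Fin 5 × Fin 5 | q.1 < q.2 ∧ ¬ (q.1 = l.castSucc ∧ q.2 = Fin.last 4)}.ncard = 9 := by
  rw [Set.ncard_eq_toFinset_card']
  fin_cases l <;> decide

theorem mainTheorem2 :
    ∃ ε : ℝ, 0 < ε ∧
      ∀ (S : StaticSpacetime) (x₀ : Space3) (N : ℕ) (p : ℝ), 1 ≤ N → 0 < p →
        S.GentlyCurved x₀ (N * p) ε →
        (∃ (A : Fin 4 → OpenMachine S) (x : Fin 4 → Space3), x 0 = x₀ ∧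
          IsTetrahedralArrangement (S.tube x₀ (2 * (N * p))) N p A x) ∧
        ∀ (A : Fin 4 → OpenMachine S) (x : Fin 4 → Space3), x 0 = x₀ →
          IsTetrahedralArrangement (S.tube x₀ (2 * (N * p))) N p A x →
          ∀ l : Fin 4, ∃ (B : OpenMachine S) (y : Space3),
            B.LocatedAt y ∧
            (∀ i, i ≠ l → OpenMachine.TwoWayChannel (S.tube x₀ (2 * (N * p))) N B (A i)) ∧
            (affineSpan ℝ (x '' {i | i ≠ l})).SOppSide (x l) y ∧
            (∀ i j : Fin 5, i ≠ j →
              OpenMachine.RadarLinkable (S.tube x₀ (2 * (N * p))) (S.tube x₀ (2 * (N * p)))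
                (Fin.snoc (α := fun _ => OpenMachine S) A B i)
                (Fin.snoc (α := fun _ => OpenMachine S) A B j)) ∧
            {q : Fin 5 × Fin 5 | q.1 < q.2 ∧
              OpenMachine.TwoWayChannel (S.tube x₀ (2 * (N * p))) N
                (Fin.snoc (α := fun _ => OpenMachine S) A B q.1)
                (Fin.snoc (α := fun _ => OpenMachine S) A B q.2)}.ncard = 9 := by
  -- Chosen so that `2 * ε` is exactly the bound `1 / 10 ^ 9` required by `NearlyFlat`.
  refine ⟨1 / (2 * 10 ^ 9), by positivity, fun S x₀ N p hN hp hS => ?_⟩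
  have hε : (0 : ℝ) ≤ 1 / (2 * 10 ^ 9) := by positivity
  have hε' : 2 * (1 / (2 * 10 ^ 9)) ≤ (1 / 10 ^ 9 : ℝ) := by norm_num
  have hNp : 0 < (N : ℝ) := by exact_mod_cast hN
  have hL : 0 < (N : ℝ) * p := by positivity
  have hV : 0 < S.lapse x₀ := S.lapse_pos x₀ hS.center_mem
  obtain ⟨F, hF⟩ := exists_orthonormal_frame (S.h x₀) (S.h_symm x₀ hS.center_mem)
    (S.h_pos x₀ hS.center_mem)
  refine ⟨StaticSpacetime.exists_tetrahedralArrangement hp hS hL hε hε' hF,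
    fun A x hx hA l => ?_⟩
  obtain ⟨z, rfl⟩ : ∃ z : Fin 4 → Space3, (fun i => frameChart x₀ (N * p) F (z i)) = x := by
    choose z hz using fun i => frameChart_surjective (x₀ := x₀) (A := F) hL (x i)
    exact ⟨z, funext hz⟩
  have hz0 : z 0 = 0 := frameChart_injective (x₀ := x₀) (A := F) hL (hx.trans frameChart_zero.symm)
  obtain ⟨⟨c, hc⟩, hz⟩ :=
    StaticSpacetime.tetrahedralArrangement_times hp hS hL hε hε' hF hz0 hA
  have hd : 0 < p / S.lapse x₀ := by positivity
  obtain ⟨y, hy, hyz, hside, hyl⟩ := NearlyFlat.exists_opposite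
    (hS.nearlyFlat hL hε hε' hF) (p := z ∘ l.succAbove) (o := z l)
    (fun i j hij => hz _ _ (l.succAbove_right_injective.ne hij))
    (fun i => hz _ _ (l.succAbove_ne i).symm) (by
      by_cases hl : l = 0
      · exact Or.inl (by rw [hl, hz0])
      · obtain ⟨i, hi⟩ := Fin.exists_succAbove_eq (Ne.symm hl)
        exact Or.inr ⟨i, by rw [Function.comp_apply, hi, hz0]⟩)
  have hyz' : ∀ i, i ≠ l → (hS.nearlyFlat hL hε hε' hF).HasTime (z i) y 1 := fun i hi => by
    obtain ⟨k, rfl⟩ := Fin.exists_succAbove_eq hi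
    exact hyz k
  have hdom : frameChart x₀ (N * p) F y ∈ S.dom :=
    hS.ball_subset ((StaticSpacetime.frameChart_mem_spaceBall hL hF _).2 (by linarith))
  -- The fifth machine is given the common phase `c` and the common spacing of ticks of the other
  -- four.
  let B := OpenMachine.atRest S _ hdom c _ hd
  have hloc : ∀ i : Fin 5, (Fin.snoc (α := fun _ => OpenMachine S) A B i).LocatedAt
      (frameChart x₀ (N * p) F (Fin.snoc (α := fun _ => Space3) z y i)) := fun i => by
    induction i using Fin.lastCases with
    | last =>
      simp only [Fin.snoc_last]
      exact OpenMachine.atRest_locatedAt hdom hd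
    | cast i =>
      simp only [Fin.snoc_castSucc]
      exact hA.located i
  have htick : ∀ i : Fin 5, (Fin.snoc (α := fun _ => OpenMachine S) A B i).TicksAt c
      (p / S.lapse x₀) := fun i => by
    induction i using Fin.lastCases with
    | last =>
      simp only [Fin.snoc_last]
      exact OpenMachine.atRest_ticksAt hdom hd
    | cast i =>
      simp only [Fin.snoc_castSucc]
      exact hc i
  have htime := NearlyFlat.snoc_hasTime hz0 hz hy hyz' hyl
  have hiff : ∀ i j : Fin 5, i ≠ j → (OpenMachine.TwoWayChannel (S.tube x₀ (2 * (N * p))) N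
      (Fin.snoc (α := fun _ => OpenMachine S) A B i)
      (Fin.snoc (α := fun _ => OpenMachine S) A B j) ↔
      ¬ ((i = l.castSucc ∧ j = Fin.last 4) ∨ (i = Fin.last 4 ∧ j = l.castSucc))) :=
    fun i j hij => by
      obtain ⟨T, hT, h1, h2⟩ := htime i j hij
      rw [← h2, OpenMachine.twoWayChannel_iff
        (StaticSpacetime.hasSignalTime hS hL hε hε' hF h1 hT)
        (StaticSpacetime.hasSignalTime hS hL hε hε' hF h1.symm hT) (hloc i) (hloc j) (htick i)
        (htick j)]
      field_simp
  refine ⟨B, _, OpenMachine.atRest_locatedAt hdom hd, fun i hi => ?_, ?_, fun i j hij => ?_, ?_⟩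
  · have := (hiff (Fin.last 4) i.castSucc (Fin.castSucc_lt_last i).ne').2 (by
      simp [hi, (Fin.castSucc_lt_last l).ne', -Fin.reduceLast])
    simpa only [Fin.snoc_last, Fin.snoc_castSucc] using this
  · have := sOppSide_frameChart (x₀ := x₀) (A := F) hL hside
    rw [range_comp, Fin.range_succAbove, image_image] at this
    exact this
  · obtain ⟨T, hT, h1, -⟩ := htime i j hij
    exact OpenMachine.radarLinkable (StaticSpacetime.hasSignalTime hS hL hε hε' hF h1 hT)
      (StaticSpacetime.hasSignalTime hS hL hε hε' hF h1.symm hT) (hloc i) (hloc j) (htick j) hd _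
  · rw [← ncard_pairs_but_one l]
    congr 1
    ext ⟨i, j⟩
    refine and_congr_right fun hij => ?_
    change i < j at hij
    rw [hiff i j hij.ne]
    -- Unordered pairs are counted by `i < j`, and the fifth machine has the last index, so the
    -- failing pair occurs in one order only.
    have : ¬ (i = Fin.last 4 ∧ j = l.castSucc) := fun h =>
      absurd hij (by rw [h.1]; exact (Fin.le_last j).not_gt)
    simp [this, -Fin.reduceLast]
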